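/- **Setting.** Let $L^2_+(\mathbb R)$ be the Hardy space of all $f\in L^2(\mathbb R)$ whose Fourier transform vanishes a.e. on $(-\infty,0)$, let $C_+$ be the orthogonal projection of $L^2(\mathbb R)$ onto it, and for $s\ge 0$ let $L^2_{s,+}(\mathbb R)=\{f\in L^2_+(\mathbb R): (1+x^2)^{s/2}f\in L^2(\mathbb R)\}$. Write $\langle f,g\rangle=\int_{\mathbb R} f\overline g\,dx$, $\mathrm e(\lambda)(x)=e^{i\lambda x}$ and $\mathbb R_+=(0,\infty)$. For $q\in L^2_+(\mathbb R)$ let $L_q=-i\partial_x-qC_+\overline q$ in $L^2_+(\mathbb R)$ with domain $H^1(\mathbb R)\cap L^2_+(\mathbb R)$, and let $\sigma_{\mathrm p}(L_q)\subset\mathbb R$ be its set of eigenvalues (which may be embedded in $[0,\infty)$). Let $\widehat{\mathbb C}=(\mathbb C\setminus\mathbb R_+)\cup(\mathbb R_++0i)\cup(\mathbb R_+-0i)$ be the plane cut along $\mathbb R_+$ with both edges of the cut attached: basic neighbourhoods of $\lambda\pm0i$, $\lambda>0$, are the half discs of small radius $\varepsilon$ about $\lambda$ on the respective side, and those of any other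 point $k$ are the discs $\{z\in\widehat{\mathbb C}:|z-k|<\varepsilon\}$. For $\lambda\le 0$, $\lambda\pm 0i$ means $\lambda$. For $E\subset\mathbb R$ put $E^\diamond=(E+0i)\cup(E-0i)$. For $k\in\widehat{\mathbb C}$ let $R_0(k)f=G_k*f$, where $G_k(x)=\pm i e^{ikx}\chi_{\mathbb R_\pm}(x)$ if $k=\lambda\pm i\mu$, $\mu\ge0$ (for $k\in(-\infty,0]$ the two choices give the same result on integrable functions with Fourier transform supported in $[0,\infty)$), and $$R(k)=R_0(k)+R_0(k)qC_+\bigl(1-C_+\overline qR_0(k)qC_+\bigr)^{-1}C_+\overline qR_0(k)$$ whenever $1-C_+\overline qR_0(k)qC_+$ is boundedly invertible on $L^2_+(\mathbb R)$. Put $$m_0(k)=R(k)q,\qquad m_{\mathrm e}(\lambda\pm0i)=\mathrm e(\lambda)+R(\lambda\pm0i)\,qC_+\overline q\,\mathrm e(\lambda),$$ as elements of $L^\infty(\mathbb R)$. **Theorem.** Let $q\in L^2_{s,+}(\mathbb R)$ for some $s>1/2$. Then $q\in L^1(\mathbb R)$; $L_q$ has finitely many eigenvalues $\lambda_1,\dots,\lambda_N$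 (pairwise distinct); for each $j$ there is a unique eigenfunction $\phi_j$ with eigenvalue $\lambda_j$ normalised by $\langle q,\phi_j\rangle=2\pi i$; and $1-C_+\overline qR_0(k)qC_+$ is boundedly invertible for all $k\in\widehat{\mathbb C}\setminus\sigma_{\mathrm p}(L_q)^\diamond$, so that $m_0(k)$ is defined for these $k$ and $m_{\mathrm e}(\lambda\pm0i)$ for all $\lambda\in[0,\infty)\setminus\sigma_{\mathrm p}(L_q)$. Moreover: (a) There is a unique map $h:\widehat{\mathbb C}\to L^\infty(\mathbb R)$ that is continuous for the weak-$*$ topology (that is, $k\mapsto\langle h(k),f\rangle$ is continuous on $\widehat{\mathbb C}$ for every $f\in L^1(\mathbb R)$) and satisfies $$m_0(k)=-i\sum_{j=1}^N\frac{\phi_j}{k-\lambda_j}+h(k)\qquad\text{for all }k\in\widehat{\mathbb C}\setminus\sigma_{\mathrm p}(L_q)^\diamond .$$ (b) For either choice of sign, the map $\lambda\mapsto\overline{\mathrm e(\lambda)}\,m_{\mathrm e}(\lambda\pm0i)$, defined on $\mathbb R_+\setminus\sigma_{\mathrm p}(L_q)$, has a unique extension to a norm-continuous map $\mathbb R_+\to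 L^\infty(\mathbb R)$, and $$\bigl\|\overline{\mathrm e(\lambda)}\,m_{\mathrm e}(\lambda\pm0i)-1\bigr\|_{L^\infty(\mathbb R)}\to0\qquad\text{as }\lambda\to0+ .$$ -/

import Mathlib

open MeasureTheory Complex Filter Topology FourierTransform
open scoped ENNReal ComplexConjugate ContDiff

namespace CalogeroMoser

noncomputable section

/-! ### The spaces -/

/-- `L¹(ℝ)`, complex valued. -/
abbrev L1 : Type := Lp ℂ 1 (volume : Measure ℝ)

/-- `L²(ℝ)`, complex valued. -/
abbrev L2 : Type := Lp ℂ 2 (volume : Measure ℝ)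

/-- `L^∞(ℝ)`, complex valued. -/
abbrev LInf : Type := Lp ℂ ∞ (volume : Measure ℝ)

/-- The Hardy space `L²₊(ℝ)`: the functions in `L²(ℝ)` whose Fourier transform is supported
in `[0, ∞)`, that is, vanishes almost everywhere on `(-∞, 0)`. -/
def hardy : Submodule ℂ L2 :=
  LinearMap.ker
    ((LpToLpRestrictCLM ℝ ℂ ℂ volume 2 (Set.Iio (0 : ℝ))).comp
      (Lp.fourierTransformₗᵢ ℝ ℂ).toContinuousLinearEquiv.toContinuousLinearMap).toLinearMap

theorem mem_hardy_iff (f : L2) :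
    f ∈ hardy ↔ ∀ᵐ ξ ∂(volume : Measure ℝ), ξ < 0 → (𝓕 f : L2) ξ = 0 := by
  have h1 : f ∈ hardy ↔
      LpToLpRestrictCLM ℝ ℂ ℂ volume 2 (Set.Iio (0 : ℝ)) (𝓕 f : L2) = 0 := Iff.rfl
  have h2 := LpToLpRestrictCLM_coeFn (μ := (volume : Measure ℝ)) (p := 2) ℂ (Set.Iio (0 : ℝ))
    (𝓕 f : L2)
  have h3 : (∀ᵐ ξ ∂(volume : Measure ℝ), ξ < 0 → (𝓕 f : L2) ξ = 0) ↔
      ∀ᵐ ξ ∂(volume : Measure ℝ).restrict (Set.Iio 0), (𝓕 f : L2) ξ = 0 :=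
    (ae_restrict_iff' measurableSet_Iio).symm
  rw [h1, Lp.eq_zero_iff_ae_eq_zero, h3]
  constructor
  · intro h
    filter_upwards [h, h2] with x hx hx2
    rw [← hx2, hx]; rfl
  · intro h
    filter_upwards [h, h2] with x hx hx2
    rw [hx2, hx]; rfl

theorem isClosed_hardy : IsClosed (hardy : Set L2) :=
  ContinuousLinearMap.isClosed_ker
    ((LpToLpRestrictCLM ℝ ℂ ℂ volume 2 (Set.Iio (0 : ℝ))).comp
      (Lp.fourierTransformₗᵢ ℝ ℂ).toContinuousLinearEquiv.toContinuousLinearMap)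

instance : CompleteSpace hardy := isClosed_hardy.completeSpace_coe

/-- The Cauchy–Szegő projector `C₊`: the orthogonal projection of `L²(ℝ)` onto `L²₊(ℝ)`. -/
def szego : L2 →L[ℂ] hardy := hardy.orthogonalProjectionOnto

/-- The weight condition `⟨x⟩ˢ q ∈ L²(ℝ)`, with `⟨x⟩ = (1 + x²)^{1/2}`. -/
def MemWeighted (s : ℝ) (q : L2) : Prop :=
  MemLp (fun x : ℝ => ((Real.sqrt (1 + x ^ 2) ^ s : ℝ) : ℂ) * q x) 2 volume

/-- By Hölder's inequality, `⟨x⟩ˢ q ∈ L²` with `s > 1/2` implies `q ∈ L¹`. -/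
theorem MemWeighted.memLp_one {s : ℝ} (hs : 1 / 2 < s) {q : L2} (hq : MemWeighted s q) :
    MemLp q 1 volume := by
  have hpos : ∀ x : ℝ, 0 < Real.sqrt (1 + x ^ 2) := fun x => Real.sqrt_pos.2 (by positivity)
  have hcont : Continuous fun x : ℝ => ((Real.sqrt (1 + x ^ 2) ^ (-s) : ℝ) : ℂ) := by
    refine continuous_ofReal.comp (Continuous.rpow_const (by fun_prop) fun x => ?_)
    exact Or.inl (hpos x).ne'
  have hw : MemLp (fun x : ℝ => ((Real.sqrt (1 + x ^ 2) ^ (-s) : ℝ) : ℂ)) 2 volume := by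
    rw [memLp_two_iff_integrable_sq_norm hcont.aestronglyMeasurable]
    have h := integrable_rpow_neg_one_add_norm_sq (E := ℝ) (μ := volume) (r := 2 * s)
      (by simp; linarith)
    refine h.congr (ae_of_all _ fun x => ?_)
    have h1 : (0 : ℝ) ≤ 1 + x ^ 2 := by positivity
    simp only [norm_real, Real.norm_eq_abs, sq_abs]
    have h2 : (Real.sqrt (1 + x ^ 2) ^ (-s)) ^ 2 = Real.sqrt (1 + x ^ 2) ^ (-s * (2 : ℕ)) := by
      rw [Real.rpow_mul (hpos x).le, Real.rpow_natCast]
    rw [h2, Real.sqrt_eq_rpow, ← Real.rpow_mul h1]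
    congr 1
    push_cast
    ring
  have h := MemLp.mul (p := 2) (q := 2) (r := 1) hq hw
  refine (memLp_congr_ae (ae_of_all _ fun x => ?_)).1 h
  simp only [Pi.mul_apply]
  rw [← mul_assoc, ← ofReal_mul, ← Real.rpow_add (hpos x)]
  simp

/-! ### The operator `L_q = -i ∂ₓ - q C₊ q̄` in `L²₊(ℝ)` -/

/-- `g ∈ L²` is the weak derivative of `f ∈ L²`. -/
def HasWeakDeriv (f g : L2) : Prop :=
  ∀ χ : ℝ → ℂ, ContDiff ℝ ∞ χ → HasCompactSupport χ →
    ∫ x, f x * deriv χ x = -∫ x, g x * χ x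

/-- The graph of `L_q`: `φ` lies in the domain `H¹₊(ℝ) = H¹(ℝ) ∩ L²₊(ℝ)` and
`L_q φ = -i φ' - q C₊(q̄ φ) = ψ`. Here `u` is the product `q̄ φ`, which lies in `L²`
since functions in `H¹` are bounded. -/
def IsLaxImage (q : L2) (φ ψ : hardy) : Prop :=
  ∃ dφ u : L2, HasWeakDeriv (φ : L2) dφ ∧
    (∀ᵐ x ∂(volume : Measure ℝ), u x = conj (q x) * (φ : L2) x) ∧
    ∀ᵐ x ∂(volume : Measure ℝ), (ψ : L2) x = -I * dφ x - q x * (szego u : L2) x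

/-- `φ` is an eigenfunction of `L_q` with eigenvalue `lam`. As `L_q` is self-adjoint, only
real eigenvalues are considered. -/
def IsEigenfunction (q : L2) (lam : ℝ) (φ : hardy) : Prop :=
  φ ≠ 0 ∧ IsLaxImage q φ ((lam : ℂ) • φ)

/-- The set `σ_p(L_q)` of eigenvalues of `L_q`. -/
def pointSpectrum (q : L2) : Set ℝ := {lam | ∃ φ, IsEigenfunction q lam φ}

/-- The pairing `⟨f, g⟩ = ∫ f ḡ`, linear in the first argument. -/
def pairing (f g : ℝ → ℂ) : ℂ := ∫ x, f x * conj (g x)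

/-! ### The plane cut along `(0, ∞)`, with both edges of the cut -/

/-- `(ℂ ∖ (0,∞)) ∪ ((0,∞) + 0i) ∪ ((0,∞) - 0i)`. The point `edge true lam` is `lam + 0i`, and
`edge false lam` is `lam - 0i`. -/
inductive CutPlane : Type
  | off (k : ℂ) (hk : ¬(0 < k.re ∧ k.im = 0)) : CutPlane
  | edge (up : Bool) (lam : ℝ) (hlam : 0 < lam) : CutPlane

namespace CutPlane

/-- The complex number underlying a point of the cut plane. -/
def val : CutPlane → ℂ
  | off k _ => k
  | edge _ lam _ => lam

/-- The point belongs to the closed upper side (of two sides); the points of `(-∞, 0]`,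
where there is no difference between the sides, are counted as upper. -/
def IsUpper : CutPlane → Prop
  | off k _ => 0 ≤ k.im
  | edge up _ _ => up = true

/-- Basic neighbourhoods: `p'` is `ε`-close to `p` and, if `p` is on an edge of the cut,
`p'` is on the same side as `p`. -/
def Near (p : CutPlane) (ε : ℝ) (p' : CutPlane) : Prop :=
  ‖p'.val - p.val‖ < ε ∧
    match p with
    | off _ _ => True
    | edge up _ _ => (p'.IsUpper ↔ up = true)

instance : TopologicalSpace CutPlane where
  IsOpen U := ∀ p ∈ U, ∃ ε > 0, ∀ p', Near p ε p' → p' ∈ U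
  isOpen_univ := fun _ _ => ⟨1, one_pos, fun _ _ => trivial⟩
  isOpen_inter := by
    rintro U V hU hV p ⟨hpU, hpV⟩
    obtain ⟨ε₁, h₁, H₁⟩ := hU p hpU
    obtain ⟨ε₂, h₂, H₂⟩ := hV p hpV
    refine ⟨min ε₁ ε₂, lt_min h₁ h₂, fun p' hp' => ⟨H₁ p' ⟨?_, hp'.2⟩, H₂ p' ⟨?_, hp'.2⟩⟩⟩
    · exact hp'.1.trans_le (min_le_left _ _)
    · exact hp'.1.trans_le (min_le_right _ _)
  isOpen_sUnion := by
    intro S hS p hp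
    obtain ⟨U, hU, hpU⟩ := hp
    obtain ⟨ε, hε, H⟩ := hS U hU p hpU
    exact ⟨ε, hε, fun p' hp' => ⟨U, hU, H p' hp'⟩⟩

/-- `lam + 0i` (for `up = true`) and `lam - 0i` (for `up = false`); for `lam ≤ 0` both mean
`lam`. -/
def bdry (up : Bool) (lam : ℝ) : CutPlane :=
  if h : 0 < lam then edge up lam h else off (lam : ℂ) (fun h' => h (by simpa using h'.1))

/-- `E^◇ = (E + 0i) ∪ (E - 0i)`. -/
def diamond (E : Set ℝ) : Set CutPlane := {p | ∃ up, ∃ lam ∈ E, p = bdry up lam}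

end CutPlane

/-! ### The free resolvent -/

open Classical in
/-- The kernel `G_k(x) = ± i e^{ikx} χ_{ℝ_±}(x)`, with the sign given by the side on which `k`
lies. For `k ∈ (-∞, 0]` both choices of sign give the same convolution with integrable
functions whose Fourier transform is supported in `[0, ∞)`; the upper sign is taken. -/
def freeKernel (k : CutPlane) (x : ℝ) : ℂ :=
  if k.IsUpper then (if 0 < x then I * exp (I * k.val * x) else 0)
  else (if x < 0 then -I * exp (I * k.val * x) else 0)

theorem norm_freeKernel_le (k : CutPlane) (x : ℝ) : ‖freeKernel k x‖ ≤ 1 := by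
  have hn : ‖exp (I * k.val * x)‖ = Real.exp (-(k.val.im * x)) := by
    rw [norm_exp]; congr 1; simp
  unfold freeKernel
  split_ifs with h1 h2 h2
  · have : 0 ≤ k.val.im := by
      cases k with
      | off k hk => exact h1
      | edge up lam hlam => simp [CutPlane.val]
    rw [norm_mul, norm_I, one_mul, hn, Real.exp_le_one_iff]
    have := mul_nonneg this h2.le
    linarith
  · simp
  · have : k.val.im ≤ 0 := by
      cases k with
      | off k hk => exact (not_le.1 h1).le
      | edge up lam hlam => simp [CutPlane.val]
    rw [norm_mul, norm_neg, norm_I, one_mul, hn, Real.exp_le_one_iff]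
    have := mul_nonneg_of_nonpos_of_nonpos this h2.le
    linarith
  · simp

theorem measurable_freeKernel (k : CutPlane) : Measurable (freeKernel k) := by
  unfold freeKernel
  have hm : Measurable fun x : ℝ => exp (I * k.val * x) := by fun_prop
  split_ifs
  · exact Measurable.ite measurableSet_Ioi (hm.const_mul I) measurable_const
  · exact Measurable.ite measurableSet_Iio (hm.const_mul (-I)) measurable_const

/-- The convolution `G_k * f`. -/
def freeConv (k : CutPlane) (f : ℝ → ℂ) (x : ℝ) : ℂ := ∫ y, freeKernel k (x - y) * f y

theorem integrable_freeConv (k : CutPlane) {f : ℝ → ℂ} (hf : Integrable f) (x : ℝ) :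
    Integrable fun y => freeKernel k (x - y) * f y :=
  hf.bdd_mul (c := 1)
    ((measurable_freeKernel k).comp (measurable_const.sub measurable_id)).aestronglyMeasurable
    (ae_of_all _ fun y => norm_freeKernel_le k (x - y))

theorem norm_freeConv_le (k : CutPlane) {f : ℝ → ℂ} (hf : Integrable f) (x : ℝ) :
    ‖freeConv k f x‖ ≤ ∫ y, ‖f y‖ := by
  refine norm_integral_le_of_norm_le hf.norm (ae_of_all _ fun y => ?_)
  rw [norm_mul]
  exact mul_le_of_le_one_left (norm_nonneg _) (norm_freeKernel_le k _)

theorem memLp_freeConv (k : CutPlane) {f : ℝ → ℂ} (hf : Integrable f) :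
    MemLp (freeConv k f) ∞ volume := by
  refine memLp_top_of_bound ?_ (∫ y, ‖f y‖) (ae_of_all _ (norm_freeConv_le k hf))
  have h : AEStronglyMeasurable (fun p : ℝ × ℝ => freeKernel k (p.1 - p.2) * f p.2)
      ((volume : Measure ℝ).prod volume) :=
    ((measurable_freeKernel k).comp
      (measurable_fst.sub measurable_snd)).aestronglyMeasurable.mul hf.1.comp_snd
  exact h.integral_prod_right'

/-- The free resolvent `R₀(k) : f ↦ G_k * f`, as a bounded operator from `L¹` to `L^∞`. -/
def freeResolvent (k : CutPlane) : L1 →L[ℂ] LInf :=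
  LinearMap.mkContinuous
    { toFun := fun f => (memLp_freeConv k (L1.integrable_coeFn f)).toLp _
      map_add' := by
        intro f g
        rw [← MemLp.toLp_add]
        refine MemLp.toLp_congr _ _ (ae_of_all _ fun x => ?_)
        simp only [freeConv, Pi.add_apply]
        rw [← integral_add (integrable_freeConv k (L1.integrable_coeFn f) x)
          (integrable_freeConv k (L1.integrable_coeFn g) x)]
        refine integral_congr_ae ?_
        filter_upwards [Lp.coeFn_add f g] with y hy
        rw [hy, Pi.add_apply, mul_add]
      map_smul' := by
        intro c f
        rw [RingHom.id_apply, ← MemLp.toLp_const_smul]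
        refine MemLp.toLp_congr _ _ (ae_of_all _ fun x => ?_)
        simp only [freeConv, Pi.smul_apply, smul_eq_mul]
        rw [← integral_const_mul]
        refine integral_congr_ae ?_
        filter_upwards [Lp.coeFn_smul c f] with y hy
        rw [hy, Pi.smul_apply, smul_eq_mul]
        ring }
    1
    (by
      intro f
      rw [one_mul, L1.norm_eq_integral_norm]
      have h0 : 0 ≤ ∫ y, ‖f y‖ := integral_nonneg fun _ => norm_nonneg _
      refine (Lp.norm_toLp _ (memLp_freeConv k (L1.integrable_coeFn f))).trans_le (ENNReal.toReal_le_of_le_ofReal h0 ?_)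
      rw [eLpNorm_exponent_top]
      exact eLpNormEssSup_le_of_ae_bound
        (ae_of_all _ (norm_freeConv_le k (L1.integrable_coeFn f))))

/-! ### The perturbed resolvent -/

/-- Multiplication by `q ∈ L²`, from `L²` to `L¹`. -/
def mulQ (q : L2) : L2 →L[ℂ] L1 := (ContinuousLinearMap.mul ℂ ℂ).holderL volume 2 2 1 q

/-- Multiplication by `q̄`, for `q ∈ L²`, from `L^∞` to `L²`. -/
def mulQbar (q : L2) : LInf →L[ℂ] L2 :=
  (ContinuousLinearMap.mul ℂ ℂ).holderL volume 2 ∞ 2 (star q)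

/-- The operator `C₊ q̄ R₀(k) q C₊` on `L²₊(ℝ)`. -/
def sandwich (q : L2) (k : CutPlane) : hardy →L[ℂ] hardy :=
  szego ∘L mulQbar q ∘L freeResolvent k ∘L mulQ q ∘L hardy.subtypeL

/-- The perturbed resolvent, extended to the edges of the cut through the resolvent identity
`R(k) = R₀(k) + R₀(k) q C₊ (1 - C₊ q̄ R₀(k) q C₊)⁻¹ C₊ q̄ R₀(k)`.
It is meaningful when `1 - C₊ q̄ R₀(k) q C₊` is boundedly invertible on `L²₊(ℝ)`;
`Ring.inverse` is zero otherwise. -/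
def resolvent (q : L2) (k : CutPlane) : L1 →L[ℂ] LInf :=
  freeResolvent k +
    freeResolvent k ∘L mulQ q ∘L hardy.subtypeL ∘L
      Ring.inverse (1 - sandwich q k) ∘L szego ∘L mulQbar q ∘L freeResolvent k

/-! ### The Jost functions -/

/-- The inhomogeneous Jost function `m₀(k) = R(k) q`, for `q ∈ L² ∩ L¹`. -/
def jostInhom (q : L2) (hq : MemLp q 1 volume) (k : CutPlane) : LInf :=
  resolvent q k (hq.toLp q)

theorem memLp_planeWave (lam : ℝ) :
    MemLp (fun x : ℝ => exp (I * lam * x)) ∞ (volume : Measure ℝ) := by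
  refine memLp_top_of_bound (by fun_prop) 1 (ae_of_all _ fun x => ?_)
  rw [norm_exp]
  simp

/-- The plane wave `e(lam) : x ↦ e^{i lam x}`, in `L^∞`. -/
def planeWave (lam : ℝ) : LInf := (memLp_planeWave lam).toLp _

/-- The homogeneous Jost function
`m_e(lam ± 0i) = e(lam) + R(lam ± 0i) (q C₊ q̄ e(lam))`. -/
def jostHom (q : L2) (up : Bool) (lam : ℝ) : LInf :=
  planeWave lam +
    resolvent q (CutPlane.bdry up lam)
      (mulQ q (szego (mulQbar q (planeWave lam)) : L2))

/-- The modulated Jost function: the product of the conjugate of `e(lam)` and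
`m_e(lam ± 0i)`. -/
def jostMod (q : L2) (up : Bool) (lam : ℝ) : LInf :=
  (ContinuousLinearMap.mul ℂ ℂ).holder ∞ (star (planeWave lam)) (jostHom q up lam)

end

end CalogeroMoser

/-!
The Jost functions are built from `(1 - K(k))⁻¹` with `K(k) = C₊ q̄ R₀(k) q C₊`, and the theorem
describes the points at which this inverse ceases to exist and the singularities that it has there.

*Invertibility.* `K(k)` is compact (`isCompactOperator_sandwich`), and it is norm continuous on the
cut plane by a Hilbert–Schmidt estimate (`continuous_sandwich`): the products `q f` have no
nonpositive frequencies, so that the two choices of the kernel agree on `(-∞, 0]`. By the Fredholm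
alternative only kernel vectors `f = K(k) f` matter. For such `f` the number `⟨R₀(k) q f, q f⟩ = ‖f‖²`
is real, and the imaginary part of the free resolvent shows that `f = 0` for nonreal `k`, while for
real `k = λ` the Fourier transform of `q f` vanishes at `λ`. Then `φ = R₀(λ) q f` decays like
`⟨x⟩⁻ˢ`, hence is square integrable, and `q f` has an integrable first moment
(`integrable_mul_szego`), hence `φ` is integrable and lies in the Hardy space. Writing
`φ = R₀(iM)((λ - iM) φ + q f)` for large `M`, a contraction argument based on Hardy's inequality
shows that `f` is bounded (`IsBound.exists_ae_norm_le`), so that `φ ∈ H¹` is an eigenfunction.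
Conversely all eigenfunctions arise in this way (`IsEigenfunction.exists_isBoundState`).

*Simplicity and finiteness.* The commutator of `L_q` with the modulation `e^{-itx}`, tested between
two bound states, gives in the limit `t → 0` that bound states with distinct energies are
orthogonal, and `2π ⟨φ₁, φ₂⟩ = ⟨φ₁, q⟩ ⟨q, φ₂⟩` for equal energies
(`IsBound.integral_boundFn_mul_conj`). Equality in the Cauchy–Schwarz inequality forces simple
eigenvalues, `⟨q, φ⟩` does not vanish, and Bessel's inequality for `q` bounds the number of
eigenvalues.

*Singularities.* Since `φ` is integrable, `K(k) f = f + (k - λ) C₊ q̄ R₀(k) φ`, and similarly for the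
adjoint. With the projection `P` onto the line spanned by `f`, the operator `1 - K(k) + P` is
invertible near `λ`, and elimination of the component along `f` exhibits a simple pole of
`(1 - K(k))⁻¹ w` with explicit residue (`exists_regular_part_of_pole`); no analyticity is needed. For
`m₀` the residue is `-⟨q, φ⟩ / ‖φ‖² = -i` times `f`, which produces the term `-iφ / (k - λ)`. For `m_e`
the source `C₊ q̄ e(λ')` is orthogonal to `f` up to `O(λ' - λ)`, and the singularity is removable. At
zero energy the source `C₊ q̄` vanishes, which gives the limit of the modulated Jost function.
-/

namespace CalogeroMoser

noncomputable section

/-! ### The Fourier transform on `L²` -/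

/-- The Fourier transform in angular frequency, `ξ ↦ ∫ e^{-iξx} g(x) dx`. -/
def angularFourier (g : ℝ → ℂ) (ξ : ℝ) : ℂ := ∫ x : ℝ, exp (-(I * ξ * x)) * g x

theorem fourier_eq_angularFourier (g : ℝ → ℂ) (ξ : ℝ) :
    𝓕 g ξ = angularFourier g (2 * Real.pi * ξ) := by
  rw [Real.fourier_real_eq_integral_exp_smul, angularFourier]
  refine integral_congr_ae (ae_of_all _ fun x => ?_)
  simp only [smul_eq_mul]
  congr 2
  push_cast
  ring

theorem angularFourier_eq_fourier (g : ℝ → ℂ) (ξ : ℝ) :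
    angularFourier g ξ = 𝓕 g (ξ / (2 * Real.pi)) := by
  rw [fourier_eq_angularFourier]
  congr 1
  field_simp

theorem norm_exp_neg_I_mul (ξ x : ℝ) : ‖exp (-(I * ξ * x))‖ = 1 := by
  rw [norm_exp]; simp

theorem integrable_exp_mul {g : ℝ → ℂ} (hg : Integrable g) (ξ : ℝ) :
    Integrable fun x : ℝ => exp (-(I * ξ * x)) * g x :=
  hg.bdd_mul (c := 1) (by fun_prop) (ae_of_all _ fun x => (norm_exp_neg_I_mul ξ x).le)

theorem norm_angularFourier_le (g : ℝ → ℂ) (ξ : ℝ) : ‖angularFourier g ξ‖ ≤ ∫ x, ‖g x‖ := by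
  refine (norm_integral_le_integral_norm _).trans_eq ?_
  simp [norm_exp_neg_I_mul]

theorem continuous_angularFourier {g : ℝ → ℂ} (hg : Integrable g) :
    Continuous (angularFourier g) := by
  refine continuous_of_dominated (bound := fun x => ‖g x‖) (fun ξ => (integrable_exp_mul hg ξ).1)
    (fun ξ => ae_of_all _ fun x => ?_) hg.norm (ae_of_all _ fun x => by fun_prop)
  simp [norm_exp_neg_I_mul]

theorem integrable_mul_L2 {f g : ℝ → ℂ} (hf : MemLp f 2) (hg : MemLp g 2) :
    Integrable fun x => f x * g x :=
  hf.integrable_mul hg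

theorem inner_L2_eq (f g : L2) : inner ℂ f g = ∫ x, g x * conj (f x) := by
  rw [L2.inner_def]
  exact integral_congr_ae (ae_of_all _ fun x => by simp [RCLike.inner_apply])

theorem coeFn_star (f : L2) : (star f : L2) =ᵐ[volume] fun x => conj (f x) := by
  filter_upwards [Lp.coeFn_star f] with x hx
  rw [hx]; rfl

/-- The Fourier transform on `L²` is the transpose of the one on test functions, through the tempered
distribution defined by `f`. -/
theorem integral_fourier_mul_test (f : L2) {ψ : ℝ → ℂ} (h1 : ContDiff ℝ ∞ ψ)
    (h2 : HasCompactSupport ψ) : ∫ x, (𝓕 f : L2) x * ψ x = ∫ x, f x * 𝓕 ψ x := by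
  have h := congrArg (fun T => T (h2.toSchwartzMap h1)) (Lp.fourier_toTemperedDistribution_eq f)
  simp only [TemperedDistribution.fourier_apply, Lp.toTemperedDistribution_apply, smul_eq_mul] at h
  simp only [mul_comm _ (ψ _), mul_comm (f _)]
  exact h.symm

theorem integral_fourierInv_mul_test (f : L2) {ψ : ℝ → ℂ} (h1 : ContDiff ℝ ∞ ψ)
    (h2 : HasCompactSupport ψ) : ∫ x, (𝓕⁻ f : L2) x * ψ x = ∫ x, f x * 𝓕⁻ ψ x := by
  have h := congrArg (fun T => T (h2.toSchwartzMap h1))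
    (Lp.fourierInv_toTemperedDistribution_eq f)
  simp only [TemperedDistribution.fourierInv_apply, Lp.toTemperedDistribution_apply,
    smul_eq_mul] at h
  simp only [mul_comm _ (ψ _), mul_comm (f _)]
  rw [SchwartzMap.fourierInv_coe] at h
  exact h.symm

theorem L2.locallyIntegrable (f : L2) : LocallyIntegrable f :=
  (Lp.memLp f).locallyIntegrable (by norm_num)

/-- Complex valued test functions separate locally integrable functions. -/
theorem ae_eq_of_forall_test {f g : ℝ → ℂ} (hf : LocallyIntegrable f) (hg : LocallyIntegrable g)
    (h : ∀ ψ : ℝ → ℂ, ContDiff ℝ ∞ ψ → HasCompactSupport ψ → ∫ x, f x * ψ x = ∫ x, g x * ψ x) :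
    f =ᵐ[volume] g := by
  refine ae_eq_of_integral_contDiff_smul_eq hf hg fun ψ h1 h2 => ?_
  have := h (fun x => (ψ x : ℂ)) (ofRealCLM.contDiff.comp h1) (h2.comp_left (g := ofReal) (by simp))
  simpa [real_smul, mul_comm] using this

theorem test_memLp {ψ : ℝ → ℂ} (h1 : ContDiff ℝ ∞ ψ) (h2 : HasCompactSupport ψ) (p : ℝ≥0∞) :
    MemLp ψ p :=
  h1.continuous.memLp_of_hasCompactSupport h2

/-- On `L¹ ∩ L²` the Fourier transform of `L²` is given by the Fourier integral. -/
theorem fourier_L2_ae_eq {f : L2} (hf : Integrable f) : (𝓕 f : L2) =ᵐ[volume] 𝓕 (f : ℝ → ℂ) := by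
  have hc : Continuous (𝓕 (f : ℝ → ℂ)) := by
    have : 𝓕 (f : ℝ → ℂ) = fun ξ => angularFourier f (2 * Real.pi * ξ) :=
      funext (fourier_eq_angularFourier f)
    rw [this]
    exact (continuous_angularFourier hf).comp (by fun_prop)
  refine ae_eq_of_forall_test (L2.locallyIntegrable _) hc.locallyIntegrable fun ψ h1 h2 => ?_
  rw [integral_fourier_mul_test f h1 h2]
  have := VectorFourier.integral_fourierIntegral_smul_eq_flip (μ := (volume : Measure ℝ))
    (ν := (volume : Measure ℝ)) (L := innerₗ ℝ) Real.continuous_fourierChar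
    (continuous_inner) hf
    (memLp_one_iff_integrable.1 (test_memLp h1 h2 1))
  simp only [flip_innerₗ, smul_eq_mul] at this
  exact this.symm

theorem fourierInv_eq_fourier_neg' (g : ℝ → ℂ) (x : ℝ) : 𝓕⁻ g x = 𝓕 g (-x) :=
  Real.fourierInv_eq_fourier_neg g x

theorem fourierInv_L2_ae_eq {f : L2} (hf : Integrable f) :
    (𝓕⁻ f : L2) =ᵐ[volume] 𝓕⁻ (f : ℝ → ℂ) := by
  have hc : Continuous (𝓕⁻ (f : ℝ → ℂ)) := by
    have : 𝓕⁻ (f : ℝ → ℂ) = fun ξ => angularFourier f (2 * Real.pi * (-ξ)) :=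
      funext fun x => by rw [fourierInv_eq_fourier_neg', fourier_eq_angularFourier]
    rw [this]
    exact (continuous_angularFourier hf).comp (by fun_prop)
  refine ae_eq_of_forall_test (L2.locallyIntegrable _) hc.locallyIntegrable fun ψ h1 h2 => ?_
  rw [integral_fourierInv_mul_test f h1 h2]
  have := VectorFourier.integral_fourierIntegral_smul_eq_flip (μ := (volume : Measure ℝ))
    (ν := (volume : Measure ℝ)) (L := -innerₗ ℝ) Real.continuous_fourierChar
    (show Continuous fun p : ℝ × ℝ => -(inner ℝ p.1 p.2) from continuous_inner.neg) hf
    (memLp_one_iff_integrable.1 (test_memLp h1 h2 1))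
  have h3 : (-innerₗ ℝ : ℝ →ₗ[ℝ] ℝ →ₗ[ℝ] ℝ).flip = -innerₗ ℝ := by
    ext; simp
  rw [h3] at this
  simp only [smul_eq_mul] at this
  exact this.symm

/-- An `L²` function with integrable Fourier transform is bounded. -/
theorem ae_norm_le_of_integrable_fourier {b : L2} (hb : Integrable (𝓕 b : L2)) :
    ∀ᵐ x, ‖b x‖ ≤ ∫ ξ, ‖(𝓕 b : L2) ξ‖ := by
  have h := fourierInv_L2_ae_eq hb
  rw [FourierPair.fourierInv_fourier_eq] at h
  filter_upwards [h] with x hx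
  rw [hx, fourierInv_eq_fourier_neg', fourier_eq_angularFourier]
  exact norm_angularFourier_le _ _

theorem memLp_exp_mul {f : ℝ → ℂ} {p : ℝ≥0∞} (hf : MemLp f p) (t : ℝ) :
    MemLp (fun x : ℝ => exp (-(I * t * x)) * f x) p :=
  hf.of_le ((by fun_prop : Continuous fun x : ℝ => exp (-(I * t * x))).aestronglyMeasurable.mul hf.1)
    (ae_of_all _ fun x => by rw [norm_mul, norm_exp_neg_I_mul, one_mul])

/-- Multiplication by `e^{-itx}` on `L²`. -/
def modulate (t : ℝ) (f : L2) : L2 := (memLp_exp_mul (Lp.memLp f) t).toLp _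

theorem coeFn_modulate (t : ℝ) (f : L2) :
    (modulate t f : L2) =ᵐ[volume] fun x : ℝ => exp (-(I * t * x)) * f x := MemLp.coeFn_toLp _

theorem test_comp_add {ψ : ℝ → ℂ} (h2 : HasCompactSupport ψ) (a : ℝ) :
    HasCompactSupport fun x => ψ (x + a) :=
  h2.comp_homeomorph (Homeomorph.addRight a)

theorem fourier_translate (ψ : ℝ → ℂ) (a x : ℝ) :
    𝓕 (fun ξ => ψ (ξ - a)) x = exp (-(I * (2 * Real.pi * a) * x)) * 𝓕 ψ x := by
  simp only [Real.fourier_real_eq_integral_exp_smul, smul_eq_mul]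
  rw [← integral_const_mul,
    ← integral_add_right_eq_self (μ := volume) (fun ξ => _ * ψ (ξ - a)) a]
  refine integral_congr_ae (ae_of_all _ fun ξ => ?_)
  simp only [add_sub_cancel_right]
  rw [← mul_assoc, ← exp_add]
  congr 2
  push_cast
  ring

/-- Modulation translates the Fourier transform. -/
theorem fourier_modulate (t : ℝ) (f : L2) :
    (𝓕 (modulate t f) : L2) =ᵐ[volume] fun ξ => (𝓕 f : L2) (ξ + t / (2 * Real.pi)) := by
  have hm := measurePreserving_add_right (volume : Measure ℝ) (t / (2 * Real.pi))
  refine ae_eq_of_forall_test (L2.locallyIntegrable _)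
    (((Lp.memLp (𝓕 f : L2)).comp_measurePreserving hm).locallyIntegrable (by norm_num))
    fun ψ h1 h2 => ?_
  rw [integral_fourier_mul_test _ h1 h2]
  have h3 : HasCompactSupport fun x => ψ (x - t / (2 * Real.pi)) := by
    simpa [sub_eq_add_neg] using test_comp_add h2 (-(t / (2 * Real.pi)))
  have h4 : ContDiff ℝ ∞ fun x => ψ (x - t / (2 * Real.pi)) := by fun_prop
  have := integral_fourier_mul_test f h4 h3
  rw [← integral_add_right_eq_self (μ := volume) _ (t / (2 * Real.pi))] at this
  simp only [add_sub_cancel_right] at this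
  rw [this]
  refine integral_congr_ae ?_
  filter_upwards [coeFn_modulate t f] with x hx
  rw [hx, fourier_translate]
  have : (2 * Real.pi * ((t / (2 * Real.pi) : ℝ) : ℂ) : ℂ) = t := by
    push_cast
    field_simp
  rw [this]
  ring

theorem fourier_conj (ψ : ℝ → ℂ) (x : ℝ) :
    𝓕 (fun ξ => conj (ψ (-ξ))) x = conj (𝓕 ψ x) := by
  simp only [Real.fourier_real_eq_integral_exp_smul, smul_eq_mul]
  rw [← integral_conj, ← integral_neg_eq_self (μ := volume)]
  refine integral_congr_ae (ae_of_all _ fun ξ => ?_)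
  simp only [neg_neg, map_mul, ← exp_conj]
  congr 2
  simp only [conj_ofReal, conj_I]
  push_cast
  ring

theorem fourier_star (f : L2) :
    (𝓕 (star f) : L2) =ᵐ[volume] fun ξ => conj ((𝓕 f : L2) (-ξ)) := by
  have hm := Measure.measurePreserving_neg (volume : Measure ℝ)
  have hloc : MemLp (fun ξ => conj ((𝓕 f : L2) (-ξ))) 2 :=
    ((Lp.memLp (𝓕 f : L2)).comp_measurePreserving hm).star
  refine ae_eq_of_forall_test (L2.locallyIntegrable _) (hloc.locallyIntegrable (by norm_num))
    fun ψ h1 h2 => ?_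
  rw [integral_fourier_mul_test _ h1 h2]
  have h3 : HasCompactSupport fun x => conj (ψ (-x)) :=
    (h2.comp_homeomorph (Homeomorph.neg ℝ)).comp_left (g := fun z : ℂ => conj z) (by simp)
  have h4 : ContDiff ℝ ∞ fun x => conj (ψ (-x)) :=
    conjCLE.contDiff.comp (h1.comp contDiff_neg)
  have := integral_fourier_mul_test f h4 h3
  simp only [fourier_conj] at this
  rw [← integral_neg_eq_self (μ := volume) ] at this
  simp only [neg_neg] at this
  have h5 := congrArg (fun z : ℂ => conj z) this
  simp only [← integral_conj, map_mul, conj_conj] at h5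
  rw [h5]
  refine integral_congr_ae ?_
  filter_upwards [coeFn_star f] with x hx
  rw [hx]

/-- The Fourier transform of a product of two `L²` functions is the convolution of their
Fourier transforms. -/
theorem fourier_mul_L2 (f h : L2) (ξ : ℝ) :
    𝓕 (fun x => f x * h x) ξ = ∫ η, (𝓕 f : L2) η * (𝓕 h : L2) (ξ - η) := by
  have h1 : 𝓕 (fun x => f x * h x) ξ = inner ℂ (star (modulate (2 * Real.pi * ξ) h)) f := by
    rw [fourier_eq_angularFourier, angularFourier, inner_L2_eq]
    refine integral_congr_ae ?_
    filter_upwards [coeFn_star (modulate (2 * Real.pi * ξ) h),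
      coeFn_modulate (2 * Real.pi * ξ) h] with x hx hx2
    rw [hx, hx2, conj_conj]
    ring
  rw [h1, ← Lp.inner_fourier_eq, inner_L2_eq]
  refine integral_congr_ae ?_
  have h2 := (Measure.measurePreserving_neg (volume : Measure ℝ)).quasiMeasurePreserving.ae
    (fourier_modulate (2 * Real.pi * ξ) h)
  filter_upwards [fourier_star (modulate (2 * Real.pi * ξ) h), h2] with η hη hη2
  rw [hη, conj_conj]
  change (𝓕 (modulate (2 * Real.pi * ξ) h) : L2) (-η) = _ at hη2
  rw [hη2]
  congr 2
  field_simp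
  ring

/-! ### The Hardy space -/

/-- `g` has no nonpositive frequencies. The functions to which the free resolvent is applied have
this property, which makes both choices of the kernel on `(-∞, 0]` equivalent. -/
def NegFreq (g : ℝ → ℂ) : Prop := ∀ ξ : ℝ, ξ ≤ 0 → angularFourier g ξ = 0

/-- The product of two Hardy functions has no nonpositive frequencies: in the convolution of
their Fourier transforms the supports do not overlap. -/
theorem negFreq_mul {f h : L2} (hf : f ∈ hardy) (hh : h ∈ hardy) :
    NegFreq fun x => f x * h x := by
  intro ξ hξ
  rw [angularFourier_eq_fourier, fourier_mul_L2]
  rw [mem_hardy_iff] at hf hh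
  refine integral_eq_zero_of_ae ?_
  have h2 := (Measure.measurePreserving_sub_left (volume : Measure ℝ)
    (ξ / (2 * Real.pi))).quasiMeasurePreserving.ae hh
  have h0 : ∀ᵐ η : ℝ, η ≠ 0 := by simp [ae_iff]
  filter_upwards [hf, h2, h0] with η h1 h2 h0
  have h3 : ξ / (2 * Real.pi) ≤ 0 := div_nonpos_of_nonpos_of_nonneg hξ (by positivity)
  rcases lt_or_gt_of_ne h0 with h | h
  · simp [h1 h]
  · simp [h2 (by linarith)]

theorem mem_hardy_of_negFreq {f : L2} (hf : Integrable f) (h : NegFreq f) : f ∈ hardy := by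
  rw [mem_hardy_iff]
  filter_upwards [fourier_L2_ae_eq hf] with ξ h1 h2
  rw [h1, fourier_eq_angularFourier]
  exact h _ (mul_nonpos_of_nonneg_of_nonpos (by positivity) h2.le)

theorem negFreq_of_mem_hardy {f : L2} (hf : Integrable f) (h : f ∈ hardy) : NegFreq f := by
  rw [mem_hardy_iff] at h
  have hc := continuous_angularFourier hf
  have h1 : ∀ᵐ ξ : ℝ, ξ < 0 → angularFourier f (2 * Real.pi * ξ) = 0 := by
    filter_upwards [fourier_L2_ae_eq hf, h] with ξ h1 h2 h3
    rw [← fourier_eq_angularFourier, ← h1, h2 h3]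
  have h2 : Set.EqOn (fun ξ => angularFourier f (2 * Real.pi * ξ)) 0 (Set.Iic 0) := by
    have h3 : Set.EqOn (fun ξ => angularFourier f (2 * Real.pi * ξ)) 0 (Set.Iio 0) := by
      refine Measure.eqOn_open_of_ae_eq (μ := volume) ?_ isOpen_Iio
        (hc.comp (by fun_prop)).continuousOn continuousOn_const
      rw [Filter.EventuallyEq, ae_restrict_iff' measurableSet_Iio]
      exact h1
    have := h3.closure (hc.comp (by fun_prop)) continuous_const
    simpa [closure_Iio] using this
  intro ξ hξ
  have := h2 (show ξ / (2 * Real.pi) ∈ Set.Iic 0 from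
    div_nonpos_of_nonpos_of_nonneg hξ (by positivity))
  simp only [Pi.zero_apply] at this
  rw [← this]
  congr 1
  field_simp

theorem inner_szego_left (u : L2) {h : L2} (hh : h ∈ hardy) :
    inner ℂ (szego u : L2) h = inner ℂ u h :=
  hardy.inner_orthogonalProjectionOnto_eq_of_mem_right ⟨h, hh⟩ u

theorem inner_szego_right (u : L2) {h : L2} (hh : h ∈ hardy) :
    inner ℂ h (szego u : L2) = inner ℂ h u :=
  hardy.inner_orthogonalProjectionOnto_eq_of_mem_left ⟨h, hh⟩ u

theorem norm_szego_le (u : L2) : ‖szego u‖ ≤ ‖u‖ :=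
  hardy.norm_orthogonalProjectionOnto_apply_le u

/-- On the Fourier side the Szegő projector is the restriction to `[0, ∞)`. -/
theorem fourier_szego (u : L2) :
    (𝓕 (szego u : L2) : L2) =ᵐ[volume] (Set.Ici (0 : ℝ)).indicator (𝓕 u : L2) := by
  set v : L2 := ((Lp.memLp (𝓕 u : L2)).indicator measurableSet_Ici).toLp
    ((Set.Ici (0 : ℝ)).indicator (𝓕 u : L2)) with hv
  have hv1 : (v : ℝ → ℂ) =ᵐ[volume] (Set.Ici (0 : ℝ)).indicator (𝓕 u : L2) := MemLp.coeFn_toLp _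
  have hF : (𝓕 (𝓕⁻ v : L2) : L2) = v := FourierInvPair.fourier_fourierInv_eq v
  have h1 : (𝓕⁻ v : L2) ∈ hardy := by
    rw [mem_hardy_iff, hF]
    filter_upwards [hv1] with ξ h1 h2
    rw [h1, Set.indicator_of_notMem (by simpa using h2)]
  have h2 : u - (𝓕⁻ v : L2) ∈ hardyᗮ := by
    rw [Submodule.mem_orthogonal]
    intro h hh
    have hsub : (𝓕 (u - (𝓕⁻ v : L2)) : L2) = 𝓕 u - 𝓕 (𝓕⁻ v : L2) :=
      map_sub (Lp.fourierTransformₗᵢ ℝ ℂ) u _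
    rw [← Lp.inner_fourier_eq, hsub, hF, inner_L2_eq]
    rw [mem_hardy_iff] at hh
    refine integral_eq_zero_of_ae ?_
    filter_upwards [hh, hv1, Lp.coeFn_sub (𝓕 u : L2) v] with ξ h1 h2 h3
    rw [h3, Pi.sub_apply, h2]
    by_cases h4 : ξ < 0
    · simp [h1 h4]
    · rw [Set.indicator_of_mem (by simpa using h4)]; simp
  have h3 : (szego u : L2) = (𝓕⁻ v : L2) := by
    have := Submodule.eq_starProjection_of_mem_of_inner_eq_zero (K := hardy) (u := u) h1
      (fun w hw => by
        rw [← inner_conj_symm, (Submodule.mem_orthogonal _ _).1 h2 w hw, map_zero])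
    exact this
  rw [h3, hF]
  exact hv1

/-- The Szegő projector annihilates the conjugate of a Hardy function. -/
theorem szego_star {q : L2} (hq : q ∈ hardy) : szego (star q) = 0 := by
  refine ext_inner_left ℂ fun h => ?_
  rw [inner_zero_right, Submodule.coe_inner, inner_szego_right _ h.2, inner_L2_eq]
  have := negFreq_mul hq h.2 0 le_rfl
  simp only [angularFourier, ofReal_zero, mul_zero, zero_mul, neg_zero, exp_zero, one_mul] at this
  have h2 := congrArg (fun z : ℂ => conj z) this
  simp only [← integral_conj, map_mul, map_zero] at h2
  rw [← h2]
  refine integral_congr_ae ?_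
  filter_upwards [coeFn_star q] with x hx
  rw [hx]

/-! ### The two half-plane resolvents -/

/-- The kernel `± i e^{ikx} χ_{ℝ_±}(x)`, with the sign chosen independently of `k`. -/
def resKer (up : Bool) (k : ℂ) (x : ℝ) : ℂ :=
  if up then (if 0 < x then I * exp (I * k * x) else 0)
  else (if x < 0 then -I * exp (I * k * x) else 0)

/-- The closed half-plane on which `resKer up` is bounded. -/
def halfPlane (up : Bool) : Set ℂ := {k | if up then 0 ≤ k.im else k.im ≤ 0}

/-- The convolution of `g` with `resKer up k`. -/
def resConv (up : Bool) (k : ℂ) (g : ℝ → ℂ) (x : ℝ) : ℂ := ∫ y, resKer up k (x - y) * g y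

theorem ofReal_mem_halfPlane (up : Bool) (lam : ℝ) : (lam : ℂ) ∈ halfPlane up := by
  simp [halfPlane]

theorem norm_resKer_le {up : Bool} {k : ℂ} (hk : k ∈ halfPlane up) (x : ℝ) :
    ‖resKer up k x‖ ≤ 1 := by
  have hn : ‖exp (I * k * x)‖ = Real.exp (-(k.im * x)) := by
    rw [norm_exp]; congr 1; simp
  cases up
  · simp only [halfPlane, resKer, Bool.false_eq_true, if_false, Set.mem_ofPred_eq] at hk ⊢
    split_ifs with h
    · rw [norm_mul, norm_neg, norm_I, one_mul, hn, Real.exp_le_one_iff]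
      nlinarith [mul_nonneg_of_nonpos_of_nonpos hk h.le]
    · simp
  · simp only [halfPlane, resKer, if_true, Set.mem_ofPred_eq] at hk ⊢
    split_ifs with h
    · rw [norm_mul, norm_I, one_mul, hn, Real.exp_le_one_iff]
      nlinarith [mul_nonneg hk h.le]
    · simp

theorem measurable_resKer (up : Bool) (k : ℂ) : Measurable (resKer up k) := by
  unfold resKer
  have hm : Measurable fun x : ℝ => exp (I * k * x) := by fun_prop
  split_ifs
  · exact Measurable.ite measurableSet_Ioi (hm.const_mul I) measurable_const
  · exact Measurable.ite measurableSet_Iio (hm.const_mul (-I)) measurable_const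

theorem integrable_resConv {up : Bool} {k : ℂ} (hk : k ∈ halfPlane up) {g : ℝ → ℂ}
    (hg : Integrable g) (x : ℝ) : Integrable fun y => resKer up k (x - y) * g y :=
  hg.bdd_mul (c := 1)
    ((measurable_resKer up k).comp (measurable_const.sub measurable_id)).aestronglyMeasurable
    (ae_of_all _ fun y => norm_resKer_le hk (x - y))

theorem norm_resConv_le {up : Bool} {k : ℂ} (hk : k ∈ halfPlane up) {g : ℝ → ℂ}
    (hg : Integrable g) (x : ℝ) : ‖resConv up k g x‖ ≤ ∫ y, ‖g y‖ := by
  refine norm_integral_le_of_norm_le hg.norm (ae_of_all _ fun y => ?_)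
  rw [norm_mul]
  exact mul_le_of_le_one_left (norm_nonneg _) (norm_resKer_le hk _)

theorem aestronglyMeasurable_resConv_integrand (up : Bool) (k : ℂ) {g : ℝ → ℂ}
    (hg : AEStronglyMeasurable g) :
    AEStronglyMeasurable (fun p : ℝ × ℝ => resKer up k (p.1 - p.2) * g p.2)
      ((volume : Measure ℝ).prod volume) :=
  ((measurable_resKer up k).comp
      (measurable_fst.sub measurable_snd)).aestronglyMeasurable.mul hg.comp_snd

theorem memLp_top_resConv {up : Bool} {k : ℂ} (hk : k ∈ halfPlane up) {g : ℝ → ℂ}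
    (hg : Integrable g) : MemLp (resConv up k g) ∞ :=
  memLp_top_of_bound (aestronglyMeasurable_resConv_integrand up k hg.1).integral_prod_right'
    (∫ y, ‖g y‖) (ae_of_all _ (norm_resConv_le hk hg))

theorem resConv_congr (up : Bool) (k : ℂ) {g h : ℝ → ℂ} (hgh : g =ᵐ[volume] h) :
    resConv up k g = resConv up k h := by
  ext x
  refine integral_congr_ae ?_
  filter_upwards [hgh] with y hy
  rw [hy]

theorem resConv_sub {up : Bool} {k : ℂ} (hk : k ∈ halfPlane up) {g h : ℝ → ℂ}
    (hg : Integrable g) (hh : Integrable h) (x : ℝ) :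
    resConv up k (fun y => g y - h y) x = resConv up k g x - resConv up k h x := by
  rw [resConv, resConv, resConv, ← integral_sub (integrable_resConv hk hg x)
    (integrable_resConv hk hh x)]
  simp only [mul_sub]

theorem resConv_const_mul (up : Bool) (k c : ℂ) (g : ℝ → ℂ) (x : ℝ) :
    resConv up k (fun y => c * g y) x = c * resConv up k g x := by
  rw [resConv, resConv, ← integral_const_mul]
  exact integral_congr_ae (ae_of_all _ fun y => by simp only; ring)

theorem resKer_false (k : ℂ) (x : ℝ) : resKer false k x = -resKer true (-k) (-x) := by
  simp only [resKer, Bool.false_eq_true, if_false, if_true, Left.neg_pos_iff]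
  split_ifs <;> simp

theorem resConv_false (k : ℂ) (g : ℝ → ℂ) (x : ℝ) :
    resConv false k g x = -resConv true (-k) (fun y => g (-y)) (-x) := by
  rw [resConv, resConv, ← integral_neg, ← integral_neg_eq_self (μ := volume)]
  refine integral_congr_ae (ae_of_all _ fun y => ?_)
  simp only
  rw [resKer_false]
  ring_nf

theorem resConv_true_ofReal (lam : ℝ) (g : ℝ → ℂ) (x : ℝ) :
    resConv true lam g x =
      I * exp (I * lam * x) * ∫ y in Set.Iio x, exp (-(I * lam * y)) * g y := by
  rw [resConv, ← integral_indicator measurableSet_Iio, ← integral_const_mul]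
  refine integral_congr_ae (ae_of_all _ fun y => ?_)
  simp only [resKer, if_true, sub_pos, Set.indicator_apply, Set.mem_Iio]
  split_ifs
  · have : exp (I * lam * ((x - y : ℝ) : ℂ)) = exp (I * lam * x) * exp (-(I * lam * y)) := by
      rw [← exp_add]; congr 1; push_cast; ring
    rw [this]; ring
  · simp

theorem resConv_false_ofReal (lam : ℝ) (g : ℝ → ℂ) (x : ℝ) :
    resConv false lam g x =
      -I * exp (I * lam * x) * ∫ y in Set.Ioi x, exp (-(I * lam * y)) * g y := by
  rw [resConv, ← integral_indicator measurableSet_Ioi, ← integral_const_mul]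
  refine integral_congr_ae (ae_of_all _ fun y => ?_)
  simp only [resKer, Bool.false_eq_true, if_false, sub_neg, Set.indicator_apply, Set.mem_Ioi]
  split_ifs
  · have : exp (I * lam * ((x - y : ℝ) : ℂ)) = exp (I * lam * x) * exp (-(I * lam * y)) := by
      rw [← exp_add]; congr 1; push_cast; ring
    rw [this]; ring
  · simp

/-- The jump of the free resolvent across a real point is the Fourier transform there. -/
theorem resConv_true_sub_false (lam : ℝ) {g : ℝ → ℂ} (hg : Integrable g) (x : ℝ) :
    resConv true lam g x - resConv false lam g x =
      I * exp (I * lam * x) * angularFourier g lam := by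
  have h := intervalIntegral.integral_Iic_add_Ioi (b := x) (μ := volume)
    (integrable_exp_mul hg lam).integrableOn (integrable_exp_mul hg lam).integrableOn
  rw [resConv_true_ofReal, resConv_false_ofReal, angularFourier, ← h, integral_Iic_eq_integral_Iio]
  ring

/-- Both half-plane kernels give the same result at a real point at which the Fourier transform of `g`
vanishes. -/
theorem resConv_eq_of_angularFourier_eq_zero (up up' : Bool) {lam : ℝ} {g : ℝ → ℂ}
    (hg : Integrable g) (h : angularFourier g lam = 0) : resConv up lam g = resConv up' lam g := by
  have : resConv true lam g = resConv false lam g := by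
    ext x
    have := resConv_true_sub_false lam hg x
    rw [h, mul_zero] at this
    exact sub_eq_zero.1 this
  cases up <;> cases up' <;> simp [this]

/-- Up to a factor `i`, the Fourier transform of `g` at `lam` is the amplitude of `R₀(lam + 0i) g` at
infinity. -/
theorem tendsto_exp_mul_resConv_atTop (lam : ℝ) {g : ℝ → ℂ} (hg : Integrable g) :
    Tendsto (fun x : ℝ => exp (-(I * lam * x)) * resConv true lam g x) atTop
      (𝓝 (I * angularFourier g lam)) := by
  have h := (aecover_Iio (μ := (volume : Measure ℝ)) tendsto_id).integral_tendsto_of_countably_generated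
    (integrable_exp_mul hg lam)
  refine (h.const_mul I).congr fun x => ?_
  rw [resConv_true_ofReal, ← mul_assoc, mul_left_comm, ← exp_add]
  simp

theorem norm_resConv_true_ofReal (lam : ℝ) (g : ℝ → ℂ) (x : ℝ) :
    ‖resConv true lam g x‖ = ‖∫ y in Set.Iio x, exp (-(I * lam * y)) * g y‖ := by
  have h : ‖exp (I * lam * x)‖ = 1 := by rw [norm_exp]; simp
  rw [resConv_true_ofReal, norm_mul, norm_mul, norm_I, h, one_mul, one_mul]

theorem norm_resConv_false_ofReal (lam : ℝ) (g : ℝ → ℂ) (x : ℝ) :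
    ‖resConv false lam g x‖ = ‖∫ y in Set.Ioi x, exp (-(I * lam * y)) * g y‖ := by
  have h : ‖exp (I * lam * x)‖ = 1 := by rw [norm_exp]; simp
  rw [resConv_false_ofReal, norm_mul, norm_mul, norm_neg, norm_I, h, one_mul, one_mul]

theorem tendsto_norm_resConv_atTop (lam : ℝ) {g : ℝ → ℂ} (hg : Integrable g) :
    Tendsto (fun x : ℝ => ‖resConv true lam g x‖) atTop (𝓝 ‖angularFourier g lam‖) := by
  have h := (tendsto_exp_mul_resConv_atTop lam hg).norm
  simpa [norm_exp_neg_I_mul] using h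

theorem tendsto_norm_resConv_atBot (lam : ℝ) {g : ℝ → ℂ} (hg : Integrable g) :
    Tendsto (fun x : ℝ => ‖resConv true lam g x‖) atBot (𝓝 0) := by
  have h1 := (aecover_Ioi (μ := (volume : Measure ℝ)) (a := id) (l := atBot)
    tendsto_id).integral_tendsto_of_countably_generated (integrable_exp_mul hg lam)
  have h3 := (h1.const_sub (angularFourier g lam)).norm
  rw [angularFourier, sub_self, norm_zero] at h3
  refine h3.congr fun x => ?_
  have h4 := intervalIntegral.integral_Iic_add_Ioi (b := x) (μ := volume)
    (integrable_exp_mul hg lam).integrableOn (integrable_exp_mul hg lam).integrableOn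
  rw [norm_resConv_true_ofReal, ← h4, integral_Iic_eq_integral_Iio]
  simp

/-- The two half-plane resolvents are adjoint to each other. -/
theorem integral_resConv_mul_conj {up : Bool} {k : ℂ} (hk : k ∈ halfPlane up) {g h : ℝ → ℂ}
    (hg : Integrable g) (hh : Integrable h) :
    ∫ x, resConv up k g x * conj (h x) = ∫ x, g x * conj (resConv (!up) (conj k) h x) := by
  have hker : ∀ x y : ℝ, conj (resKer (!up) (conj k) (y - x)) = resKer up k (x - y) := by
    intro x y
    have he : conj (exp (I * conj k * ((y - x : ℝ) : ℂ))) = exp (I * k * ((x - y : ℝ) : ℂ)) := by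
      rw [← exp_conj]; congr 1; simp only [map_mul, conj_I, conj_conj, conj_ofReal]
      push_cast; ring
    cases up <;>
    simp only [resKer, Bool.not_true, Bool.not_false, Bool.false_eq_true, if_false, if_true,
      sub_neg, sub_pos] <;> split_ifs <;> simp [-ofReal_sub, he]
  have h1 : ∀ x, resConv up k g x * conj (h x) =
      ∫ y, resKer up k (x - y) * g y * conj (h x) := fun x => by
    rw [resConv, integral_mul_const]
  have h2 : ∀ y, g y * conj (resConv (!up) (conj k) h y) =
      ∫ x, resKer up k (x - y) * g y * conj (h x) := fun y => by
    rw [resConv, ← integral_conj, ← integral_const_mul]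
    refine integral_congr_ae (ae_of_all _ fun x => ?_)
    simp only [map_mul, hker]
    ring
  simp only [h1, h2]
  refine integral_integral_swap ?_
  have h3 : Integrable (fun p : ℝ × ℝ => conj (h p.1) * g p.2) (volume.prod volume) :=
    Integrable.mul_prod (f := fun x => conj (h x)) (conjCLE.toContinuousLinearMap.integrable_comp hh) hg
  refine (h3.bdd_mul (c := 1) (f := fun p : ℝ × ℝ => resKer up k (p.1 - p.2))
    ((measurable_resKer up k).comp
      (measurable_fst.sub measurable_snd)).aestronglyMeasurable
    (ae_of_all _ fun p => norm_resKer_le hk _)).congr (ae_of_all _ fun p => ?_)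
  simp only [Function.uncurry]
  ring

/-! ### Resolvent identities -/

/-- The convolution of the kernels at two points of the same half-plane. -/
theorem sub_mul_integral_resKer_mul (k : ℂ) (lam x y : ℝ) :
    (k - lam) * ∫ z, resKer true k (x - z) * resKer true lam (z - y) =
      resKer true k (x - y) - resKer true lam (x - y) := by
  have h1 : ∀ z : ℝ, resKer true k (x - z) * resKer true lam (z - y) =
      (Set.Ioo y x).indicator
        (fun z : ℝ => -exp (I * k * x - I * lam * y) * exp (-(I * (k - lam)) * z)) z := by
    intro z
    simp only [resKer, if_true, sub_pos, Set.indicator_apply, Set.mem_Ioo]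
    have he : exp (I * k * ((x - z : ℝ) : ℂ)) * exp (I * lam * ((z - y : ℝ) : ℂ)) =
        exp (I * k * x - I * lam * y) * exp (-(I * (k - lam)) * z) := by
      rw [← exp_add, ← exp_add]; congr 1; push_cast; ring
    by_cases hz : z < x <;> by_cases hy : y < z <;> simp only [hz, hy, if_true, if_false, and_true,
      and_false, mul_zero, zero_mul]
    linear_combination (I * I) * he + exp (I * k * x - I * lam * y) * exp (-(I * (k - lam)) * z) * I_mul_I
  simp only [h1]
  rw [integral_indicator measurableSet_Ioo, integral_const_mul]
  by_cases hxy : y < x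
  · rw [← integral_Ioc_eq_integral_Ioo, ← intervalIntegral.integral_of_le hxy.le]
    simp only [resKer, if_true, sub_pos, hxy]
    by_cases hk : k - lam = 0
    · have : k = lam := sub_eq_zero.1 hk
      rw [this]; simp
    · have hc : -(I * (k - lam)) ≠ 0 := neg_ne_zero.2 (mul_ne_zero I_ne_zero hk)
      rw [integral_exp_mul_complex hc]
      have e1 : exp (I * k * ((x - y : ℝ) : ℂ)) =
          exp (I * k * x - I * lam * y) * exp (-(I * (k - lam)) * y) := by
        rw [← exp_add]; congr 1; push_cast; ring
      have e2 : exp (I * lam * ((x - y : ℝ) : ℂ)) =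
          exp (I * k * x - I * lam * y) * exp (-(I * (k - lam)) * x) := by
        rw [← exp_add]; congr 1; push_cast; ring
      rw [e1, e2]
      generalize exp (-(I * (k - lam)) * x) = X
      generalize exp (-(I * (k - lam)) * y) = Y
      field_simp
      linear_combination (X - Y) * I_mul_I
  · rw [Set.Ioo_eq_empty hxy]
    simp [resKer, hxy]

theorem integrable_abs_mul_add {g : ℝ → ℂ} (hg : Integrable g)
    (hxg : Integrable fun x : ℝ => (x : ℂ) * g x) (x : ℝ) :
    Integrable fun y => (|x| + |y|) * ‖g y‖ := by
  have := (hg.norm.const_mul |x|).add hxg.norm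
  refine this.congr (ae_of_all _ fun y => ?_)
  simp [add_mul]

/-- The case of the upper half-plane. Although `R₀(lam) g` need not be integrable, Fubini's theorem
applies: the iterated kernel is supported in `y < z < x`, an interval in `z` of length at most
`|x| + |y|`. -/
theorem resolvent_identity_true {k : ℂ} (hk : k ∈ halfPlane true) (lam : ℝ) {g : ℝ → ℂ}
    (hg : Integrable g) (hxg : Integrable fun x : ℝ => (x : ℂ) * g x) (x : ℝ) :
    resConv true k g x - resConv true lam g x =
      (k - lam) * resConv true k (resConv true lam g) x := by
  have hF : Integrable (fun p : ℝ × ℝ => resKer true k (x - p.1) * (resKer true lam (p.1 - p.2) * g p.2))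
      (volume.prod volume) := by
    have hmeas : AEStronglyMeasurable
        (fun p : ℝ × ℝ => resKer true k (x - p.1) * (resKer true lam (p.1 - p.2) * g p.2))
        ((volume : Measure ℝ).prod volume) :=
      (((measurable_resKer true k).comp
        (measurable_const.sub measurable_fst)).aestronglyMeasurable).mul
        (aestronglyMeasurable_resConv_integrand true lam hg.1)
    -- The integrand is supported in `y < z < x`.
    have hb : ∀ z y : ℝ, ‖resKer true k (x - z) * (resKer true lam (z - y) * g y)‖ ≤
        (Set.Ioo y x).indicator (fun _ => ‖g y‖) z := by
      intro z y
      by_cases hz : z ∈ Set.Ioo y x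
      · rw [Set.indicator_of_mem hz, norm_mul, norm_mul]
        exact (mul_le_of_le_one_left (by positivity) (norm_resKer_le hk _)).trans
          (mul_le_of_le_one_left (norm_nonneg _) (norm_resKer_le (ofReal_mem_halfPlane true lam) _))
      · rw [Set.indicator_of_notMem hz]
        simp only [Set.mem_Ioo, not_and_or, not_lt] at hz
        rcases hz with hz | hz <;> simp [resKer, not_lt.2 hz]
    have hi : ∀ y : ℝ, Integrable ((Set.Ioo y x).indicator (fun _ : ℝ => ‖g y‖)) := fun y =>
      (integrable_indicator_iff measurableSet_Ioo).2 (integrableOn_const (by simp))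
    rw [integrable_prod_iff' hmeas]
    refine ⟨?_, ?_⟩
    · have hm2 := hmeas.prod_swap.prodMk_left
      filter_upwards [hm2] with y hy
      exact (hi y).mono' hy (ae_of_all _ fun z => hb z y)
    · refine (integrable_abs_mul_add hg hxg x).mono' hmeas.norm.prod_swap.integral_prod_right' ?_
      have hm2 := hmeas.prod_swap.prodMk_left
      filter_upwards [hm2] with y hy
      rw [Real.norm_of_nonneg (integral_nonneg fun _ => norm_nonneg _)]
      refine (integral_mono_of_nonneg (ae_of_all _ fun _ => norm_nonneg _) (hi y)
        (ae_of_all _ fun z => hb z y)).trans ?_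
      rw [integral_indicator measurableSet_Ioo]
      simp only [integral_const, MeasurableSet.univ, measureReal_restrict_apply, Set.univ_inter,
        Real.volume_real_Ioo, smul_eq_mul]
      refine mul_le_mul_of_nonneg_right (max_le ?_ (by positivity)) (norm_nonneg _)
      have := le_abs_self x
      have := neg_abs_le y
      linarith
  have h1 : resConv true k (resConv true lam g) x =
      ∫ y, (∫ z, resKer true k (x - z) * resKer true lam (z - y)) * g y := by
    have h2 : ∀ z, resKer true k (x - z) * resConv true lam g z =
        ∫ y, resKer true k (x - z) * (resKer true lam (z - y) * g y) := fun z => by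
      rw [resConv, integral_const_mul]
    rw [resConv]
    simp only [h2]
    rw [integral_integral_swap hF]
    refine integral_congr_ae (ae_of_all _ fun y => ?_)
    simp only
    rw [← integral_mul_const]
    simp only [mul_assoc]
  rw [h1, ← integral_const_mul]
  have h3 : ∀ y, (k - lam) * ((∫ z, resKer true k (x - z) * resKer true lam (z - y)) * g y) =
      resKer true k (x - y) * g y - resKer true lam (x - y) * g y := fun y => by
    rw [← mul_assoc, sub_mul_integral_resKer_mul, sub_mul]
  simp only [h3]
  exact (integral_sub (integrable_resConv hk hg x)
    (integrable_resConv (ofReal_mem_halfPlane true lam) hg x)).symm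

/-- The first resolvent identity, for a function with an integrable first moment. -/
theorem resolvent_identity {up : Bool} {k : ℂ} (hk : k ∈ halfPlane up) (lam : ℝ) {g : ℝ → ℂ}
    (hg : Integrable g) (hxg : Integrable fun x : ℝ => (x : ℂ) * g x) (x : ℝ) :
    resConv up k g x - resConv up lam g x =
      (k - lam) * resConv up k (resConv up lam g) x := by
  cases up
  · have hk' : -k ∈ halfPlane true := by simpa [halfPlane] using hk
    have hx' : Integrable fun x : ℝ => (x : ℂ) * g (-x) := by
      refine hxg.comp_neg.neg.congr (ae_of_all _ fun x => ?_)
      simp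
    have h := resolvent_identity_true hk' (-lam) hg.comp_neg hx' (-x)
    have h2 : (fun y => resConv false lam g (-y)) =
        fun y => (-1) * resConv true ((-lam : ℝ) : ℂ) (fun y => g (-y)) y := by
      ext y; rw [resConv_false]; simp
    rw [resConv_false k, resConv_false lam, resConv_false k, h2, resConv_const_mul]
    push_cast at h ⊢
    linear_combination -h
  · exact resolvent_identity_true hk lam hg hxg x

/-- If `g` has an integrable first moment and `ĝ(λ) = 0`, then `R₀(λ)g` is integrable. -/
theorem integrable_resConv_of_moment (lam : ℝ) {g : ℝ → ℂ} (hg : Integrable g)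
    (hxg : Integrable fun x : ℝ => (x : ℂ) * g x) (h0 : angularFourier g lam = 0) :
    Integrable (resConv true lam g) := by
  -- By Tonelli, `∫ |x| |g|` is the integral of `|g y|` over the pairs with `x` between `0` and `y`.
  have hmS : MeasurableSet {p : ℝ × ℝ | p.1 ∈ Set.uIoc 0 p.2} := by
    have : {p : ℝ × ℝ | p.1 ∈ Set.uIoc 0 p.2} =
        {p : ℝ × ℝ | min 0 p.2 < p.1} ∩ {p : ℝ × ℝ | p.1 ≤ max 0 p.2} := by
      ext p; simp [Set.uIoc]
    rw [this]
    exact (measurableSet_lt (by fun_prop) (by fun_prop)).inter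
      (measurableSet_le (by fun_prop) (by fun_prop))
  set H : ℝ × ℝ → ℝ := {p : ℝ × ℝ | p.1 ∈ Set.uIoc 0 p.2}.indicator (fun p => ‖g p.2‖) with hH
  have hmeas : AEStronglyMeasurable H ((volume : Measure ℝ).prod volume) :=
    hg.1.norm.comp_snd.indicator hmS
  have hHy : ∀ x y, H (x, y) = (Set.uIoc 0 y).indicator (fun _ => ‖g y‖) x := fun x y => rfl
  have hHi : Integrable H ((volume : Measure ℝ).prod volume) := by
    rw [integrable_prod_iff' hmeas]
    refine ⟨ae_of_all _ fun y => ?_, ?_⟩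
    · simp only [hHy]
      exact (integrable_indicator_iff measurableSet_uIoc).2 (integrableOn_const (by simp))
    · refine hxg.norm.congr (ae_of_all _ fun y => ?_)
      simp only [hHy, norm_indicator_eq_indicator_norm, norm_norm]
      rw [integral_indicator measurableSet_uIoc]
      simp [measureReal_def]
  refine hHi.integral_prod_left.mono'
    (memLp_top_resConv (ofReal_mem_halfPlane true lam) hg).1 (ae_of_all _ fun x => ?_)
  have key : ∀ S : Set ℝ, MeasurableSet S → (∀ y ∈ S, x ∈ Set.uIoc 0 y) →
      ‖∫ y in S, exp (-(I * lam * y)) * g y‖ ≤ ∫ y, H (x, y) := by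
    intro S hS hxS
    rw [← integral_indicator hS]
    have hHx : Integrable fun y => H (x, y) := by
      refine hg.norm.mono' ?_ (ae_of_all _ fun y => ?_)
      · exact hg.1.norm.indicator (hmS.preimage (measurable_prodMk_left (x := x)))
      · rw [hHy, norm_indicator_eq_indicator_norm, norm_norm]
        exact Set.indicator_le_self' (fun _ _ => norm_nonneg _) _
    refine norm_integral_le_of_norm_le hHx (ae_of_all _ fun y => ?_)
    by_cases hy : y ∈ S
    · rw [Set.indicator_of_mem hy, hHy, Set.indicator_of_mem (hxS y hy), norm_mul,
        norm_exp_neg_I_mul, one_mul]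
    · rw [Set.indicator_of_notMem hy, norm_zero, hHy]
      exact Set.indicator_nonneg (fun _ _ => norm_nonneg _) _
  rcases le_or_gt x 0 with hx | hx
  · rw [norm_resConv_true_ofReal]
    exact key _ measurableSet_Iio fun y hy => by
      rw [Set.uIoc_of_ge (le_of_lt (lt_of_lt_of_le hy hx))]; exact ⟨hy, hx⟩
  · rw [resConv_eq_of_angularFourier_eq_zero true false hg h0, norm_resConv_false_ofReal]
    exact key _ measurableSet_Ioi fun y hy => by
      rw [Set.uIoc_of_le (le_of_lt (lt_trans hx hy))]; exact ⟨hx, le_of_lt hy⟩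

/-- On the Fourier side `φ = R₀(λ)g` reads `(ξ - λ) φ̂(ξ) = ĝ(ξ)`. -/
theorem sub_mul_angularFourier_resConv (lam : ℝ) {g : ℝ → ℂ} (hg : Integrable g)
    (hxg : Integrable fun x : ℝ => (x : ℂ) * g x) (h0 : angularFourier g lam = 0) (ξ : ℝ) :
    (ξ - lam : ℂ) * angularFourier (resConv true lam g) ξ = angularFourier g ξ := by
  have hφ := integrable_resConv_of_moment lam hg hxg h0
  have h1 := tendsto_exp_mul_resConv_atTop ξ hg
  have h2 : Tendsto (fun x : ℝ => exp (-(I * ξ * x)) * resConv true lam g x) atTop (𝓝 0) := by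
    have h := tendsto_norm_resConv_atTop lam hg
    rw [h0, norm_zero] at h
    rw [tendsto_zero_iff_norm_tendsto_zero]
    simpa [norm_exp_neg_I_mul] using h
  have h3 := (tendsto_exp_mul_resConv_atTop ξ hφ).const_mul (ξ - lam : ℂ)
  have h4 := tendsto_nhds_unique (h1.sub h2) (h3.congr fun x => ?_)
  · have : I * ((ξ - lam : ℂ) * angularFourier (resConv true lam g) ξ) = I * angularFourier g ξ := by
      linear_combination -h4
    exact mul_left_cancel₀ I_ne_zero this
  · have := resolvent_identity_true (ofReal_mem_halfPlane true ξ) lam hg hxg x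
    linear_combination (-exp (-(I * ξ * x))) * this

/-- Division of `ĝ(ξ)` by `ξ - lam` preserves the vanishing for `ξ ≤ 0`, and `ξ = lam` is reached by
continuity. -/
theorem negFreq_resConv (lam : ℝ) {g : ℝ → ℂ} (hg : Integrable g)
    (hxg : Integrable fun x : ℝ => (x : ℂ) * g x) (h0 : angularFourier g lam = 0)
    (hn : NegFreq g) : NegFreq (resConv true lam g) := by
  have hc := continuous_angularFourier (integrable_resConv_of_moment lam hg hxg h0)
  have h1 : ∀ ξ : ℝ, ξ ≤ 0 → ξ ≠ lam → angularFourier (resConv true lam g) ξ = 0 := by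
    intro ξ hξ hne
    have h := sub_mul_angularFourier_resConv lam hg hxg h0 ξ
    rw [hn ξ hξ] at h
    refine (mul_eq_zero.1 h).resolve_left ?_
    exact sub_ne_zero.2 (by exact_mod_cast hne)
  intro ξ hξ
  by_cases hne : ξ = lam
  · subst hne
    have h2 : Tendsto (angularFourier (resConv true ξ g)) (𝓝[<] ξ)
        (𝓝 (angularFourier (resConv true ξ g) ξ)) := hc.continuousAt.mono_left nhdsWithin_le_nhds
    refine tendsto_nhds_unique h2 (tendsto_const_nhds.congr' ?_)
    filter_upwards [self_mem_nhdsWithin] with η hη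
    exact (h1 η (le_of_lt (lt_of_lt_of_le hη hξ)) (ne_of_lt hη)).symm
  · exact h1 ξ hξ hne

/-! ### The resolvent off the real axis -/

theorem resKer_eq_zero_outside (k : ℂ) : resKer true k = (Set.Ioi (0 : ℝ)).indicator
    (fun x : ℝ => I * exp (I * k * x)) := by
  ext x; simp [resKer, Set.indicator_apply]

theorem integrable_resKer_true {k : ℂ} (hk : 0 < k.im) : Integrable (resKer true k) := by
  rw [resKer_eq_zero_outside, integrable_indicator_iff measurableSet_Ioi]
  exact (integrableOn_exp_mul_complex_Ioi (a := I * k) (by simpa using hk) 0).const_mul I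

theorem angularFourier_resKer_true {k : ℂ} (hk : 0 < k.im) (ξ : ℝ) :
    angularFourier (resKer true k) ξ = (ξ - k)⁻¹ := by
  have hre : (I * (k - ξ)).re < 0 := by simpa using hk
  have hne : k - ξ ≠ 0 := by
    intro h; rw [h] at hre; simp at hre
  have hne' : (ξ : ℂ) - k ≠ 0 := by
    intro h; exact hne (by linear_combination -h)
  have h1 : ∀ x : ℝ, exp (-(I * ξ * x)) * resKer true k x =
      (Set.Ioi (0 : ℝ)).indicator (fun x : ℝ => I * exp (I * (k - ξ) * x)) x := by
    intro x
    rw [resKer_eq_zero_outside]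
    simp only [Set.indicator_apply, Set.mem_Ioi]
    split_ifs
    · have : exp (I * (k - ξ) * x) = exp (-(I * ξ * x)) * exp (I * k * x) := by
        rw [← exp_add]; congr 1; ring
      rw [this]; ring
    · simp
  rw [angularFourier]
  simp only [h1]
  rw [integral_indicator measurableSet_Ioi, integral_const_mul, integral_exp_mul_complex_Ioi hre]
  simp only [ofReal_zero, mul_zero, exp_zero]
  field_simp [I_ne_zero]
  ring

theorem integrable_resKer_false {k : ℂ} (hk : k.im < 0) : Integrable (resKer false k) := by
  have := (integrable_resKer_true (k := -k) (by simpa using hk)).comp_neg.neg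
  exact this.congr (ae_of_all _ fun x => (resKer_false k x).symm)

theorem angularFourier_resKer_false {k : ℂ} (hk : k.im < 0) (ξ : ℝ) :
    angularFourier (resKer false k) ξ = (ξ - k)⁻¹ := by
  have h := angularFourier_resKer_true (k := -k) (by simpa using hk) (-ξ)
  have h2 : angularFourier (resKer false k) ξ = -angularFourier (resKer true (-k)) (-ξ) := by
    rw [angularFourier, angularFourier, ← integral_neg, ← integral_neg_eq_self (μ := volume)]
    refine integral_congr_ae (ae_of_all _ fun y => ?_)
    simp only [resKer_false]
    push_cast
    simp
  rw [h2, h, ← inv_neg]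
  congr 1
  push_cast; ring

theorem resConv_eq_convolution (up : Bool) (k : ℂ) (g : ℝ → ℂ) :
    resConv up k g = convolution g (resKer up k) (ContinuousLinearMap.mul ℂ ℂ) volume := by
  ext x
  rw [convolution, resConv]
  exact integral_congr_ae (ae_of_all _ fun y => by simp [mul_comm])

theorem integrable_resConv_of_im {up : Bool} {k : ℂ} (hk : k ∈ halfPlane up) (hk0 : k.im ≠ 0)
    {g : ℝ → ℂ} (hg : Integrable g) :
    Integrable (resConv up k g) ∧
      ∀ ξ : ℝ, angularFourier (resConv up k g) ξ = angularFourier g ξ * (ξ - k)⁻¹ := by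
  have h : Integrable (resKer up k) ∧ ∀ ξ : ℝ, angularFourier (resKer up k) ξ = (ξ - k)⁻¹ := by
    cases up
    · have : k.im < 0 := lt_of_le_of_ne (by simpa [halfPlane] using hk) hk0
      exact ⟨integrable_resKer_false this, angularFourier_resKer_false this⟩
    · have : 0 < k.im := lt_of_le_of_ne (by simpa [halfPlane] using hk) hk0.symm
      exact ⟨integrable_resKer_true this, angularFourier_resKer_true this⟩
  rw [resConv_eq_convolution]
  refine ⟨hg.integrable_convolution _ h.1, fun ξ => ?_⟩
  rw [angularFourier_eq_fourier, Real.fourier_mul_convolution_eq hg h.1,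
    ← angularFourier_eq_fourier, ← angularFourier_eq_fourier, h.2]

theorem memLp_two_of_integrable_of_top {f : ℝ → ℂ} (h1 : Integrable f) (h2 : MemLp f ∞) :
    MemLp f 2 :=
  (memLp_two_iff_integrable_sq_norm h1.1).2
    ((h1.norm.mul_of_top_left h2.norm).congr (ae_of_all _ fun x => by simp [sq]))

theorem ae_eq_of_angularFourier_eq {f h : ℝ → ℂ} (hf : Integrable f) (hf2 : MemLp f 2)
    (hh : Integrable h) (hh2 : MemLp h 2)
    (he : ∀ ξ, angularFourier f ξ = angularFourier h ξ) : f =ᵐ[volume] h := by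
  have e1 := hf2.coeFn_toLp
  have e2 := hh2.coeFn_toLp
  have h1 := fourier_L2_ae_eq (f := hf2.toLp f) (hf.congr e1.symm)
  have h2 := fourier_L2_ae_eq (f := hh2.toLp h) (hh.congr e2.symm)
  have hF : ∀ {u v : ℝ → ℂ}, u =ᵐ[volume] v → ∀ ξ, angularFourier u ξ = angularFourier v ξ := by
    intro u v huv ξ
    refine integral_congr_ae ?_
    filter_upwards [huv] with x hx
    rw [hx]
  have h3 : (𝓕 (hf2.toLp f) : L2) = 𝓕 (hh2.toLp h) := by
    refine Lp.ext ?_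
    filter_upwards [h1, h2] with ξ h1 h2
    rw [h1, h2, fourier_eq_angularFourier, fourier_eq_angularFourier, hF e1, hF e2, he]
  have h4 : hf2.toLp f = hh2.toLp h := (Lp.fourierTransformₗᵢ ℝ ℂ).injective h3
  exact (MemLp.toLp_eq_toLp_iff _ _).1 h4

theorem conj_mem_halfPlane {up : Bool} {k : ℂ} (hk : k ∈ halfPlane up) :
    conj k ∈ halfPlane (!up) := by
  cases up <;> simpa [halfPlane] using hk

/-- If `⟨R₀(k)g, g⟩` is real for a nonreal `k`, then `R₀(k)g = 0`. This is the identity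
`R₀(k) - R₀(k̄) = (k - k̄) R₀(k̄) R₀(k)`, paired with `g`. -/
theorem resConv_ae_eq_zero_of_im_eq_zero {up : Bool} {k : ℂ} (hk : k ∈ halfPlane up)
    (hk0 : k.im ≠ 0) {g : ℝ → ℂ} (hg : Integrable g)
    (h : (∫ x, resConv up k g x * conj (g x)).im = 0) : resConv up k g =ᵐ[volume] 0 := by
  have hk' := conj_mem_halfPlane hk
  have hk0' : (conj k).im ≠ 0 := by simpa using hk0
  obtain ⟨i1, F1⟩ := integrable_resConv_of_im hk hk0 hg
  obtain ⟨i2, F2⟩ := integrable_resConv_of_im hk' hk0' hg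
  obtain ⟨i3, F3⟩ := integrable_resConv_of_im hk' hk0' i1
  have t1 := memLp_top_resConv hk hg
  have t2 := memLp_top_resConv hk' hg
  have t3 := memLp_top_resConv hk' i1
  -- The resolvent identity off the real axis is checked on the Fourier side.
  have h1 : (fun x => resConv up k g x - resConv (!up) (conj k) g x) =ᵐ[volume]
      fun x => (k - conj k) * resConv (!up) (conj k) (resConv up k g) x := by
    refine ae_eq_of_angularFourier_eq (i1.sub i2)
      ((memLp_two_of_integrable_of_top i1 t1).sub (memLp_two_of_integrable_of_top i2 t2))
      (i3.const_mul _) ((memLp_two_of_integrable_of_top i3 t3).const_mul _) fun ξ => ?_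
    have e1 : angularFourier (fun x => resConv up k g x - resConv (!up) (conj k) g x) ξ =
        angularFourier (resConv up k g) ξ - angularFourier (resConv (!up) (conj k) g) ξ := by
      rw [angularFourier, angularFourier, angularFourier,
        ← integral_sub (integrable_exp_mul i1 ξ) (integrable_exp_mul i2 ξ)]
      simp only [mul_sub]
    have e2 : angularFourier (fun x => (k - conj k) *
        resConv (!up) (conj k) (resConv up k g) x) ξ =
        (k - conj k) * angularFourier (resConv (!up) (conj k) (resConv up k g)) ξ := by
      rw [angularFourier, angularFourier, ← integral_const_mul]
      exact integral_congr_ae (ae_of_all _ fun x => by simp only; ring)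
    have n1 : (ξ : ℂ) - k ≠ 0 := fun h0 => hk0 (by simpa using congrArg im h0)
    have n2 : (ξ : ℂ) - conj k ≠ 0 := fun h0 => hk0 (by simpa using congrArg im h0)
    rw [e1, e2, F1, F2, F3, F1]
    field_simp
    ring
  have h2 : ∫ x, resConv (!up) (conj k) g x * conj (g x) =
      conj (∫ x, resConv up k g x * conj (g x)) := by
    have := integral_resConv_mul_conj hk' hg hg
    rw [this, ← integral_conj]
    simp [mul_comm]
  have h3 : ∫ x, resConv (!up) (conj k) (resConv up k g) x * conj (g x) =
      ∫ x, resConv up k g x * conj (resConv up k g x) := by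
    have := integral_resConv_mul_conj hk' i1 hg
    simpa using this
  have j : ∀ {u : ℝ → ℂ}, MemLp u ∞ → Integrable fun x => u x * conj (g x) := fun hu =>
    (conjCLE.toContinuousLinearMap.integrable_comp hg).mul_of_top_right hu
  have h4 : (k - conj k) * ∫ x, resConv up k g x * conj (resConv up k g x) = 0 := by
    rw [← h3, ← integral_const_mul]
    have : (fun x => (k - conj k) * (resConv (!up) (conj k) (resConv up k g) x * conj (g x)))
        =ᵐ[volume] fun x => resConv up k g x * conj (g x) -
          resConv (!up) (conj k) g x * conj (g x) := by
      filter_upwards [h1] with x hx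
      rw [← mul_assoc, ← hx]; ring
    rw [integral_congr_ae this, integral_sub (j t1) (j t2), h2, sub_conj, h]
    simp
  have h5 : k - conj k ≠ 0 := by
    rw [sub_conj]; simpa [I_ne_zero] using hk0
  have h6 := (mul_eq_zero.1 h4).resolve_left h5
  have m1 := memLp_two_of_integrable_of_top i1 t1
  have h7 : ∫ x, ‖resConv up k g x‖ ^ 2 = 0 := by
    have : ∫ x, resConv up k g x * conj (resConv up k g x) =
        ((∫ x, ‖resConv up k g x‖ ^ 2 : ℝ) : ℂ) := by
      rw [← integral_complex_ofReal]
      refine integral_congr_ae (ae_of_all _ fun x => ?_)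
      simp only [mul_conj, normSq_eq_norm_sq]
    rw [this] at h6
    exact_mod_cast h6
  rw [integral_eq_zero_iff_of_nonneg (fun _ => by positivity)
    (memLp_two_iff_integrable_sq_norm m1.1 |>.1 m1)] at h7
  filter_upwards [h7] with x hx
  simpa using hx

/-- If `⟨R₀(λ ± 0i)g, g⟩` is real, then the Fourier transform of `g` vanishes at `λ`. -/
theorem angularFourier_eq_zero_of_im_eq_zero {up : Bool} {lam : ℝ} {g : ℝ → ℂ}
    (hg : Integrable g) (h : (∫ x, resConv up lam g x * conj (g x)).im = 0) :
    angularFourier g lam = 0 := by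
  have hc : ∀ up : Bool, ∫ x, resConv (!up) lam g x * conj (g x) =
      conj (∫ x, resConv up lam g x * conj (g x)) := by
    intro up
    have := integral_resConv_mul_conj (ofReal_mem_halfPlane (!up) lam) hg hg
    rw [this, ← integral_conj]
    refine integral_congr_ae (ae_of_all _ fun x => ?_)
    simp only [map_mul, conj_conj, Bool.not_not, conj_ofReal]
    ring
  have j : ∀ up, Integrable fun x => resConv up lam g x * conj (g x) := fun up =>
    (conjCLE.toContinuousLinearMap.integrable_comp hg).mul_of_top_right
      (memLp_top_resConv (ofReal_mem_halfPlane up lam) hg)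
  have h0 : ∀ b, (∫ x, resConv b lam g x * conj (g x)).im = 0 := by
    intro b
    by_cases hb : b = up
    · rw [hb]; exact h
    · have : b = !up := by cases b <;> cases up <;> first | rfl | exact absurd rfl hb
      rw [this, hc, conj_im, h, neg_zero]
  have h1 : ∫ x, (resConv true lam g x - resConv false lam g x) * conj (g x) = 0 := by
    simp only [sub_mul]
    rw [integral_sub (j true) (j false), show false = !true from rfl, hc true, sub_conj, h0 true]
    simp
  -- The jump of the resolvent, paired with `g`, is `i |ĝ(lam)|²`.
  have h2 : ∫ x, (resConv true lam g x - resConv false lam g x) * conj (g x) =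
      I * angularFourier g lam * conj (angularFourier g lam) := by
    rw [angularFourier, ← integral_conj, ← integral_const_mul]
    refine integral_congr_ae (ae_of_all _ fun x => ?_)
    simp only
    rw [resConv_true_sub_false lam hg, map_mul, ← exp_conj]
    have : conj (-(I * lam * x)) = I * lam * x := by simp
    rw [this, angularFourier]
    ring
  rw [h2, mul_assoc, mul_conj] at h1
  have := (mul_eq_zero.1 h1).resolve_left I_ne_zero
  exact normSq_eq_zero.1 (by exact_mod_cast this)

/-! ### Decay -/

/-- The weight `⟨x⟩ = (1 + x²)^{1/2}`. -/
def jbracket (x : ℝ) : ℝ := Real.sqrt (1 + x ^ 2)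

theorem jbracket_pos (x : ℝ) : 0 < jbracket x := Real.sqrt_pos.2 (by positivity)

theorem one_le_jbracket (x : ℝ) : 1 ≤ jbracket x := Real.one_le_sqrt.2 (by nlinarith)

theorem abs_le_jbracket (x : ℝ) : |x| ≤ jbracket x :=
  Real.abs_le_sqrt (by linarith)

theorem jbracket_le_of_abs_le {x y : ℝ} (h : |x| ≤ |y|) : jbracket x ≤ jbracket y :=
  Real.sqrt_le_sqrt (by have := sq_le_sq.2 h; linarith)

theorem continuous_jbracket : Continuous jbracket := by unfold jbracket; fun_prop

/-- As `ĝ(lam) = 0`, the value at `x` is an integral over the half-line beyond `x`, where the weight is at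
least `⟨x⟩ˢ`. -/
theorem norm_resConv_le_jbracket {lam s : ℝ} (hs : 0 ≤ s) {g : ℝ → ℂ} (hg : Integrable g)
    (hgs : Integrable fun x => jbracket x ^ s * ‖g x‖) (h0 : angularFourier g lam = 0) (x : ℝ) :
    ‖resConv true lam g x‖ ≤ jbracket x ^ (-s) * ∫ y, jbracket y ^ s * ‖g y‖ := by
  have key : ∀ S : Set ℝ, MeasurableSet S → (∀ y ∈ S, |x| ≤ |y|) →
      ‖∫ y in S, exp (-(I * lam * y)) * g y‖ ≤ jbracket x ^ (-s) * ∫ y, jbracket y ^ s * ‖g y‖ := by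
    intro S hS hxS
    rw [← integral_indicator hS, ← integral_const_mul]
    refine norm_integral_le_of_norm_le (hgs.const_mul _) (ae_of_all _ fun y => ?_)
    by_cases hy : y ∈ S
    · rw [Set.indicator_of_mem hy, norm_mul, norm_exp_neg_I_mul, one_mul, ← mul_assoc]
      refine le_mul_of_one_le_left (norm_nonneg _) ?_
      rw [Real.rpow_neg (jbracket_pos x).le, inv_mul_eq_div, one_le_div
        (Real.rpow_pos_of_pos (jbracket_pos x) s)]
      exact Real.rpow_le_rpow (jbracket_pos x).le (jbracket_le_of_abs_le (hxS y hy)) hs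
    · rw [Set.indicator_of_notMem hy, norm_zero]
      have := Real.rpow_nonneg (jbracket_pos x).le (-s)
      have := Real.rpow_nonneg (jbracket_pos y).le s
      positivity
  rcases le_or_gt x 0 with hx | hx
  · rw [norm_resConv_true_ofReal]
    refine key _ measurableSet_Iio fun y hy => ?_
    have hy' : y < x := hy
    rw [abs_of_nonpos hx, abs_of_nonpos (hy'.le.trans hx)]; linarith
  · rw [resConv_eq_of_angularFourier_eq_zero true false hg h0, norm_resConv_false_ofReal]
    refine key _ measurableSet_Ioi fun y hy => ?_
    have hy' : x < y := hy
    rw [abs_of_pos hx, abs_of_pos (hx.trans hy')]; exact hy'.le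

/-! ### Weak solutions of `-i φ' = λφ + g` -/

theorem hasDerivAt_exp_neg_I_mul (lam x : ℝ) :
    HasDerivAt (fun x : ℝ => exp (-(I * lam * x))) (exp (-(I * lam * x)) * (-(I * lam))) x := by
  have := ((ofRealCLM.hasDerivAt (x := x)).const_mul (I * lam)).fun_neg
  simp only [ofRealCLM_apply, ofReal_one, mul_one] at this
  exact this.cexp

theorem resConv_false_deriv (lam : ℝ) {η : ℝ → ℂ} (h1 : ContDiff ℝ ∞ η)
    (h2 : HasCompactSupport η) (y : ℝ) :
    resConv false lam (deriv η) y = I * η y + I * lam * resConv false lam η y := by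
  have hd : ∀ x, HasDerivAt η (deriv η x) x := fun x =>
    (h1.differentiable (by simp) x).hasDerivAt
  have hcd : Continuous (deriv η) := h1.continuous_deriv (by simp)
  have i1 : Integrable fun x : ℝ => exp (-(I * lam * x)) * deriv η x :=
    integrable_exp_mul (hcd.integrable_of_hasCompactSupport h2.deriv) lam
  have i2 : Integrable fun x : ℝ => exp (-(I * lam * x)) * η x :=
    integrable_exp_mul (h1.continuous.integrable_of_hasCompactSupport h2) lam
  have hF : ∀ x : ℝ, HasDerivAt (fun x : ℝ => exp (-(I * lam * x)) * η x)
      (-(I * lam) * (exp (-(I * lam * x)) * η x) + exp (-(I * lam * x)) * deriv η x) x := by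
    intro x
    refine ((hasDerivAt_exp_neg_I_mul lam x).fun_mul (hd x)).congr_deriv ?_
    ring
  have hlim : Tendsto (fun x : ℝ => exp (-(I * lam * x)) * η x) atTop (𝓝 0) := by
    have hcs : HasCompactSupport fun x : ℝ => exp (-(I * lam * x)) * η x := h2.mul_left
    exact hcs.is_zero_at_infty.mono_left atTop_le_cocompact
  have h := integral_Ioi_of_hasDerivAt_of_tendsto' (a := y) (fun x _ => hF x)
    ((i2.const_mul _).add i1).integrableOn hlim
  rw [integral_add (i2.const_mul _).integrableOn i1.integrableOn, integral_const_mul] at h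
  rw [resConv_false_ofReal, resConv_false_ofReal]
  have he : exp (I * lam * y) * exp (-(I * lam * y)) = 1 := by rw [← exp_add]; simp
  have h' : ∫ x in Set.Ioi y, exp (-(I * lam * x)) * deriv η x =
      -(exp (-(I * lam * y)) * η y) + I * lam * ∫ x in Set.Ioi y, exp (-(I * lam * x)) * η x := by
    linear_combination h
  rw [h']
  linear_combination (I * η y) * he

/-- `φ = R₀(λ + 0i)g` solves `-i φ' = λφ + g` weakly. -/
theorem integral_resConv_mul_deriv (lam : ℝ) {g χ : ℝ → ℂ} (hg : Integrable g)
    (h1 : ContDiff ℝ ∞ χ) (h2 : HasCompactSupport χ) :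
    ∫ x, resConv true lam g x * deriv χ x =
      -∫ x, (I * (lam * resConv true lam g x + g x)) * χ x := by
  set η : ℝ → ℂ := fun x => conj (χ x) with hη
  have hη1 : ContDiff ℝ ∞ η := conjCLE.contDiff.comp h1
  have hη2 : HasCompactSupport η := h2.comp_left (g := fun z : ℂ => conj z) (by simp)
  have hdη : ∀ x, deriv η x = conj (deriv χ x) := fun x => by
    have : HasDerivAt χ (deriv χ x) x := (h1.differentiable (by simp) x).hasDerivAt
    exact (conjCLE.toContinuousLinearMap.hasFDerivAt.comp_hasDerivAt x this).deriv
  have iη : Integrable η := hη1.continuous.integrable_of_hasCompactSupport hη2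
  have idη : Integrable (deriv η) := (hη1.continuous_deriv (by simp)).integrable_of_hasCompactSupport hη2.deriv
  have hmem := ofReal_mem_halfPlane true lam
  have a1 := integral_resConv_mul_conj hmem hg idη
  have a2 := integral_resConv_mul_conj hmem hg iη
  simp only [conj_ofReal, Bool.not_true] at a1 a2
  simp only [resConv_false_deriv lam hη1 hη2] at a1
  simp only [hdη, conj_conj] at a1
  simp only [hη, conj_conj] at a2
  rw [a1]
  have i1 : Integrable fun x => g x * χ x := by
    refine hg.mul_of_top_left (test_memLp h1 h2 ∞)
  have i2 : Integrable fun x => resConv true lam g x * χ x :=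
    (h1.continuous.integrable_of_hasCompactSupport h2).mul_of_top_right (memLp_top_resConv hmem hg)
  have i3 : Integrable fun x => g x * conj (resConv false lam η x) :=
    hg.mul_of_top_left (memLp_top_resConv (ofReal_mem_halfPlane false lam) iη).star
  have e1 : ∀ x, g x * conj (I * η x + I * lam * resConv false lam η x) =
      -I * (g x * χ x) + (-I * lam) * (g x * conj (resConv false lam η x)) := fun x => by
    simp only [map_add, map_mul, conj_I, conj_ofReal, hη, conj_conj]; ring
  have e2 : ∀ x, (I * (lam * resConv true lam g x + g x)) * χ x =
      I * (g x * χ x) + (I * lam) * (resConv true lam g x * χ x) := fun x => by ring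
  simp only [e1, e2]
  rw [integral_add (i1.const_mul _) (i3.const_mul _), integral_add (i1.const_mul _) (i2.const_mul _)]
  simp only [integral_const_mul]
  rw [a2]
  ring

/-- A locally integrable function with vanishing weak derivative is constant. -/
theorem ae_eq_const_of_weak_deriv_eq_zero {F : ℝ → ℂ} (hF : LocallyIntegrable F)
    (h : ∀ χ : ℝ → ℂ, ContDiff ℝ ∞ χ → HasCompactSupport χ → ∫ x, F x * deriv χ x = 0) :
    ∃ c : ℂ, F =ᵐ[volume] fun _ => c := by
  obtain ⟨b⟩ : Nonempty (ContDiffBump (0 : ℝ)) := inferInstance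
  -- The constant is the average of `F` against a fixed test function of integral one.
  set χ₀ : ℝ → ℂ := fun x => (b.normed volume x : ℂ) with hχ₀
  have c1 : ContDiff ℝ ∞ χ₀ := ofRealCLM.contDiff.comp b.contDiff_normed
  have c2 : HasCompactSupport χ₀ := b.hasCompactSupport_normed.comp_left (g := ofReal) (by simp)
  have c3 : ∫ x, χ₀ x = 1 := by
    simp only [hχ₀]
    rw [integral_complex_ofReal, b.integral_normed, ofReal_one]
  have hFi : ∀ {ψ : ℝ → ℂ}, ContDiff ℝ ∞ ψ → HasCompactSupport ψ → Integrable fun x => F x * ψ x :=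
    fun h1 h2 => by
      simpa [mul_comm] using hF.integrable_smul_left_of_hasCompactSupport h1.continuous h2
  refine ⟨∫ x, F x * χ₀ x, ae_eq_of_forall_test hF continuous_const.locallyIntegrable
    fun ψ h1 h2 => ?_⟩
  set η : ℝ → ℂ := fun x => ψ x - (∫ y, ψ y) * χ₀ x with hη
  have η1 : ContDiff ℝ ∞ η := h1.sub (contDiff_const.mul c1)
  have η2 : HasCompactSupport η := h2.sub (c2.mul_left)
  have iψ : Integrable ψ := h1.continuous.integrable_of_hasCompactSupport h2
  have iχ : Integrable χ₀ := c1.continuous.integrable_of_hasCompactSupport c2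
  have η3 : ∫ x, η x = 0 := by
    rw [hη, integral_sub iψ (iχ.const_mul _), integral_const_mul, c3]; simp
  obtain ⟨R, hR⟩ := η2.isCompact.isBounded.subset_closedBall (0 : ℝ)
  have hz : ∀ x, R < |x| → η x = 0 := fun x hx => by
    by_contra hne
    have := hR (subset_tsupport _ hne)
    rw [mem_closedBall_zero_iff, Real.norm_eq_abs] at this
    linarith
  -- The primitive of `η` is a test function since `η` has integral zero.
  set χ : ℝ → ℂ := fun x => ∫ y in (-(|R| + 1))..x, η y with hχ
  have hd : ∀ x, HasDerivAt χ (η x) x := fun x =>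
    intervalIntegral.integral_hasDerivAt_right (η1.continuous.intervalIntegrable _ _)
      (η1.continuous.stronglyMeasurableAtFilter _ _) η1.continuous.continuousAt
  have hderiv : deriv χ = η := funext fun x => (hd x).deriv
  have χ1 : ContDiff ℝ ∞ χ := contDiff_infty_iff_deriv.2
    ⟨fun x => (hd x).differentiableAt, by rw [hderiv]; exact η1⟩
  have χ2 : HasCompactSupport χ := by
    refine HasCompactSupport.of_support_subset_isCompact
      (isCompact_Icc (a := -(|R| + 1)) (b := |R| + 1)) fun x hx => ?_
    by_contra hne
    refine hx ?_
    simp only [Set.mem_Icc, not_and_or, not_le] at hne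
    have hRa := le_abs_self R
    rcases hne with hne | hne
    · simp only [hχ]
      refine intervalIntegral.integral_zero_ae (ae_of_all _ fun y hy => ?_)
      rw [Set.uIoc_of_ge hne.le] at hy
      have := neg_le_abs y
      exact hz y (by linarith [hy.2])
    · simp only [hχ]
      rw [intervalIntegral.integral_of_le (by have := abs_nonneg R; linarith),
        setIntegral_eq_integral_of_forall_compl_eq_zero, η3]
      intro y hy
      simp only [Set.mem_Ioc, not_and_or, not_le, not_lt] at hy
      rcases hy with hy | hy
      · exact hz y (by have := neg_le_abs y; linarith)
      · exact hz y (by have := le_abs_self y; linarith)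
  have h3 := h χ χ1 χ2
  rw [hderiv] at h3
  have h4 : ∀ x, F x * η x = F x * ψ x - (∫ y, ψ y) * (F x * χ₀ x) := fun x => by
    rw [hη]; ring
  simp only [h4] at h3
  rw [integral_sub (hFi h1 h2) ((hFi c1 c2).const_mul _), integral_const_mul] at h3
  rw [integral_const_mul]
  linear_combination h3

theorem eq_zero_of_tendsto_norm_of_memLp {l : Filter ℝ} (hl : ∀ s ∈ l, volume s = ⊤) {f : ℝ → ℂ}
    (hf : MemLp f 2) {a : ℝ} (h : Tendsto (fun x => ‖f x‖) l (𝓝 a)) : a = 0 := by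
  have h1 : Integrable fun x => ‖f x‖ ^ 2 := (memLp_two_iff_integrable_sq_norm hf.1).1 hf
  have h2 := (h1.integrableAtFilter l).eq_zero_of_tendsto hl (h.pow 2)
  simpa using h2

theorem volume_of_mem_atTop (s : Set ℝ) (hs : s ∈ (atTop : Filter ℝ)) : volume s = ⊤ := by
  obtain ⟨b, hb⟩ := mem_atTop_sets.1 hs
  rw [← top_le_iff, ← Real.volume_Ici (a := b)]
  exact measure_mono hb

theorem volume_of_mem_atBot (s : Set ℝ) (hs : s ∈ (atBot : Filter ℝ)) : volume s = ⊤ := by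
  obtain ⟨b, hb⟩ := mem_atBot_sets.1 hs
  rw [← top_le_iff, ← Real.volume_Iic (a := b)]
  exact measure_mono hb

/-- A square integrable weak solution of `-i φ' = λφ + g` is given by the free resolvent, and
the Fourier transform of `g` vanishes at `λ`, since `φ` tends to zero at both ends. -/
theorem ae_eq_resConv_of_weak_solution (lam : ℝ) {φ g : ℝ → ℂ} (hφ : MemLp φ 2)
    (hg : Integrable g)
    (h : ∀ χ : ℝ → ℂ, ContDiff ℝ ∞ χ → HasCompactSupport χ →
      ∫ x, φ x * deriv χ x = -∫ x, (I * (lam * φ x + g x)) * χ x) :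
    φ =ᵐ[volume] resConv true lam g ∧ angularFourier g lam = 0 := by
  have hmem := ofReal_mem_halfPlane true lam
  have hT := memLp_top_resConv hmem hg
  have hlφ : LocallyIntegrable φ := hφ.locallyIntegrable (by norm_num)
  have hlR : LocallyIntegrable (resConv true lam g) := hT.locallyIntegrable (by norm_num)
  set F : ℝ → ℂ := fun x => exp (-(I * lam * x)) * (φ x - resConv true lam g x) with hF
  have hlF : LocallyIntegrable F := by
    have h1 := ((memLp_exp_mul hφ lam).locallyIntegrable (by norm_num)).sub
      ((memLp_exp_mul hT lam).locallyIntegrable (by norm_num))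
    have h2 : F = (fun x : ℝ => exp (-(I * lam * x)) * φ x) -
        fun x : ℝ => exp (-(I * lam * x)) * resConv true lam g x := by
      ext x; simp only [hF, Pi.sub_apply]; ring
    rw [h2]; exact h1
  -- The difference of two solutions, modulated by `e^{-ilam x}`, has zero weak derivative.
  obtain ⟨c, hc⟩ := ae_eq_const_of_weak_deriv_eq_zero hlF fun ψ h1 h2 => by
    have k1 : ContDiff ℝ ∞ fun x : ℝ => exp (-(I * lam * x)) * ψ x := by
      refine ContDiff.mul (ContDiff.cexp ?_) h1
      exact (contDiff_const.mul ofRealCLM.contDiff).neg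
    have k2 : HasCompactSupport fun x : ℝ => exp (-(I * lam * x)) * ψ x := h2.mul_left
    have hd : ∀ x, deriv (fun x : ℝ => exp (-(I * lam * x)) * ψ x) x =
        exp (-(I * lam * x)) * deriv ψ x - I * lam * (exp (-(I * lam * x)) * ψ x) := by
      intro x
      rw [((hasDerivAt_exp_neg_I_mul lam x).fun_mul (h1.differentiable (by simp) x).hasDerivAt).deriv]
      ring
    have a1 := h _ k1 k2
    have a2 := integral_resConv_mul_deriv lam hg k1 k2
    have j : ∀ {u ψ : ℝ → ℂ}, LocallyIntegrable u → ContDiff ℝ ∞ ψ → HasCompactSupport ψ →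
        Integrable fun x => u x * ψ x := fun hu h1 h2 => by
      simpa [mul_comm] using hu.integrable_smul_left_of_hasCompactSupport h1.continuous h2
    have kd1 : ContDiff ℝ ∞ (deriv fun x : ℝ => exp (-(I * lam * x)) * ψ x) :=
      (contDiff_infty_iff_deriv.1 k1).2
    have a3 := integral_sub (j hlφ kd1 k2.deriv) (j hlR kd1 k2.deriv)
    rw [a1, a2] at a3
    have lg := hg.locallyIntegrable
    have e1 : ∀ u : ℝ → ℂ, (fun x => (I * (lam * u x + g x)) * (exp (-(I * lam * x)) * ψ x)) =
        fun x => (I * lam) * (u x * (exp (-(I * lam * x)) * ψ x)) + I * (g x * (exp (-(I * lam * x)) * ψ x)) := fun u => by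
      ext x; ring
    rw [e1, e1, integral_add ((j hlφ k1 k2).const_mul _) ((j lg k1 k2).const_mul _),
      integral_add ((j hlR k1 k2).const_mul _) ((j lg k1 k2).const_mul _)] at a3
    have e2 : ∀ x, F x * deriv ψ x =
        (φ x * deriv (fun x : ℝ => exp (-(I * lam * x)) * ψ x) x -
          resConv true lam g x * deriv (fun x : ℝ => exp (-(I * lam * x)) * ψ x) x) +
        ((I * lam) * (φ x * (exp (-(I * lam * x)) * ψ x)) -
          (I * lam) * (resConv true lam g x * (exp (-(I * lam * x)) * ψ x))) := fun x => by
      rw [hd, hF]; ring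
    simp only [e2]
    have s1 : Integrable fun x => φ x * deriv (fun x : ℝ => exp (-(I * lam * x)) * ψ x) x -
        resConv true lam g x * deriv (fun x : ℝ => exp (-(I * lam * x)) * ψ x) x :=
      (j hlφ kd1 k2.deriv).sub (j hlR kd1 k2.deriv)
    have s2 : Integrable fun x => (I * lam) * (φ x * (exp (-(I * lam * x)) * ψ x)) -
        (I * lam) * (resConv true lam g x * (exp (-(I * lam * x)) * ψ x)) :=
      ((j hlφ k1 k2).const_mul _).sub ((j hlR k1 k2).const_mul _)
    rw [integral_add s1 s2, a3,
      integral_sub ((j hlφ k1 k2).const_mul _) ((j hlR k1 k2).const_mul _)]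
    ring
  -- `φ - R₀(λ + 0i)g = c e^{iλx}`
  have h1 : ∀ᵐ x : ℝ, φ x = resConv true lam g x + c * exp (I * lam * x) := by
    filter_upwards [hc] with x hx
    have he : exp (I * lam * x) * exp (-(I * lam * x)) = 1 := by rw [← exp_add]; simp
    have hx' : exp (-(I * lam * x)) * (φ x - resConv true lam g x) = c := hx
    linear_combination (-(φ x - resConv true lam g x)) * he + exp (I * lam * x) * hx'
  have hc0 : c = 0 := by
    have m1 : MemLp (fun x : ℝ => resConv true lam g x + c * exp (I * lam * x)) 2 :=
      (memLp_congr_ae h1).1 hφ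
    have hz : Tendsto (resConv true lam g) atBot (𝓝 0) :=
      tendsto_zero_iff_norm_tendsto_zero.2 (tendsto_norm_resConv_atBot lam hg)
    have hz2 : Tendsto (fun x : ℝ => exp (-(I * lam * x)) * resConv true lam g x + c) atBot
        (𝓝 (0 + c)) := by
      refine Tendsto.add_const c ?_
      rw [tendsto_zero_iff_norm_tendsto_zero]
      simpa [norm_exp_neg_I_mul] using tendsto_norm_resConv_atBot lam hg
    have h2 := eq_zero_of_tendsto_norm_of_memLp volume_of_mem_atBot m1 (a := ‖c‖) (by
      have := hz2.norm
      rw [zero_add] at this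
      refine this.congr fun x => ?_
      have he : exp (I * lam * x) * exp (-(I * lam * x)) = 1 := by rw [← exp_add]; simp
      have : exp (-(I * lam * x)) * resConv true lam g x + c =
          exp (-(I * lam * x)) * (resConv true lam g x + c * exp (I * lam * x)) := by
        linear_combination (-c) * he
      rw [this, norm_mul, norm_exp_neg_I_mul, one_mul])
    exact norm_eq_zero.1 h2
  have h2 : φ =ᵐ[volume] resConv true lam g := by
    filter_upwards [h1] with x hx
    rw [hx, hc0, zero_mul, add_zero]
  refine ⟨h2, norm_eq_zero.1 ?_⟩
  exact eq_zero_of_tendsto_norm_of_memLp volume_of_mem_atTop ((memLp_congr_ae h2).1 hφ)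
    (tendsto_norm_resConv_atTop lam hg)

/-! ### The topology of the cut plane -/

namespace CutPlane

theorem off_val_ne (k : ℂ) (hk : ¬(0 < k.re ∧ k.im = 0)) {lam : ℝ} (hlam : 0 < lam) :
    k ≠ lam := by
  rintro rfl; exact hk (by simpa using hlam)

theorem Near.self (p : CutPlane) {ε : ℝ} (hε : 0 < ε) : Near p ε p := by
  refine ⟨by simpa using hε, ?_⟩
  cases p with
  | off k hk => trivial
  | edge up lam h => exact Iff.rfl

theorem Near.mono {p p' : CutPlane} {ε ε' : ℝ} (h : Near p ε p') (hε : ε ≤ ε') : Near p ε' p' :=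
  ⟨h.1.trans_le hε, h.2⟩

theorem isUpper_edge (up : Bool) (lam : ℝ) (h : 0 < lam) : (edge up lam h).IsUpper ↔ up = true :=
  Iff.rfl

theorem isUpper_off (k : ℂ) (h) : (off k h).IsUpper ↔ 0 ≤ k.im := Iff.rfl

/-- Sufficiently small basic neighbourhoods are open. -/
theorem exists_isOpen_near (p : CutPlane) {ε : ℝ} (hε : 0 < ε) :
    ∃ ε' > 0, ε' ≤ ε ∧ IsOpen {p' | Near p ε' p'} := by
  cases p with
  | off k hk =>
    refine ⟨ε, hε, le_rfl, fun p' hp' => ⟨ε - ‖p'.val - k‖, sub_pos.2 hp'.1, fun p'' h => ?_⟩⟩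
    refine ⟨?_, trivial⟩
    have h1 := h.1
    have : ‖p''.val - k‖ ≤ ‖p''.val - p'.val‖ + ‖p'.val - k‖ := by
      simpa using norm_add_le (p''.val - p'.val) (p'.val - k)
    change ‖p''.val - k‖ < ε
    linarith
  | edge up lam hlam =>
    refine ⟨min ε lam, lt_min hε hlam, min_le_left _ _, fun p' hp' => ?_⟩
    obtain ⟨hp1, hp2⟩ := hp'
    change ‖p'.val - lam‖ < _ at hp1
    have hd : ∀ p'' : CutPlane, ‖p''.val - p'.val‖ < min ε lam - ‖p'.val - lam‖ →
        ‖p''.val - lam‖ < min ε lam := by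
      intro p'' h
      have : ‖p''.val - lam‖ ≤ ‖p''.val - p'.val‖ + ‖p'.val - lam‖ := by
        simpa using norm_add_le (p''.val - p'.val) (p'.val - lam)
      linarith
    cases p' with
    | edge up' lam' h' =>
      refine ⟨_, sub_pos.2 hp1, fun p'' h => ⟨hd p'' h.1, ?_⟩⟩
      exact (h.2 : _ ↔ _).trans hp2
    | off k' hk' =>
      -- `k'` has positive real part, hence lies strictly off the real axis.
      have hre : 0 < k'.re := by
        have h1 : |(k' - lam).re| < lam := (abs_re_le_norm _).trans_lt (hp1.trans_le (min_le_right _ _))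
        rw [sub_re, ofReal_re, abs_lt] at h1
        linarith [h1.1]
      have him : k'.im ≠ 0 := fun h => hk' ⟨hre, h⟩
      refine ⟨min (min ε lam - ‖k' - lam‖) |k'.im|, lt_min (sub_pos.2 hp1) (abs_pos.2 him),
        fun p'' h => ⟨hd p'' (h.1.trans_le (min_le_left _ _)), ?_⟩⟩
      have h1 : |(p''.val - k').im| < |k'.im| :=
        (abs_im_le_norm _).trans_lt (h.1.trans_le (min_le_right _ _))
      rw [sub_im] at h1
      have hp2' : 0 ≤ k'.im ↔ up = true := hp2
      refine Iff.trans ?_ hp2'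
      have hup : p''.IsUpper ↔ 0 ≤ p''.val.im := by
        cases p'' with
        | off k'' _ => exact Iff.rfl
        | edge up'' lam'' _ => simp [val] at h1
      rw [hup]
      rcases lt_or_gt_of_ne him with h2 | h2
      · rw [abs_of_neg h2] at h1
        have := (abs_lt.1 h1).2
        constructor <;> intro <;> linarith
      · rw [abs_of_pos h2] at h1
        have := (abs_lt.1 h1).1
        constructor <;> intro <;> linarith

theorem nhds_hasBasis (p : CutPlane) :
    (𝓝 p).HasBasis (fun ε : ℝ => 0 < ε) (fun ε => {p' | Near p ε p'}) := by
  refine ⟨fun U => ⟨fun hU => ?_, ?_⟩⟩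
  · obtain ⟨V, hVU, hV, hp⟩ := mem_nhds_iff.1 hU
    obtain ⟨ε, hε, h⟩ := hV p hp
    exact ⟨ε, hε, fun p' hp' => hVU (h p' hp')⟩
  · rintro ⟨ε, hε, h⟩
    obtain ⟨ε', h1, h2, h3⟩ := exists_isOpen_near p hε
    exact mem_of_superset (h3.mem_nhds (Near.self p h1)) fun p' hp' => h (Near.mono hp' h2)

instance : FirstCountableTopology CutPlane where
  nhds_generated_countable p := by
    have h : (𝓝 p).HasBasis (fun _ : ℕ => True) (fun n => {p' | Near p (1 / ((n : ℝ) + 1)) p'}) := by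
      refine (nhds_hasBasis p).to_hasBasis (fun ε hε => ?_) fun n _ => ⟨_, by positivity, le_rfl⟩
      obtain ⟨n, hn⟩ := exists_nat_one_div_lt hε
      exact ⟨n, trivial, fun p' hp' => Near.mono hp' hn.le⟩
    exact h.isCountablyGenerated

theorem continuous_val : Continuous val := by
  refine continuous_iff_continuousAt.2 fun p => ?_
  rw [ContinuousAt, Metric.tendsto_nhds]
  intro ε hε
  filter_upwards [(nhds_hasBasis p).mem_of_mem hε] with p' hp'
  rw [dist_eq_norm]; exact hp'.1

theorem exists_not_near {p p' : CutPlane} (h : p ≠ p') : ∃ ε > 0, ¬Near p ε p' := by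
  by_cases hv : p'.val = p.val
  · refine ⟨1, one_pos, fun hn => ?_⟩
    cases p with
    | off k hk =>
      cases p' with
      | off k' hk' => exact h (by simp only [val] at hv; subst hv; rfl)
      | edge up lam hlam => exact off_val_ne k hk hlam hv.symm
    | edge up lam hlam =>
      cases p' with
      | off k' hk' => exact off_val_ne k' hk' hlam hv
      | edge up' lam' hlam' =>
        simp only [val, ofReal_inj] at hv
        subst hv
        have h2 : (up' = true ↔ up = true) := hn.2
        have : up' = up := by cases up <;> cases up' <;> simp_all
        subst this
        exact h rfl
  · exact ⟨‖p'.val - p.val‖, norm_pos_iff.2 (sub_ne_zero.2 hv), fun hn => lt_irrefl _ hn.1⟩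

instance : T1Space CutPlane where
  t1 p := by
    rw [← isOpen_compl_iff]
    intro p' hp'
    obtain ⟨ε, hε, h⟩ := exists_not_near (p := p') (p' := p) hp'
    exact ⟨ε, hε, fun p'' h2 h3 => h (by rw [Set.mem_singleton_iff] at h3; rwa [← h3])⟩

instance nhdsWithin_compl_singleton_neBot (p : CutPlane) : (𝓝[≠] p).NeBot := by
  rw [(nhdsWithin_hasBasis (nhds_hasBasis p) _).neBot_iff]
  intro ε hε
  have key : ∀ (k : ℂ) (c : ℝ), c ≠ 0 → |c| < ε → (k + c * I).im ≠ 0 →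
      ∃ hk : ¬(0 < (k + c * I).re ∧ (k + c * I).im = 0),
        ‖(off (k + c * I) hk).val - k‖ < ε ∧ (off (k + c * I) hk).val ≠ k := by
    intro k c hc hcε him
    refine ⟨fun h => him h.2, ?_, ?_⟩
    · simpa [val] using hcε
    · simp [val, hc]
  have hε2 : |ε / 2| < ε := by rw [abs_of_pos (half_pos hε)]; exact half_lt_self hε
  cases p with
  | off k hk =>
    rcases le_or_gt 0 k.im with h | h
    · obtain ⟨hk', h1, h2⟩ := key k (ε / 2) (by positivity) hε2 (by simp; linarith)
      exact ⟨_, ⟨h1, trivial⟩, fun h3 => h2 (congrArg val h3)⟩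
    · obtain ⟨hk', h1, h2⟩ := key k (-(ε / 2)) (by simp; linarith) (by rwa [abs_neg]) (by simp; linarith)
      exact ⟨_, ⟨h1, trivial⟩, fun h3 => h2 (congrArg val h3)⟩
  | edge up lam hlam =>
    cases up
    · obtain ⟨hk', h1, h2⟩ := key lam (-(ε / 2)) (by simp; linarith) (by rwa [abs_neg]) (by simp; linarith)
      exact ⟨_, ⟨h1, by simp [isUpper_off, hε]⟩, fun h3 => h2 (congrArg val h3)⟩
    · obtain ⟨hk', h1, h2⟩ := key lam (ε / 2) (by positivity) hε2 (by simp; linarith)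
      exact ⟨_, ⟨h1, by simp [isUpper_off]; linarith⟩, fun h3 => h2 (congrArg val h3)⟩

/-- The side of the cut on which the kernel of the free resolvent is taken. -/
def side : CutPlane → Bool
  | off k _ => open Classical in decide (0 ≤ k.im)
  | edge up _ _ => up

theorem side_eq_true_iff (p : CutPlane) : p.side = true ↔ p.IsUpper := by
  cases p <;> simp [side, IsUpper]

theorem val_mem_halfPlane (p : CutPlane) : p.val ∈ halfPlane p.side := by
  cases p with
  | off k hk =>
    by_cases h : 0 ≤ k.im
    · simp [side, h, halfPlane, val]
    · simp [side, h, halfPlane, val, (not_le.1 h).le]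
  | edge up lam h => exact ofReal_mem_halfPlane up lam

/-- The complex conjugate of a point of the cut plane; it exchanges the edges. -/
def conjPt : CutPlane → CutPlane
  | off k hk => off (conj k) (by simpa using hk)
  | edge up lam h => edge (!up) lam h

theorem val_conjPt (p : CutPlane) : p.conjPt.val = conj p.val := by
  cases p <;> simp [conjPt, val]

/-- The sides of `k` and `k̄` are opposite unless `k ∈ (-∞, 0]`. -/
theorem side_conjPt (p : CutPlane) :
    p.conjPt.side = !p.side ∨ (p.val.im = 0 ∧ p.val.re ≤ 0) := by
  cases p with
  | off k hk =>
    rcases lt_trichotomy k.im 0 with h | h | h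
    · left; simp [conjPt, side, h.le, h]
    · right
      exact ⟨h, not_lt.1 fun h2 => hk ⟨h2, h⟩⟩
    · left; simp [conjPt, side, h.le, h]
  | edge up lam h => left; rfl

theorem continuous_conjPt : Continuous conjPt := by
  refine continuous_iff_continuousAt.2 fun p => ?_
  rw [ContinuousAt, (nhds_hasBasis p.conjPt).tendsto_right_iff]
  intro ε hε
  have hn : ∀ p' : CutPlane, ‖p'.conjPt.val - p.conjPt.val‖ = ‖p'.val - p.val‖ := fun p' => by
    rw [val_conjPt, val_conjPt, ← map_sub, norm_conj]
  cases p with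
  | off k hk =>
    filter_upwards [(nhds_hasBasis (off k hk)).mem_of_mem hε] with p' hp'
    exact ⟨by rw [hn]; exact hp'.1, trivial⟩
  | edge up lam h =>
    filter_upwards [(nhds_hasBasis (edge up lam h)).mem_of_mem (lt_min hε h)] with p' hp'
    refine ⟨by rw [hn]; exact hp'.1.trans_le (min_le_left _ _), ?_⟩
    have h1 : p'.IsUpper ↔ up = true := hp'.2
    have h2 := hp'.1
    cases p' with
    | edge up' lam' h' =>
      change (!up') = true ↔ (!up) = true
      have : up' = true ↔ up = true := h1
      cases up <;> cases up' <;> simp_all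
    | off k' hk' =>
      have hre : 0 < k'.re := by
        have h3 : |(k' - lam).re| < lam := (abs_re_le_norm _).trans_lt (h2.trans_le (min_le_right _ _))
        rw [sub_re, ofReal_re, abs_lt] at h3
        linarith [h3.1]
      have him : k'.im ≠ 0 := fun h => hk' ⟨hre, h⟩
      have h3 : 0 ≤ k'.im ↔ up = true := h1
      change 0 ≤ (conj k').im ↔ (!up) = true
      rw [conj_im]
      rcases lt_or_gt_of_ne him with h4 | h4
      · have : up = false := by
          cases up
          · rfl
          · exact absurd (h3.2 rfl) (not_le.2 h4)
        subst this; simp [h4.le]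
      · have : up = true := h3.1 h4.le
        subst this; simp [h4]

theorem val_bdry (up : Bool) (lam : ℝ) : (bdry up lam).val = lam := by
  unfold bdry; split_ifs <;> rfl

/-- Near `p₀` the kernel side at `p` is admissible for `p₀`, and it differs from the side of `p₀`
only if `p₀ ∈ (-∞, 0]`. -/
theorem eventually_side (p₀ : CutPlane) : ∀ᶠ p in 𝓝 p₀, p₀.val ∈ halfPlane p.side ∧
    (p.side = p₀.side ∨ (p₀.val.im = 0 ∧ p₀.val.re ≤ 0)) := by
  cases p₀ with
  | edge up lam h =>
    filter_upwards [(nhds_hasBasis (edge up lam h)).mem_of_mem one_pos] with p hp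
    refine ⟨ofReal_mem_halfPlane _ lam, Or.inl ?_⟩
    have h2 : p.IsUpper ↔ up = true := hp.2
    rw [← side_eq_true_iff] at h2
    change p.side = up
    cases hs : p.side <;> cases up <;> simp_all
  | off k hk =>
    by_cases him : k.im = 0
    · refine Eventually.of_forall fun p => ⟨?_, Or.inr ⟨him, not_lt.1 fun h2 => hk ⟨h2, him⟩⟩⟩
      simp [halfPlane, val, him]
    · filter_upwards [(nhds_hasBasis (off k hk)).mem_of_mem (abs_pos.2 him)] with p hp
      have h1 : |(p.val - k).im| < |k.im| := (abs_im_le_norm _).trans_lt hp.1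
      rw [sub_im] at h1
      have hs : p.side = (off k hk).side := by
        cases p with
        | edge up' lam' _ => simp [val] at h1
        | off k' hk' =>
          simp only [val, side, decide_eq_decide] at h1 ⊢
          rcases lt_or_gt_of_ne him with h2 | h2
          · rw [abs_of_neg h2] at h1
            have := (abs_lt.1 h1).2
            constructor <;> intro <;> linarith
          · rw [abs_of_pos h2] at h1
            have := (abs_lt.1 h1).1
            constructor <;> intro <;> linarith
      exact ⟨by rw [hs]; exact val_mem_halfPlane _, Or.inl hs⟩

theorem continuousAt_bdry (up : Bool) {lam : ℝ} (hlam : 0 < lam) : ContinuousAt (bdry up) lam := by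
  have hb : bdry up lam = edge up lam hlam := by simp [bdry, hlam]
  rw [ContinuousAt, hb, (nhds_hasBasis _).tendsto_right_iff]
  intro ε hε
  filter_upwards [Metric.ball_mem_nhds lam hε, lt_mem_nhds hlam] with x hx hx0
  refine ⟨?_, ?_⟩
  · rw [val_bdry]
    change ‖(x : ℂ) - lam‖ < ε
    rw [← ofReal_sub, norm_real]; exact hx
  · simp [bdry, hx0, isUpper_edge]

theorem tendsto_bdry_zero (up : Bool) : Tendsto (bdry up) (𝓝[>] 0) (𝓝 (bdry up 0)) := by
  have hb : bdry up 0 = off 0 (by simp) := by simp [bdry]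
  rw [hb, (nhds_hasBasis _).tendsto_right_iff]
  intro ε hε
  filter_upwards [nhdsWithin_le_nhds (Metric.ball_mem_nhds (0 : ℝ) hε)] with x hx
  refine ⟨?_, trivial⟩
  rw [val_bdry]
  simpa [val] using hx

end CutPlane

/-! ### Weak sequential continuity and compactness -/

/-- An operator that maps bounded weakly convergent sequences to norm convergent ones is
compact. -/
theorem isCompactOperator_of_weak_seq {H F : Type*} [NormedAddCommGroup H] [InnerProductSpace ℂ H]
    [CompleteSpace H] [TopologicalSpace.SeparableSpace H] [NormedAddCommGroup F] [NormedSpace ℂ F]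
    (T : H →L[ℂ] F)
    (hT : ∀ (f : ℕ → H) (f₀ : H), (∀ n, ‖f n‖ ≤ 1) →
      (∀ y, Tendsto (fun n => inner ℂ y (f n)) atTop (𝓝 (inner ℂ y f₀))) →
      Tendsto (fun n => T (f n)) atTop (𝓝 (T f₀))) : IsCompactOperator T := by
  have hc : IsSeqCompact (T '' Metric.closedBall 0 1) := by
    intro x hx
    choose f hf hfx using hx
    -- Through the Riesz isomorphism the unit ball is weakly sequentially compact.
    have hball := WeakDual.isSeqCompact_closedBall ℂ H (0 : StrongDual ℂ H) 1
    have hmem : ∀ n, StrongDual.toWeakDual (InnerProductSpace.toDual ℂ H (f n)) ∈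
        WeakDual.toStrongDual ⁻¹' Metric.closedBall (0 : StrongDual ℂ H) 1 := fun n => by
      have h1 : ‖InnerProductSpace.toDual ℂ H (f n)‖ ≤ 1 := by
        rw [LinearIsometryEquiv.norm_map]; simpa using hf n
      simpa using h1
    obtain ⟨ψ, hψ, m, hm, hlim⟩ := hball hmem
    set f₀ : H := (InnerProductSpace.toDual ℂ H).symm (WeakDual.toStrongDual ψ) with hf₀
    have hψ' : ‖WeakDual.toStrongDual ψ‖ ≤ 1 := by simpa using hψ
    refine ⟨T f₀, ⟨f₀, ?_, rfl⟩, m, hm, ?_⟩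
    · rw [mem_closedBall_zero_iff, hf₀, LinearIsometryEquiv.norm_map]; exact hψ'
    · have h := hT (fun n => f (m n)) f₀ (fun n => by simpa using hf (m n)) fun y => by
        have h1 := ((WeakDual.eval_continuous (𝕜 := ℂ) (E := H) y).tendsto ψ).comp hlim
        have h2 : ψ y = inner ℂ f₀ y := by
          rw [hf₀, ← InnerProductSpace.toDual_apply_apply, LinearIsometryEquiv.apply_symm_apply]
          rfl
        rw [h2] at h1
        have h3 := (continuous_conj.tendsto _).comp h1
        rw [inner_conj_symm] at h3
        refine h3.congr fun n => ?_
        simp only [Function.comp_apply]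
        rw [← inner_conj_symm]
        rfl
      refine h.congr fun n => ?_
      exact hfx (m n)
  refine (isCompactOperator_iff_image_closedBall_subset_compact (T : H →ₗ[ℂ] F) one_pos).2
    ⟨_, hc.isCompact, subset_rfl⟩

/-- The Fredholm alternative for `1 - T`. -/
theorem isUnit_one_sub_of_injective {H : Type*} [NormedAddCommGroup H] [NormedSpace ℂ H]
    [CompleteSpace H] {T : H →L[ℂ] H} (hT : IsCompactOperator T) (h : ∀ v, T v = v → v = 0) :
    IsUnit (1 - T) := by
  rcases hT.hasEigenvalue_or_mem_resolventSet (one_ne_zero (α := ℂ)) with h1 | h1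
  · obtain ⟨v, hv⟩ := h1.exists_hasEigenvector
    exact absurd (h v (by simpa using hv.apply_eq_smul)) hv.2
  · rw [spectrum.mem_resolventSet_iff] at h1
    simpa using h1

/-! ### Function-level descriptions of the operators -/

theorem freeKernel_eq (p : CutPlane) (x : ℝ) : freeKernel p x = resKer p.side p.val x := by
  unfold freeKernel resKer
  by_cases h : p.IsUpper
  · rw [if_pos h, if_pos ((CutPlane.side_eq_true_iff p).2 h)]
  · rw [if_neg h, if_neg (fun h2 => h ((CutPlane.side_eq_true_iff p).1 h2))]

theorem freeConv_eq (p : CutPlane) (g : ℝ → ℂ) : freeConv p g = resConv p.side p.val g := by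
  ext x; simp only [freeConv, resConv, freeKernel_eq]

theorem coeFn_freeResolvent (p : CutPlane) (f : L1) :
    (freeResolvent p f : ℝ → ℂ) =ᵐ[volume] resConv p.side p.val f := by
  rw [← freeConv_eq]
  exact MemLp.coeFn_toLp (memLp_freeConv p (L1.integrable_coeFn f))

theorem coeFn_mulQ (q f : L2) : (mulQ q f : ℝ → ℂ) =ᵐ[volume] fun x => q x * f x := by
  filter_upwards [(ContinuousLinearMap.mul ℂ ℂ).coeFn_holder (r := 1) q f] with x hx
  exact hx

theorem coeFn_mulQbar (q : L2) (u : LInf) :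
    (mulQbar q u : ℝ → ℂ) =ᵐ[volume] fun x => conj (q x) * u x := by
  filter_upwards [(ContinuousLinearMap.mul ℂ ℂ).coeFn_holder (r := 2) (star q) u, coeFn_star q]
    with x hx hx2
  rw [← hx2]
  exact hx

theorem norm_sq_L2 (f : L2) : ‖f‖ ^ 2 = ∫ x, ‖f x‖ ^ 2 := by
  have h := inner_self_eq_norm_sq_to_K (𝕜 := ℂ) f
  rw [inner_L2_eq] at h
  have h2 : ∫ x, f x * conj (f x) = ((∫ x, ‖f x‖ ^ 2 : ℝ) : ℂ) := by
    rw [← integral_complex_ofReal]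
    refine integral_congr_ae (ae_of_all _ fun x => ?_)
    simp only [mul_conj, normSq_eq_norm_sq]
  rw [h2] at h
  have h3 : ((∫ x, ‖f x‖ ^ 2 : ℝ) : ℂ) = ((‖f‖ ^ 2 : ℝ) : ℂ) := by rw [h]; norm_cast
  exact (ofReal_injective h3).symm

theorem integrable_norm_sq_L2 (f : L2) : Integrable fun x => ‖f x‖ ^ 2 :=
  (memLp_two_iff_integrable_sq_norm (Lp.memLp f).1).1 (Lp.memLp f)

theorem norm_star_L2 (f : L2) : ‖(star f : L2)‖ = ‖f‖ := by
  have h : ‖(star f : L2)‖ ^ 2 = ‖f‖ ^ 2 := by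
    rw [norm_sq_L2, norm_sq_L2]
    refine integral_congr_ae ?_
    filter_upwards [coeFn_star f] with x hx
    rw [hx, norm_conj]
  exact (pow_left_inj₀ (norm_nonneg _) (norm_nonneg _) two_ne_zero).1 h

/-- The Cauchy–Schwarz inequality for functions. -/
theorem norm_integral_mul_sq_le {a b : ℝ → ℂ} (ha : MemLp a 2) (hb : MemLp b 2) :
    ‖∫ x, a x * b x‖ ^ 2 ≤ (∫ x, ‖a x‖ ^ 2) * ∫ x, ‖b x‖ ^ 2 := by
  have e1 := (ha.coeFn_toLp)
  have e2 := (hb.coeFn_toLp)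
  have h1 : ∫ x, a x * b x = inner ℂ (star (ha.toLp a)) (hb.toLp b) := by
    rw [inner_L2_eq]
    refine integral_congr_ae ?_
    filter_upwards [e1, e2, coeFn_star (ha.toLp a)] with x h1 h2 h3
    rw [h3, h1, h2, conj_conj]; ring
  have h2 : ∀ {u : ℝ → ℂ} (hu : MemLp u 2), ∫ x, ‖u x‖ ^ 2 = ‖hu.toLp u‖ ^ 2 := by
    intro u hu
    rw [norm_sq_L2]
    refine integral_congr_ae ?_
    filter_upwards [hu.coeFn_toLp] with x hx
    rw [hx]
  rw [h1, h2 ha, h2 hb, ← mul_pow]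
  refine pow_le_pow_left₀ (norm_nonneg _) ((norm_inner_le_norm _ _).trans_eq ?_) 2
  rw [norm_star_L2]

/-- Dominated convergence in `L²` for multiples of `q` by uniformly bounded functions. -/
theorem tendsto_L2_of_dominated {ι : Type*} {l : Filter ι} [l.IsCountablyGenerated] (q : L2)
    {F : ι → L2} {F₀ : L2} {u : ι → ℝ → ℂ} (C : ℝ)
    (hF : ∀ᶠ i in l, ∀ᵐ x, ‖F i x - F₀ x‖ = ‖q x‖ * ‖u i x‖)
    (hm : ∀ᶠ i in l, AEStronglyMeasurable (u i))
    (hb : ∀ᶠ i in l, ∀ᵐ x, ‖u i x‖ ≤ C) (hu : ∀ᵐ x, Tendsto (fun i => u i x) l (𝓝 0)) :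
    Tendsto F l (𝓝 F₀) := by
  rw [tendsto_iff_norm_sub_tendsto_zero]
  have h1 : Tendsto (fun i => ∫ x, ‖q x‖ ^ 2 * ‖u i x‖ ^ 2) l (𝓝 (∫ _ : ℝ, (0 : ℝ))) := by
    refine tendsto_integral_filter_of_dominated_convergence
      (bound := fun x => ‖q x‖ ^ 2 * C ^ 2) ?_ ?_ ((integrable_norm_sq_L2 q).mul_const _) ?_
    · filter_upwards [hm] with i hi
      exact (integrable_norm_sq_L2 q).1.mul (hi.norm.pow 2)
    · filter_upwards [hb] with i h2
      filter_upwards [h2] with x h2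
      rw [Real.norm_of_nonneg (by positivity)]
      gcongr
    · filter_upwards [hu] with x hx
      simpa using (hx.norm.pow 2).const_mul (‖q x‖ ^ 2)
  rw [integral_zero] at h1
  have h2 := h1.sqrt
  rw [Real.sqrt_zero] at h2
  refine h2.congr' ?_
  filter_upwards [hF] with i hi
  rw [← Real.sqrt_sq (norm_nonneg (F i - F₀)), norm_sq_L2]
  congr 1
  refine integral_congr_ae ?_
  filter_upwards [hi, Lp.coeFn_sub (F i) F₀] with x h1 h2
  rw [h2, Pi.sub_apply, h1, mul_pow]

/-! ### Continuity of the free resolvent on the cut plane -/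

/-- Difference of the kernels at `p` and `p₀`, both taken on the side of `p`. -/
def kerDiff (p₀ p : CutPlane) (x : ℝ) : ℂ := resKer p.side p.val x - resKer p.side p₀.val x

theorem continuous_resKer_param (up : Bool) (x : ℝ) : Continuous fun k : ℂ => resKer up k x := by
  unfold resKer
  split_ifs <;> fun_prop

theorem tendsto_kerDiff (p₀ : CutPlane) (x : ℝ) :
    Tendsto (fun p => kerDiff p₀ p x) (𝓝 p₀) (𝓝 0) := by
  have h : ∀ b : Bool, Tendsto (fun p : CutPlane => ‖resKer b p.val x - resKer b p₀.val x‖) (𝓝 p₀)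
      (𝓝 0) := fun b => by
    have h1 := (((continuous_resKer_param b x).comp CutPlane.continuous_val).tendsto p₀).sub_const
      (resKer b p₀.val x)
    simpa using h1.norm
  have h2 := (h true).add (h false)
  rw [add_zero] at h2
  refine squeeze_zero_norm (fun p => ?_) h2
  unfold kerDiff
  cases p.side
  · exact le_add_of_nonneg_left (norm_nonneg _)
  · exact le_add_of_nonneg_right (norm_nonneg _)

theorem norm_kerDiff_le {p₀ p : CutPlane} (h : p₀.val ∈ halfPlane p.side) (x : ℝ) :
    ‖kerDiff p₀ p x‖ ≤ 2 :=
  (norm_sub_le _ _).trans (by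
    have := norm_resKer_le p.val_mem_halfPlane x
    have := norm_resKer_le h x
    linarith)

theorem measurable_kerDiff (p₀ p : CutPlane) : Measurable (kerDiff p₀ p) :=
  (measurable_resKer _ _).sub (measurable_resKer _ _)

theorem resConv_eq_of_negFreq {b b' : Bool} {k : ℂ} {g : ℝ → ℂ} (hg : Integrable g)
    (hn : NegFreq g) (h : b = b' ∨ (k.im = 0 ∧ k.re ≤ 0)) : resConv b k g = resConv b' k g := by
  rcases h with rfl | ⟨h1, h2⟩
  · rfl
  · have hk : k = (k.re : ℂ) := Complex.ext (by simp) (by simp [h1])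
    rw [hk]
    exact resConv_eq_of_angularFourier_eq_zero b b' hg (hn _ h2)

/-- For functions without nonpositive frequencies the kernel at `p₀` may be taken on the side of `p`. -/
theorem resConv_sub_eq_integral_kerDiff {p₀ p : CutPlane} {g : ℝ → ℂ} (hg : Integrable g)
    (hn : NegFreq g) (h : p₀.val ∈ halfPlane p.side ∧
      (p.side = p₀.side ∨ (p₀.val.im = 0 ∧ p₀.val.re ≤ 0))) (x : ℝ) :
    resConv p.side p.val g x - resConv p₀.side p₀.val g x = ∫ y, kerDiff p₀ p (x - y) * g y := by
  rw [← resConv_eq_of_negFreq hg hn h.2, resConv, resConv,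
    ← integral_sub (integrable_resConv p.val_mem_halfPlane hg x) (integrable_resConv h.1 hg x)]
  simp only [kerDiff, sub_mul]

theorem tendsto_resConv {g : ℝ → ℂ} (hg : Integrable g) (hn : NegFreq g) (p₀ : CutPlane) (x : ℝ) :
    Tendsto (fun p : CutPlane => resConv p.side p.val g x) (𝓝 p₀)
      (𝓝 (resConv p₀.side p₀.val g x)) := by
  refine tendsto_sub_nhds_zero_iff.1 ?_
  have h1 : Tendsto (fun p => ∫ y, kerDiff p₀ p (x - y) * g y) (𝓝 p₀) (𝓝 (∫ _ : ℝ, (0 : ℂ))) := by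
    refine tendsto_integral_filter_of_dominated_convergence (bound := fun y => 2 * ‖g y‖) ?_ ?_
      (hg.norm.const_mul 2) (ae_of_all _ fun y => ?_)
    · exact Eventually.of_forall fun p => ((measurable_kerDiff p₀ p).comp
        (measurable_const.sub measurable_id)).aestronglyMeasurable.mul hg.1
    · filter_upwards [CutPlane.eventually_side p₀] with p hp
      refine ae_of_all _ fun y => ?_
      rw [norm_mul]
      exact mul_le_mul_of_nonneg_right (norm_kerDiff_le hp.1 _) (norm_nonneg _)
    · simpa using (tendsto_kerDiff p₀ (x - y)).mul_const (g y)
  rw [integral_zero] at h1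
  refine h1.congr' ?_
  filter_upwards [CutPlane.eventually_side p₀] with p hp
  exact (resConv_sub_eq_integral_kerDiff hg hn hp x).symm

theorem angularFourier_congr {g h : ℝ → ℂ} (hgh : g =ᵐ[volume] h) (ξ : ℝ) :
    angularFourier g ξ = angularFourier h ξ := by
  refine integral_congr_ae ?_
  filter_upwards [hgh] with x hx
  rw [hx]

theorem NegFreq.congr {g h : ℝ → ℂ} (hg : NegFreq g) (hgh : g =ᵐ[volume] h) : NegFreq h :=
  fun ξ hξ => by rw [← angularFourier_congr hgh, hg ξ hξ]

theorem negFreq_mulQ {q : L2} (hq : q ∈ hardy) (f : hardy) : NegFreq (mulQ q (f : L2)) :=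
  (negFreq_mul hq f.2).congr (coeFn_mulQ q f).symm

theorem tendsto_mulQbar_freeResolvent (q : L2) {G : L1} (hG : NegFreq G) (p₀ : CutPlane) :
    Tendsto (fun p => mulQbar q (freeResolvent p G)) (𝓝 p₀)
      (𝓝 (mulQbar q (freeResolvent p₀ G))) := by
  have hGi := L1.integrable_coeFn G
  refine tendsto_L2_of_dominated q
    (u := fun p x => resConv p.side p.val G x - resConv p₀.side p₀.val G x)
    (2 * ∫ y, ‖G y‖) ?_ ?_ ?_ ?_
  · refine Eventually.of_forall fun p => ?_
    filter_upwards [coeFn_mulQbar q (freeResolvent p G), coeFn_mulQbar q (freeResolvent p₀ G),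
      coeFn_freeResolvent p G, coeFn_freeResolvent p₀ G] with x h1 h2 h3 h4
    rw [h1, h2, h3, h4, ← mul_sub, norm_mul, norm_conj]
  · exact Eventually.of_forall fun p => (memLp_top_resConv p.val_mem_halfPlane hGi).1.sub
      (memLp_top_resConv p₀.val_mem_halfPlane hGi).1
  · refine Eventually.of_forall fun p => ae_of_all _ fun x => ?_
    refine (norm_sub_le _ _).trans ?_
    have := norm_resConv_le p.val_mem_halfPlane hGi x
    have := norm_resConv_le p₀.val_mem_halfPlane hGi x
    linarith
  · refine ae_of_all _ fun x => ?_
    have := (tendsto_resConv hGi hG p₀ x).sub_const (resConv p₀.side p₀.val G x)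
    simpa using this

theorem norm_freeResolvent_le (p : CutPlane) : ‖freeResolvent p‖ ≤ 1 :=
  LinearMap.mkContinuous_norm_le _ zero_le_one _

theorem pairing_congr {u v : ℝ → ℂ} (h : u =ᵐ[volume] v) (f : ℝ → ℂ) :
    pairing u f = pairing v f := by
  refine integral_congr_ae ?_
  filter_upwards [h] with x hx
  rw [hx]

theorem integrable_pairing (u : LInf) (f : L1) : Integrable fun x => u x * conj (f x) :=
  (conjCLE.toContinuousLinearMap.integrable_comp (L1.integrable_coeFn f)).mul_of_top_right
    (Lp.memLp u)

theorem pairing_add (u v : LInf) (f : L1) : pairing (u + v : LInf) f = pairing u f + pairing v f := by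
  rw [pairing, pairing, pairing, ← integral_add (integrable_pairing u f) (integrable_pairing v f)]
  refine integral_congr_ae ?_
  filter_upwards [Lp.coeFn_add u v] with x hx
  rw [hx, Pi.add_apply, add_mul]

theorem pairing_smul (c : ℂ) (u : LInf) (f : L1) : pairing (c • u : LInf) f = c * pairing u f := by
  rw [pairing, pairing, ← integral_const_mul]
  refine integral_congr_ae ?_
  filter_upwards [Lp.coeFn_smul c u] with x hx
  rw [hx, Pi.smul_apply, smul_eq_mul, mul_assoc]

theorem norm_pairing_le (u : LInf) (f : L1) : ‖pairing u f‖ ≤ ‖u‖ * ‖f‖ := by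
  rw [L1.norm_eq_integral_norm, ← integral_const_mul]
  refine norm_integral_le_of_norm_le ((L1.integrable_coeFn f).norm.const_mul _) ?_
  filter_upwards [ae_le_eLpNormEssSup (f := u) (μ := volume)] with x hx
  rw [norm_mul, norm_conj]
  refine mul_le_mul_of_nonneg_right ?_ (norm_nonneg _)
  rw [Lp.norm_def, eLpNorm_exponent_top, ← toReal_enorm]
  refine ENNReal.toReal_mono ?_ hx
  have := Lp.eLpNorm_ne_top u
  rwa [eLpNorm_exponent_top] at this

theorem tendsto_pairing_freeResolvent {ι : Type*} {l : Filter ι} {p : ι → CutPlane}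
    {p₀ : CutPlane} (hp : Tendsto p l (𝓝 p₀)) {G : ι → L1} {G₀ : L1} (hG₀ : NegFreq G₀)
    (hG : Tendsto G l (𝓝 G₀)) (f : L1) :
    Tendsto (fun i => pairing (freeResolvent (p i) (G i)) f) l
      (𝓝 (pairing (freeResolvent p₀ G₀) f)) := by
  have hGi := L1.integrable_coeFn G₀
  have h1 : Tendsto (fun p' => pairing (freeResolvent p' G₀) f) (𝓝 p₀)
      (𝓝 (pairing (freeResolvent p₀ G₀) f)) := by
    have e : ∀ p' : CutPlane, pairing (freeResolvent p' G₀) f =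
        ∫ x, resConv p'.side p'.val G₀ x * conj (f x) := fun p' =>
      pairing_congr (coeFn_freeResolvent p' G₀) f
    simp only [e]
    refine tendsto_integral_filter_of_dominated_convergence
      (bound := fun x => (∫ y, ‖G₀ y‖) * ‖f x‖) ?_ ?_ ((L1.integrable_coeFn f).norm.const_mul _)
      (ae_of_all _ fun x => (tendsto_resConv hGi hG₀ p₀ x).mul_const _)
    · exact Eventually.of_forall fun p' => (memLp_top_resConv p'.val_mem_halfPlane hGi).1.mul
        (conjCLE.toContinuousLinearMap.integrable_comp (L1.integrable_coeFn f)).1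
    · refine Eventually.of_forall fun p' => ae_of_all _ fun x => ?_
      rw [norm_mul, norm_conj]
      exact mul_le_mul_of_nonneg_right (norm_resConv_le p'.val_mem_halfPlane hGi x) (norm_nonneg _)
  have h2 : Tendsto (fun i => pairing (freeResolvent (p i) (G i - G₀)) f) l (𝓝 0) := by
    have h3 := (tendsto_iff_norm_sub_tendsto_zero.1 hG).mul_const ‖f‖
    rw [zero_mul] at h3
    refine squeeze_zero_norm (fun i => (norm_pairing_le _ _).trans ?_) h3
    gcongr
    refine ((freeResolvent (p i)).le_opNorm _).trans ?_
    exact mul_le_of_le_one_left (norm_nonneg _) (norm_freeResolvent_le _)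
  have h4 := (h1.comp hp).add h2
  rw [add_zero] at h4
  refine h4.congr fun i => ?_
  simp only [Function.comp_apply]
  rw [← pairing_add, ← map_add, add_sub_cancel]

/-! ### The sandwiched resolvent -/

theorem sandwich_apply (q : L2) (p : CutPlane) (f : hardy) :
    sandwich q p f = szego (mulQbar q (freeResolvent p (mulQ q (f : L2)))) := rfl

theorem memLp_bdd_mul_L2 (q : L2) {u : ℝ → ℂ} (hu : Measurable u) {C : ℝ} (hC : ∀ x, ‖u x‖ ≤ C)
    (x : ℝ) : MemLp (fun y => u (x - y) * q y) 2 := by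
  refine MemLp.of_le_mul (c := C) (Lp.memLp q) ((hu.comp
    (measurable_const.sub measurable_id)).aestronglyMeasurable.mul (Lp.memLp q).1)
    (ae_of_all _ fun y => ?_)
  rw [norm_mul]
  exact mul_le_mul_of_nonneg_right (hC _) (norm_nonneg _)

/-- The operator `C₊ q̄ R₀(k) q C₊` is compact. -/
theorem isCompactOperator_sandwich (q : L2) (p : CutPlane) : IsCompactOperator (sandwich q p) := by
  have : Fact ((2 : ℝ≥0∞) ≠ ⊤) := ⟨ENNReal.ofNat_ne_top⟩
  have : SecondCountableTopology L2 := inferInstance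
  have : SecondCountableTopology hardy := TopologicalSpace.Subtype.secondCountableTopology _
  refine isCompactOperator_of_weak_seq _ fun f f₀ hf hlim => ?_
  simp only [sandwich_apply]
  refine (szego.continuous.tendsto _).comp ?_
  have hG : ∀ g : hardy, Integrable fun y => q y * (g : L2) y := fun g =>
    integrable_mul_L2 (Lp.memLp q) (Lp.memLp _)
  have hbd : ∀ g : hardy, ‖g‖ ≤ 1 → ∫ y, ‖q y * (g : L2) y‖ ≤ ‖mulQ q‖ := fun g hg => by
    have h1 : ∫ y, ‖q y * (g : L2) y‖ = ‖mulQ q (g : L2)‖ := by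
      rw [L1.norm_eq_integral_norm]
      refine integral_congr_ae ?_
      filter_upwards [coeFn_mulQ q g] with y hy
      rw [hy]
    rw [h1]
    exact ((mulQ q).le_opNorm _).trans (mul_le_of_le_one_right (norm_nonneg _) hg)
  have hconv : ∀ x, Tendsto (fun n => resConv p.side p.val (fun y => q y * (f n : L2) y) x) atTop
      (𝓝 (resConv p.side p.val (fun y => q y * (f₀ : L2) y) x)) := by
    intro x
    have hm := memLp_bdd_mul_L2 q (measurable_resKer p.side p.val)
      (norm_resKer_le p.val_mem_halfPlane) x
    -- The value at `x` is a bounded linear functional of the vector, hence weakly continuous.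
    have e : ∀ g : hardy, resConv p.side p.val (fun y => q y * (g : L2) y) x =
        inner ℂ (szego (star (hm.toLp _))) g := by
      intro g
      rw [Submodule.coe_inner, inner_szego_left _ g.2, inner_L2_eq, resConv]
      refine integral_congr_ae ?_
      filter_upwards [hm.coeFn_toLp, coeFn_star (hm.toLp _)] with y h1 h2
      rw [h2, h1, conj_conj]
      ring
    simp only [e]
    exact hlim _
  have hf₀ : ∫ y, ‖q y * (f₀ : L2) y‖ = ‖mulQ q (f₀ : L2)‖ := by
    rw [L1.norm_eq_integral_norm]
    refine integral_congr_ae ?_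
    filter_upwards [coeFn_mulQ q f₀] with y hy
    rw [hy]
  refine tendsto_L2_of_dominated q
    (u := fun n x => resConv p.side p.val (fun y => q y * (f n : L2) y) x -
      resConv p.side p.val (fun y => q y * (f₀ : L2) y) x)
    (‖mulQ q‖ + ‖mulQ q (f₀ : L2)‖) ?_ ?_ ?_ ?_
  · refine Eventually.of_forall fun n => ?_
    filter_upwards [coeFn_mulQbar q (freeResolvent p (mulQ q (f n : L2))),
      coeFn_mulQbar q (freeResolvent p (mulQ q (f₀ : L2))),
      coeFn_freeResolvent p (mulQ q (f n : L2)), coeFn_freeResolvent p (mulQ q (f₀ : L2))]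
      with x h1 h2 h3 h4
    rw [h1, h2, h3, h4, ← mul_sub, norm_mul, norm_conj, resConv_congr _ _ (coeFn_mulQ q (f n)),
      resConv_congr _ _ (coeFn_mulQ q f₀)]
  · exact Eventually.of_forall fun n => (memLp_top_resConv p.val_mem_halfPlane (hG _)).1.sub
      (memLp_top_resConv p.val_mem_halfPlane (hG _)).1
  · refine Eventually.of_forall fun n => ae_of_all _ fun x => (norm_sub_le _ _).trans ?_
    have h1 := (norm_resConv_le p.val_mem_halfPlane (hG (f n)) x).trans (hbd _ (hf n))
    have h2 := (norm_resConv_le p.val_mem_halfPlane (hG f₀) x).trans_eq hf₀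
    exact add_le_add h1 h2
  · refine ae_of_all _ fun x => ?_
    simpa using (hconv x).sub_const (resConv p.side p.val (fun y => q y * (f₀ : L2) y) x)

/-- The square of the Hilbert–Schmidt norm of the operator with kernel `q̄(x) κ(x - y) q(y)`. -/
def hsNormSq (q : L2) (κ : ℝ → ℂ) : ℝ := ∫ x, ‖q x‖ ^ 2 * ∫ y, ‖κ (x - y) * q y‖ ^ 2

section HilbertSchmidt

variable {q : L2} {κ : ℝ → ℂ} {C : ℝ}

theorem hsNormSq_nonneg (q : L2) (κ : ℝ → ℂ) : 0 ≤ hsNormSq q κ :=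
  integral_nonneg fun _ => mul_nonneg (by positivity) (integral_nonneg fun _ => by positivity)

theorem norm_kernel_mul_sq_le (hC : ∀ x, ‖κ x‖ ≤ C) (x y : ℝ) :
    ‖κ (x - y) * q y‖ ^ 2 ≤ C ^ 2 * ‖q y‖ ^ 2 := by
  rw [norm_mul, mul_pow]
  gcongr
  exact hC _

theorem integral_norm_kernel_mul_sq_le (hC : ∀ x, ‖κ x‖ ≤ C) (x : ℝ) :
    ∫ y, ‖κ (x - y) * q y‖ ^ 2 ≤ C ^ 2 * ‖q‖ ^ 2 := by
  rw [norm_sq_L2, ← integral_const_mul]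
  exact integral_mono_of_nonneg (ae_of_all _ fun _ => by positivity)
    ((integrable_norm_sq_L2 q).const_mul _) (ae_of_all _ fun y => norm_kernel_mul_sq_le hC x y)

theorem aestronglyMeasurable_integral_kernel (q : L2) (hκ : Measurable κ) :
    AEStronglyMeasurable fun x => ∫ y, ‖κ (x - y) * q y‖ ^ 2 := by
  have h : AEStronglyMeasurable (fun z : ℝ × ℝ => κ (z.1 - z.2) * q z.2)
      ((volume : Measure ℝ).prod volume) :=
    (hκ.comp (measurable_fst.sub measurable_snd)).aestronglyMeasurable.mul (Lp.memLp q).1.comp_snd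
  exact (h.norm.pow 2).integral_prod_right'

theorem norm_hsNormSq_integrand_le (hC : ∀ x, ‖κ x‖ ≤ C) (x : ℝ) :
    ‖‖q x‖ ^ 2 * ∫ y, ‖κ (x - y) * q y‖ ^ 2‖ ≤ ‖q x‖ ^ 2 * (C ^ 2 * ‖q‖ ^ 2) := by
  have h0 : 0 ≤ ∫ y, ‖κ (x - y) * q y‖ ^ 2 := integral_nonneg fun _ => by positivity
  rw [Real.norm_of_nonneg (by positivity)]
  exact mul_le_mul_of_nonneg_left (integral_norm_kernel_mul_sq_le hC x) (by positivity)

/-- An integral operator is bounded by its Hilbert–Schmidt norm. -/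
theorem norm_sq_le_hsNormSq_mul (hκ : Measurable κ) (hC : ∀ x, ‖κ x‖ ≤ C) {v f : L2}
    (hv : ∀ᵐ x, ‖v x‖ = ‖q x‖ * ‖∫ y, κ (x - y) * (q y * f y)‖) :
    ‖v‖ ^ 2 ≤ hsNormSq q κ * ‖f‖ ^ 2 := by
  have hvx : ∀ᵐ x, ‖v x‖ ^ 2 = ‖q x‖ ^ 2 * ‖∫ y, (κ (x - y) * q y) * f y‖ ^ 2 := by
    filter_upwards [hv] with x hx
    simp only [hx, mul_pow, mul_assoc]
  rw [norm_sq_L2, integral_congr_ae hvx, hsNormSq, ← integral_mul_const]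
  have hint : Integrable fun x => ‖q x‖ ^ 2 * (∫ y, ‖κ (x - y) * q y‖ ^ 2) * ‖f‖ ^ 2 :=
    (((integrable_norm_sq_L2 q).mul_const (C ^ 2 * ‖q‖ ^ 2)).mono'
      ((integrable_norm_sq_L2 q).1.mul (aestronglyMeasurable_integral_kernel q hκ))
      (ae_of_all _ fun x => norm_hsNormSq_integrand_le hC x)).mul_const _
  refine integral_mono_of_nonneg (ae_of_all _ fun _ => by positivity) hint
    (ae_of_all _ fun x => ?_)
  simp only
  rw [mul_assoc]
  refine mul_le_mul_of_nonneg_left ?_ (by positivity)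
  have h3 := norm_integral_mul_sq_le (memLp_bdd_mul_L2 q hκ hC x) (Lp.memLp f)
  rwa [← norm_sq_L2] at h3

/-- The Hilbert–Schmidt norm tends to zero with the kernel, by dominated convergence. -/
theorem tendsto_hsNormSq {ι : Type*} {l : Filter ι} [l.IsCountablyGenerated] (q : L2)
    {κ : ι → ℝ → ℂ} (hκ : ∀ i, Measurable (κ i)) (hC : ∀ᶠ i in l, ∀ x, ‖κ i x‖ ≤ C)
    (hlim : ∀ x, x ≠ 0 → Tendsto (fun i => κ i x) l (𝓝 0)) :
    Tendsto (fun i => hsNormSq q (κ i)) l (𝓝 0) := by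
  have hinner : ∀ x, Tendsto (fun i => ∫ y, ‖κ i (x - y) * q y‖ ^ 2) l (𝓝 0) := by
    intro x
    rw [← integral_zero ℝ ℝ (μ := volume)]
    refine tendsto_integral_filter_of_dominated_convergence (bound := fun y => C ^ 2 * ‖q y‖ ^ 2) ?_
      ?_ ((integrable_norm_sq_L2 q).const_mul _) ?_
    · filter_upwards [hC] with i hi
      exact (memLp_bdd_mul_L2 q (hκ i) hi x).1.norm.pow 2
    · filter_upwards [hC] with i hi
      refine ae_of_all _ fun y => ?_
      rw [Real.norm_of_nonneg (by positivity)]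
      exact norm_kernel_mul_sq_le hi x y
    · filter_upwards [compl_mem_ae_iff.2 (measure_singleton x)] with y hy
      have hy' : x - y ≠ 0 := fun h => hy (by simpa using (sub_eq_zero.1 h).symm)
      simpa using ((hlim (x - y) hy').mul_const (q y)).norm.pow 2
  rw [← integral_zero ℝ ℝ (μ := volume)]
  refine tendsto_integral_filter_of_dominated_convergence
    (bound := fun x => ‖q x‖ ^ 2 * (C ^ 2 * ‖q‖ ^ 2)) ?_ ?_
    ((integrable_norm_sq_L2 q).mul_const _) (ae_of_all _ fun x => ?_)
  · exact Eventually.of_forall fun i =>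
      (integrable_norm_sq_L2 q).1.mul (aestronglyMeasurable_integral_kernel q (hκ i))
  · filter_upwards [hC] with i hi
    exact ae_of_all _ fun x => norm_hsNormSq_integrand_le hi x
  · simpa using (hinner x).const_mul (‖q x‖ ^ 2)

end HilbertSchmidt

/-- The operator `C₊ q̄ R₀(k) q C₊` depends norm-continuously on `k` in the cut plane. -/
theorem continuous_sandwich {q : L2} (hq : q ∈ hardy) : Continuous (sandwich q) := by
  refine continuous_iff_continuousAt.2 fun p₀ => ?_
  refine (tendsto_iff_norm_sub_tendsto_zero (E := hardy →L[ℂ] hardy)).2 ?_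
  have hev := CutPlane.eventually_side p₀
  have hsq := (tendsto_hsNormSq q (C := 2) (measurable_kerDiff p₀)
    (hev.mono fun p hp => norm_kerDiff_le hp.1) fun x _ => tendsto_kerDiff p₀ x).sqrt
  rw [Real.sqrt_zero] at hsq
  refine squeeze_zero' (Eventually.of_forall fun _ => ContinuousLinearMap.opNorm_nonneg _) ?_ hsq
  filter_upwards [hev] with p hp
  refine ContinuousLinearMap.opNorm_le_bound _ (Real.sqrt_nonneg _) fun f => ?_
  have hGi : Integrable fun y => q y * (f : L2) y := integrable_mul_L2 (Lp.memLp q) (Lp.memLp _)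
  set v : L2 := mulQbar q (freeResolvent p (mulQ q (f : L2))) -
    mulQbar q (freeResolvent p₀ (mulQ q (f : L2))) with hv
  have h1 : (sandwich q p - sandwich q p₀) f = szego v := by
    rw [sub_apply, sandwich_apply, sandwich_apply, ← map_sub]
  have hvx : ∀ᵐ x, ‖v x‖ = ‖q x‖ * ‖∫ y, kerDiff p₀ p (x - y) * (q y * (f : L2) y)‖ := by
    filter_upwards [coeFn_mulQbar q (freeResolvent p (mulQ q (f : L2))),
      coeFn_mulQbar q (freeResolvent p₀ (mulQ q (f : L2))),
      coeFn_freeResolvent p (mulQ q (f : L2)), coeFn_freeResolvent p₀ (mulQ q (f : L2)),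
      Lp.coeFn_sub (mulQbar q (freeResolvent p (mulQ q (f : L2))))
        (mulQbar q (freeResolvent p₀ (mulQ q (f : L2))))] with x h1 h2 h3 h4 h5
    rw [hv, h5, Pi.sub_apply, h1, h2, h3, h4, ← mul_sub, resConv_congr _ _ (coeFn_mulQ q f),
      resConv_congr _ _ (coeFn_mulQ q f),
      resConv_sub_eq_integral_kerDiff hGi (negFreq_mul hq f.2) hp, norm_mul, norm_conj]
  have h2 := norm_sq_le_hsNormSq_mul (measurable_kerDiff p₀ p) (norm_kerDiff_le hp.1) hvx
  rw [h1]
  refine (norm_szego_le v).trans ?_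
  rw [← Real.sqrt_sq (norm_nonneg v), ← Real.sqrt_sq (norm_nonneg f),
    ← Real.sqrt_mul (hsNormSq_nonneg _ _)]
  exact Real.sqrt_le_sqrt h2

theorem norm_sandwich_le (q : L2) (p : CutPlane) :
    ‖sandwich q p‖ ≤ Real.sqrt (hsNormSq q (resKer p.side p.val)) := by
  refine ContinuousLinearMap.opNorm_le_bound _ (Real.sqrt_nonneg _) fun f => ?_
  have h2 := norm_sq_le_hsNormSq_mul (q := q) (measurable_resKer p.side p.val)
    (norm_resKer_le p.val_mem_halfPlane) (v := mulQbar q (freeResolvent p (mulQ q (f : L2))))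
    (f := f) (by
      filter_upwards [coeFn_mulQbar q (freeResolvent p (mulQ q (f : L2))),
        coeFn_freeResolvent p (mulQ q (f : L2))] with x h1 h2
      rw [h1, h2, norm_mul, norm_conj, resConv_congr _ _ (coeFn_mulQ q f), resConv])
  rw [sandwich_apply]
  refine (norm_szego_le _).trans ?_
  rw [← Real.sqrt_sq (norm_nonneg (mulQbar q _)), ← Real.sqrt_sq (norm_nonneg f),
    ← Real.sqrt_mul (hsNormSq_nonneg _ _)]
  exact Real.sqrt_le_sqrt h2

/-! ### Kernel vectors of `1 - C₊ q̄ R₀ q C₊` -/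

/-- The product `q f`. -/
def density (q : L2) (f : hardy) (x : ℝ) : ℂ := q x * (f : L2) x

/-- `φ = R₀(lam) (q f)`. -/
def boundFn (q : L2) (lam : ℝ) (f : hardy) : ℝ → ℂ := resConv true lam (density q f)

/-- `f = C₊ q̄ φ` for `φ = R₀(lam) (q f)`, where the Fourier transform of `q f` vanishes at `lam`,
so that the side from which `R₀(lam)` is taken is irrelevant. -/
structure IsBound (q : L2) (lam : ℝ) (f : hardy) : Prop where
  fourier_eq_zero : angularFourier (density q f) lam = 0
  exists_szego : ∃ u : L2, (u =ᵐ[volume] fun x => conj (q x) * boundFn q lam f x) ∧ szego u = f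

theorem integrable_density (q : L2) (f : hardy) : Integrable (density q f) :=
  integrable_mul_L2 (Lp.memLp q) (Lp.memLp _)

theorem negFreq_density {q : L2} (hq : q ∈ hardy) (f : hardy) : NegFreq (density q f) :=
  negFreq_mul hq f.2

theorem coeFn_mulQbar_freeResolvent_mulQ (q : L2) (p : CutPlane) (f : hardy) :
    mulQbar q (freeResolvent p (mulQ q (f : L2))) =ᵐ[volume]
      fun x => conj (q x) * resConv p.side p.val (density q f) x := by
  filter_upwards [coeFn_mulQbar q (freeResolvent p (mulQ q (f : L2))),
    coeFn_freeResolvent p (mulQ q (f : L2))] with x h1 h2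
  rw [h1, h2, resConv_congr _ _ (coeFn_mulQ q f)]
  rfl

theorem CutPlane.eq_bdry_of_im_eq_zero (p : CutPlane) (h : p.val.im = 0) :
    p = bdry p.side p.val.re := by
  cases p with
  | off k hk =>
    have h1 : ¬0 < k.re := fun h2 => hk ⟨h2, h⟩
    have h2 : k = (k.re : ℂ) := Complex.ext (by simp) (by simpa [val] using h)
    change off k hk = bdry _ k.re
    unfold bdry
    rw [dif_neg h1]
    congr
  | edge up lam hlam => simp [bdry, val, side, hlam]

/-- If `f` is fixed by `C₊ q̄ R₀(k) q C₊` then `⟨R₀(k) q f, q f⟩ = ‖f‖²` is real. -/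
theorem im_integral_resConv_density {q : L2} {p : CutPlane} {f : hardy}
    (hf : sandwich q p f = f) :
    (∫ x, resConv p.side p.val (density q f) x * conj (density q f x)).im = 0 := by
  have h1 : ∫ x, resConv p.side p.val (density q f) x * conj (density q f x) =
      inner ℂ (f : L2) (mulQbar q (freeResolvent p (mulQ q (f : L2)))) := by
    rw [inner_L2_eq]
    refine integral_congr_ae ?_
    filter_upwards [coeFn_mulQbar_freeResolvent_mulQ q p f] with x hx
    rw [hx, density, map_mul]
    ring
  rw [h1, ← inner_szego_right _ f.2, ← sandwich_apply, hf]
  exact inner_self_im (𝕜 := ℂ) (f : L2)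

/-- There are no kernel vectors at nonreal points. -/
theorem eq_zero_of_sandwich_eq {q : L2} {p : CutPlane} (hp : p.val.im ≠ 0) {f : hardy}
    (hf : sandwich q p f = f) : f = 0 := by
  have h1 := resConv_ae_eq_zero_of_im_eq_zero p.val_mem_halfPlane hp (integrable_density q f)
    (im_integral_resConv_density hf)
  rw [← hf, sandwich_apply]
  have h2 : mulQbar q (freeResolvent p (mulQ q (f : L2))) = 0 := by
    refine Lp.ext ?_
    filter_upwards [coeFn_mulQbar_freeResolvent_mulQ q p f, h1, Lp.coeFn_zero ℂ 2 volume]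
      with x h2 h3 h4
    rw [h2, h3, h4]; simp
  rw [h2, map_zero]

/-- At a real point the Fourier transform of `q f` vanishes for a kernel vector `f`. -/
theorem isBound_of_sandwich_eq {q : L2} {p : CutPlane} (hp : p.val.im = 0) {f : hardy}
    (hf : sandwich q p f = f) : IsBound q p.val.re f := by
  have hk : p.val = (p.val.re : ℂ) := Complex.ext (by simp) (by simpa using hp)
  have h1 := im_integral_resConv_density hf
  generalize p.val.re = lam at hk ⊢
  rw [hk] at h1
  have h2 := angularFourier_eq_zero_of_im_eq_zero (integrable_density q f) h1
  refine ⟨h2, mulQbar q (freeResolvent p (mulQ q (f : L2))), ?_, hf⟩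
  filter_upwards [coeFn_mulQbar_freeResolvent_mulQ q p f] with x hx
  rw [hx, hk, boundFn,
    resConv_eq_of_angularFourier_eq_zero p.side true (integrable_density q f) h2]

/-! ### Decay of bound states -/

theorem memLp_jbracket_rpow {s : ℝ} (hs : 1 / 2 < s) :
    MemLp (fun x : ℝ => jbracket x ^ (-s)) 2 := by
  have hcont : Continuous fun x : ℝ => jbracket x ^ (-s) :=
    Continuous.rpow_const continuous_jbracket fun x => Or.inl (jbracket_pos x).ne'
  rw [memLp_two_iff_integrable_sq hcont.aestronglyMeasurable]
  have h := integrable_rpow_neg_one_add_norm_sq (E := ℝ) (μ := volume) (r := 2 * s)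
    (by simp; linarith)
  refine h.congr (ae_of_all _ fun x => ?_)
  have h1 : (0 : ℝ) ≤ 1 + x ^ 2 := by positivity
  simp only [Real.norm_eq_abs, sq_abs]
  have h2 : (jbracket x ^ (-s)) ^ 2 = jbracket x ^ (-s * (2 : ℕ)) := by
    rw [Real.rpow_mul (jbracket_pos x).le, Real.rpow_natCast]
  rw [h2, jbracket, Real.sqrt_eq_rpow, ← Real.rpow_mul h1]
  congr 1
  push_cast
  ring

theorem integrable_weighted_density {s : ℝ} {q : L2} (hqs : MemWeighted s q) (f : hardy) :
    Integrable fun x => jbracket x ^ s * ‖density q f x‖ := by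
  have h := (integrable_mul_L2 hqs (Lp.memLp (f : L2))).norm
  refine h.congr (ae_of_all _ fun x => ?_)
  simp only [density, norm_mul, norm_real, Real.norm_eq_abs]
  rw [abs_of_nonneg (Real.rpow_nonneg (Real.sqrt_nonneg _) _), jbracket, mul_assoc]

theorem aestronglyMeasurable_boundFn (q : L2) (lam : ℝ) (f : hardy) :
    AEStronglyMeasurable (boundFn q lam f) :=
  (memLp_top_resConv (ofReal_mem_halfPlane true lam) (integrable_density q f)).1

section Weighted

variable {s : ℝ} {q : L2} {lam : ℝ} {f : hardy}

theorem IsBound.norm_boundFn_le (h : IsBound q lam f) (hs : 1 / 2 < s) (hqs : MemWeighted s q)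
    (x : ℝ) : ‖boundFn q lam f x‖ ≤ jbracket x ^ (-s) * ∫ y, jbracket y ^ s * ‖density q f y‖ :=
  norm_resConv_le_jbracket (by linarith) (integrable_density q f)
    (integrable_weighted_density hqs f) h.fourier_eq_zero x

theorem IsBound.memLp_boundFn (h : IsBound q lam f) (hs : 1 / 2 < s) (hqs : MemWeighted s q) :
    MemLp (boundFn q lam f) 2 := by
  refine ((memLp_jbracket_rpow hs).mul_const
    (∫ y, jbracket y ^ s * ‖density q f y‖)).of_le (aestronglyMeasurable_boundFn q lam f)
    (ae_of_all _ fun x => ?_)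
  exact (h.norm_boundFn_le hs hqs x).trans (le_abs_self _)

/-- Since `|x| ⟨x⟩⁻ˢ ≤ ⟨x⟩ˢ`, the function `x q̄ φ` is square integrable. -/
theorem IsBound.memLp_mul_boundFn (h : IsBound q lam f) (hs : 1 / 2 < s) (hqs : MemWeighted s q) :
    MemLp (fun x : ℝ => (x : ℂ) * (conj (q x) * boundFn q lam f x)) 2 := by
  refine MemLp.of_le_mul (c := ∫ y, jbracket y ^ s * ‖density q f y‖) hqs ?_
    (ae_of_all _ fun x => ?_)
  · exact (continuous_ofReal.aestronglyMeasurable).mul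
      ((continuous_conj.comp_aestronglyMeasurable (Lp.memLp q).1).mul
        (aestronglyMeasurable_boundFn q lam f))
  · have h1 := h.norm_boundFn_le hs hqs x
    have h0 : 0 ≤ ∫ y, jbracket y ^ s * ‖density q f y‖ :=
      integral_nonneg fun y => mul_nonneg (Real.rpow_nonneg (jbracket_pos y).le _) (norm_nonneg _)
    have h2 : |x| * jbracket x ^ (-s) ≤ jbracket x ^ s := by
      calc |x| * jbracket x ^ (-s) ≤ jbracket x ^ (1 : ℝ) * jbracket x ^ (-s) := by
            rw [Real.rpow_one]
            exact mul_le_mul_of_nonneg_right (abs_le_jbracket x)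
              (Real.rpow_nonneg (jbracket_pos x).le _)
        _ = jbracket x ^ (1 - s) := by rw [← Real.rpow_add (jbracket_pos x), sub_eq_add_neg]
        _ ≤ jbracket x ^ s := Real.rpow_le_rpow_of_exponent_le (one_le_jbracket x) (by linarith)
    simp only [norm_mul, norm_real, Real.norm_eq_abs, norm_conj]
    rw [abs_of_nonneg (Real.rpow_nonneg (Real.sqrt_nonneg _) _)]
    calc |x| * (‖q x‖ * ‖boundFn q lam f x‖)
        ≤ |x| * (‖q x‖ * (jbracket x ^ (-s) * ∫ y, jbracket y ^ s * ‖density q f y‖)) := by gcongr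
      _ = (∫ y, jbracket y ^ s * ‖density q f y‖) * ((|x| * jbracket x ^ (-s)) * ‖q x‖) := by ring
      _ ≤ (∫ y, jbracket y ^ s * ‖density q f y‖) * (jbracket x ^ s * ‖q x‖) := by gcongr
      _ = _ := rfl

end Weighted

/-! ### First moments of `q C₊ u` -/

theorem integral_norm_mul_norm_le (a b : L2) : ∫ x, ‖a x‖ * ‖b x‖ ≤ ‖a‖ * ‖b‖ := by
  have ha : MemLp (fun x => ((‖a x‖ : ℝ) : ℂ)) 2 := (Lp.memLp a).norm.ofReal
  have hb : MemLp (fun x => ((‖b x‖ : ℝ) : ℂ)) 2 := (Lp.memLp b).norm.ofReal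
  have h := norm_integral_mul_sq_le ha hb
  simp only [← ofReal_mul] at h
  rw [integral_complex_ofReal] at h
  simp only [norm_real, norm_norm] at h
  rw [← norm_sq_L2, ← norm_sq_L2, ← mul_pow, Real.norm_of_nonneg
    (integral_nonneg fun x => by positivity)] at h
  exact (pow_le_pow_iff_left₀ (integral_nonneg fun x => by positivity) (by positivity)
    two_ne_zero).1 h

theorem ae_comp_add {p : ℝ → Prop} (h : ∀ᵐ x, p x) (a : ℝ) : ∀ᵐ x, p (x + a) :=
  (measurePreserving_add_right volume a).quasiMeasurePreserving.ae h

theorem fourier_modulate_szego (t : ℝ) (u : L2) :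
    (𝓕 (modulate t (szego u)) : L2) =ᵐ[volume]
      fun ξ => (Set.Ici (0 : ℝ)).indicator (𝓕 u : L2) (ξ + t / (2 * Real.pi)) := by
  filter_upwards [fourier_modulate t (szego u : L2), ae_comp_add (fourier_szego u) _] with ξ h1 h2
  rw [h1, h2]

/-- Lowering frequencies commutes with the Szegő projection. -/
theorem szego_modulate_szego {t : ℝ} (ht : 0 ≤ t) (u : L2) :
    szego (modulate t (szego u)) = szego (modulate t u) := by
  refine Subtype.ext ((Lp.fourierTransformₗᵢ ℝ ℂ).injective ?_)
  change (𝓕 (szego (modulate t (szego u)) : L2) : L2) = 𝓕 (szego (modulate t u) : L2)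
  refine Lp.ext ?_
  filter_upwards [fourier_szego (modulate t (szego u)), fourier_szego (modulate t u),
    fourier_modulate t u, fourier_modulate_szego t u] with ξ h1 h2 h3 h4
  rw [h1, h2]
  by_cases hξ : ξ ∈ Set.Ici (0 : ℝ)
  · have h5 : ξ + t / (2 * Real.pi) ∈ Set.Ici (0 : ℝ) :=
      add_nonneg (show (0 : ℝ) ≤ ξ from hξ) (show (0 : ℝ) ≤ t / (2 * Real.pi) by positivity)
    rw [Set.indicator_of_mem hξ, Set.indicator_of_mem hξ, h3, h4, Set.indicator_of_mem h5]
  · simp only [Set.indicator_of_notMem hξ]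

/-- The negative frequencies that appear when the frequencies of `C₊ u` are lowered by a small
amount form a small bounded function, as the Fourier transform of `u` is bounded. -/
theorem ae_norm_modulate_sub_szego_le {t : ℝ} (ht : 0 ≤ t) {u : L2} (hu : Integrable u) :
    ∀ᵐ x, ‖(modulate t (szego u) - szego (modulate t u) : L2) x‖ ≤
      t / (2 * Real.pi) * ∫ y, ‖u y‖ := by
  set δ := t / (2 * Real.pi) with hδ
  have hδ0 : 0 ≤ δ := by positivity
  set b : L2 := modulate t (szego u) - szego (modulate t u) with hb
  have hF : ∀ᵐ ξ, ‖(𝓕 b : L2) ξ‖ ≤ (Set.Ico (-δ) 0).indicator (fun _ => ∫ y, ‖u y‖) ξ := by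
    have hsub : (𝓕 b : L2) = 𝓕 (modulate t (szego u)) - 𝓕 (szego (modulate t u) : L2) :=
      map_sub (Lp.fourierTransformₗᵢ ℝ ℂ) _ _
    have hu' := ae_comp_add (fourier_L2_ae_eq hu) δ
    filter_upwards [Lp.coeFn_sub (𝓕 (modulate t (szego u)) : L2) (𝓕 (szego (modulate t u) : L2)),
      fourier_modulate t u, fourier_modulate_szego t u, fourier_szego (modulate t u), hu']
      with ξ h1 h2 h3 h4 h5
    rw [hsub, h1, Pi.sub_apply, h3, h4, ← hδ]
    have h6 : ‖(𝓕 u : L2) (ξ + δ)‖ ≤ ∫ y, ‖u y‖ := by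
      rw [h5, fourier_eq_angularFourier]; exact norm_angularFourier_le _ _
    by_cases h0 : 0 ≤ ξ
    · rw [Set.indicator_of_mem (show ξ ∈ Set.Ici (0 : ℝ) from h0), Set.indicator_of_mem
        (show ξ + δ ∈ Set.Ici (0 : ℝ) from add_nonneg h0 hδ0), h2, sub_self, norm_zero]
      exact Set.indicator_nonneg (fun _ _ => integral_nonneg fun _ => norm_nonneg _) _
    · rw [Set.indicator_of_notMem (show ξ ∉ Set.Ici (0 : ℝ) from h0), sub_zero]
      by_cases h7 : 0 ≤ ξ + δ
      · rw [Set.indicator_of_mem (show ξ + δ ∈ Set.Ici (0 : ℝ) from h7), Set.indicator_of_mem]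
        · exact h6
        · exact ⟨by linarith, not_le.1 h0⟩
      · rw [Set.indicator_of_notMem (show ξ + δ ∉ Set.Ici (0 : ℝ) from h7), norm_zero]
        exact Set.indicator_nonneg (fun _ _ => integral_nonneg fun _ => norm_nonneg _) _
  have hint : Integrable ((Set.Ico (-δ) 0).indicator (fun _ : ℝ => ∫ y, ‖u y‖)) :=
    (integrable_indicator_iff measurableSet_Ico).2 (integrableOn_const (by simp))
  have hFi : Integrable (𝓕 b : L2) := hint.mono' (Lp.memLp _).1 hF
  filter_upwards [ae_norm_le_of_integrable_fourier hFi] with x hx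
  refine hx.trans ((integral_mono_ae hFi.norm hint hF).trans_eq ?_)
  rw [integral_indicator measurableSet_Ico, setIntegral_const]
  simp [hδ0]

theorem norm_exp_sub_one_le (t x : ℝ) : ‖exp (-(I * t * x)) - 1‖ ≤ |t * x| := by
  have h := Real.norm_exp_I_mul_ofReal_sub_one_le (x := -(t * x))
  rw [norm_neg, Real.norm_eq_abs] at h
  convert h using 3
  push_cast
  ring_nf

theorem norm_modulate_sub_le {u : L2} (hxu : MemLp (fun x : ℝ => (x : ℂ) * u x) 2) {t : ℝ}
    (ht : 0 ≤ t) : ‖modulate t u - u‖ ≤ t * ‖hxu.toLp _‖ := by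
  refine Lp.norm_le_mul_norm_of_ae_le_mul ?_
  filter_upwards [Lp.coeFn_sub (modulate t u) u, coeFn_modulate t u, hxu.coeFn_toLp]
    with x h1 h2 h3
  rw [h1, Pi.sub_apply, h2, h3, norm_mul, norm_real, ← mul_assoc, ← sub_one_mul, norm_mul]
  refine mul_le_mul_of_nonneg_right ((norm_exp_sub_one_le t x).trans_eq ?_) (norm_nonneg _)
  rw [abs_mul, abs_of_nonneg ht, Real.norm_eq_abs]

/-- The `L¹` modulus of continuity of the Fourier transform of `q C₊ u`. The difference
`e^{-itx} C₊ u - C₊ u` is split into `C₊ (e^{-itx} u - u)`, of order `t` in `L²`, and the part of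
`e^{-itx} C₊ u` with negative frequencies, of order `t` in `L^∞`. -/
theorem integral_norm_exp_sub_one_mul_le {q u : L2} (hq : Integrable q) (hu : Integrable u)
    (hxu : MemLp (fun x : ℝ => (x : ℂ) * u x) 2) {t : ℝ} (ht : 0 ≤ t) :
    ∫ x : ℝ, ‖exp (-(I * t * x)) - 1‖ * ‖q x * (szego u : L2) x‖ ≤
      t * (‖q‖ * ‖hxu.toLp _‖ + (∫ y, ‖u y‖) / (2 * Real.pi) * ∫ y, ‖q y‖) := by
  set f : L2 := (szego u).1 with hf
  set w : L2 := (szego (modulate t u - u)).1 with hw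
  set C : ℝ := t / (2 * Real.pi) * ∫ y, ‖u y‖ with hC
  have hle : ∀ᵐ x : ℝ, ‖exp (-(I * t * x)) - 1‖ * ‖q x * f x‖ ≤ ‖q x‖ * ‖w x‖ + C * ‖q x‖ := by
    filter_upwards [coeFn_modulate t f, Lp.coeFn_sub (modulate t f) (szego (modulate t u) : L2),
      ae_norm_modulate_sub_szego_le ht hu, Lp.coeFn_sub (szego (modulate t u) : L2) f]
      with x h1 h2 h3 h4
    have hwx : w x = (szego (modulate t u) : L2) x - f x := by
      rw [← Pi.sub_apply, ← h4, hw, map_sub]; rfl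
    rw [h2, Pi.sub_apply, h1] at h3
    have h5 : ‖(exp (-(I * t * x)) - 1) * f x‖ ≤ ‖w x‖ + C := by
      rw [show (exp (-(I * t * x)) - 1) * f x = w x +
        (exp (-(I * t * x)) * f x - (szego (modulate t u) : L2) x) by rw [hwx]; ring]
      exact (norm_add_le _ _).trans (add_le_add_right h3 _)
    calc ‖exp (-(I * t * x)) - 1‖ * ‖q x * f x‖ = ‖q x‖ * ‖(exp (-(I * t * x)) - 1) * f x‖ := by
          rw [norm_mul, norm_mul]; ring
      _ ≤ ‖q x‖ * (‖w x‖ + C) := by gcongr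
      _ = _ := by ring
  have hi1 : Integrable fun x => ‖q x‖ * ‖w x‖ :=
    (integrable_mul_L2 (Lp.memLp q) (Lp.memLp w)).norm.congr (ae_of_all _ fun x => norm_mul _ _)
  refine (integral_mono_of_nonneg (ae_of_all _ fun _ => by positivity)
    (hi1.add (hq.norm.const_mul C)) hle).trans ?_
  have h6 : ∫ x, ‖q x‖ * ‖w x‖ + C * ‖q x‖ = (∫ x, ‖q x‖ * ‖w x‖) + C * ∫ x, ‖q x‖ := by
    rw [integral_add hi1 (hq.norm.const_mul C), integral_const_mul]
  simp only [Pi.add_apply]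
  rw [h6]
  have h7 := integral_norm_mul_norm_le q w
  have h8 : ‖w‖ ≤ t * ‖hxu.toLp _‖ := (norm_szego_le _).trans (norm_modulate_sub_le hxu ht)
  have h9 : ‖q‖ * ‖w‖ ≤ ‖q‖ * (t * ‖hxu.toLp _‖) := by gcongr
  have h10 : C * ∫ x, ‖q x‖ = t * ((∫ y, ‖u y‖) / (2 * Real.pi) * ∫ y, ‖q y‖) := by
    rw [hC]; ring
  rw [h10]
  linarith

/-- If `u` has a square integrable first moment then `q C₊ u` has an integrable first moment:
difference quotients of its Fourier transform are controlled by those of `u`, up to a contribution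
of frequencies near zero which is handled by the boundedness of the Fourier transform of `u`. -/
theorem integrable_mul_szego {q u : L2} (hq : Integrable q) (hu : Integrable u)
    (hxu : MemLp (fun x : ℝ => (x : ℂ) * u x) 2) :
    Integrable fun x : ℝ => (x : ℂ) * (q x * (szego u : L2) x) := by
  have hqf : Integrable fun x => q x * (szego u : L2) x :=
    integrable_mul_L2 (Lp.memLp q) (Lp.memLp _)
  set K : ℝ := ‖q‖ * ‖hxu.toLp _‖ + (∫ y, ‖u y‖) / (2 * Real.pi) * ∫ y, ‖q y‖ with hK
  -- Fatou's lemma for the difference quotients of `e^{-itx}` as `t → 0`.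
  set t : ℕ → ℝ := fun n => 1 / ((n : ℝ) + 1) with ht
  have ht0 : ∀ n, 0 < t n := fun n => by positivity
  set G : ℕ → ℝ → ℝ := fun n x =>
    ‖exp (-(I * t n * x)) - 1‖ / t n * ‖q x * (szego u : L2) x‖ with hG
  have hGm : ∀ n, AEStronglyMeasurable (G n) := fun n => by
    refine AEStronglyMeasurable.mul ?_ hqf.1.norm
    exact Continuous.aestronglyMeasurable (by fun_prop)
  have hlim : ∀ x : ℝ, Tendsto (fun n => G n x) atTop (𝓝 (|x| * ‖q x * (szego u : L2) x‖)) := by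
    intro x
    refine Tendsto.mul_const _ ?_
    have h1 : HasDerivAt (fun τ : ℝ => exp (-(I * x * τ))) (-(I * x)) 0 := by
      have := hasDerivAt_exp_neg_I_mul x 0
      simpa using this
    have h2 := h1.tendsto_slope_zero
    have h3 : Tendsto t atTop (𝓝[≠] 0) := by
      refine tendsto_nhdsWithin_iff.2 ⟨tendsto_one_div_add_atTop_nhds_zero_nat, ?_⟩
      exact Eventually.of_forall fun n => (ht0 n).ne'
    have h4 := (h2.comp h3).norm
    have h5 : ‖-(I * (x : ℂ))‖ = |x| := by simp
    rw [h5] at h4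
    refine h4.congr fun n => ?_
    simp only [Function.comp_apply, zero_add, ofReal_zero, mul_zero, neg_zero, exp_zero]
    rw [norm_smul, norm_inv, Real.norm_of_nonneg (ht0 n).le, div_eq_inv_mul]
    congr 4
    ring_nf
  have hbd : ∀ n, ∫⁻ x, ‖G n x‖ₑ ≤ ENNReal.ofReal K := by
    intro n
    have hGi : Integrable (G n) := by
      refine hqf.norm.bdd_mul (c := 2 / t n)
        (Continuous.aestronglyMeasurable (by fun_prop)) (ae_of_all _ fun x => ?_)
      rw [Real.norm_of_nonneg (div_nonneg (norm_nonneg _) (ht0 n).le)]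
      refine div_le_div_of_nonneg_right ((norm_sub_le _ _).trans ?_) (ht0 n).le
      rw [norm_exp_neg_I_mul, norm_one]; norm_num
    have h0 : ∀ x, 0 ≤ G n x := fun x =>
      mul_nonneg (div_nonneg (norm_nonneg _) (ht0 n).le) (norm_nonneg _)
    have h1 : ∫⁻ x, ‖G n x‖ₑ = ENNReal.ofReal (∫ x, G n x) := by
      rw [ofReal_integral_eq_lintegral_ofReal hGi (ae_of_all _ h0)]
      exact lintegral_congr fun x => Real.enorm_of_nonneg (h0 x)
    rw [h1]
    refine ENNReal.ofReal_le_ofReal ?_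
    have h2 := integral_norm_exp_sub_one_mul_le hq hu hxu (ht0 n).le
    have h3 : ∫ x, G n x = (t n)⁻¹ *
        ∫ x : ℝ, ‖exp (-(I * t n * x)) - 1‖ * ‖q x * (szego u : L2) x‖ := by
      rw [← integral_const_mul]
      refine integral_congr_ae (ae_of_all _ fun x => ?_)
      simp only [hG]; ring
    rw [h3, inv_mul_le_iff₀ (ht0 n)]
    exact h2
  have hfin : liminf (fun n => ∫⁻ x, ‖G n x‖ₑ) atTop ≠ ⊤ :=
    ((liminf_le_of_frequently_le' (Frequently.of_forall hbd)).trans_lt ENNReal.ofReal_lt_top).ne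
  have h := integrable_of_tendsto (ae_of_all _ hlim) hGm hfin
  refine (integrable_norm_iff (continuous_ofReal.aestronglyMeasurable.mul hqf.1)).1
    (h.congr (ae_of_all _ fun x => ?_))
  simp only [Pi.mul_apply, norm_mul, norm_real, Real.norm_eq_abs]

/-! ### Integrability of bound states -/

section Weighted

variable {s : ℝ} {q : L2} {lam : ℝ} {f : hardy}

theorem MemWeighted.integrable (hqs : MemWeighted s q) (hs : 1 / 2 < s) : Integrable q :=
  memLp_one_iff_integrable.1 (hqs.memLp_one hs)

/-- The density `q f` of a bound state has an integrable first moment, as `f = C₊ u` with `u = q̄ φ`,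
and `x u` is square integrable. -/
theorem IsBound.integrable_moment (h : IsBound q lam f) (hs : 1 / 2 < s)
    (hqs : MemWeighted s q) : Integrable fun x : ℝ => (x : ℂ) * density q f x := by
  obtain ⟨u, hu, hf⟩ := h.exists_szego
  have h1 : Integrable u :=
    (integrable_mul_L2 (Lp.memLp q).star (h.memLp_boundFn hs hqs)).congr hu.symm
  have h2 : MemLp (fun x : ℝ => (x : ℂ) * u x) 2 := by
    refine (memLp_congr_ae ?_).1 (h.memLp_mul_boundFn hs hqs)
    filter_upwards [hu] with x hx
    rw [hx]
  have h3 := integrable_mul_szego (hqs.integrable hs) h1 h2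
  rw [hf] at h3
  exact h3

theorem IsBound.integrable_boundFn (h : IsBound q lam f) (hs : 1 / 2 < s)
    (hqs : MemWeighted s q) : Integrable (boundFn q lam f) :=
  integrable_resConv_of_moment lam (integrable_density q f) (h.integrable_moment hs hqs)
    h.fourier_eq_zero

theorem IsBound.negFreq_boundFn (h : IsBound q lam f) (hq : q ∈ hardy) (hs : 1 / 2 < s)
    (hqs : MemWeighted s q) : NegFreq (boundFn q lam f) :=
  negFreq_resConv lam (integrable_density q f) (h.integrable_moment hs hqs) h.fourier_eq_zero
    (negFreq_density hq f)

theorem IsBound.toLp_mem_hardy (h : IsBound q lam f) (hq : q ∈ hardy) (hs : 1 / 2 < s)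
    (hqs : MemWeighted s q) : (h.memLp_boundFn hs hqs).toLp _ ∈ hardy := by
  have h1 := (h.memLp_boundFn hs hqs).coeFn_toLp
  exact mem_hardy_of_negFreq ((h.integrable_boundFn hs hqs).congr h1.symm)
    ((h.negFreq_boundFn hq hs hqs).congr h1.symm)

end Weighted

/-! ### Scalar products of bound states -/

theorem resConv_exp_mul (k : ℂ) (t : ℝ) (g : ℝ → ℂ) (x : ℝ) :
    resConv true k (fun y : ℝ => exp (-(I * t * y)) * g y) x =
      exp (-(I * t * x)) * resConv true (k + t) g x := by
  rw [resConv, resConv, ← integral_const_mul]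
  refine integral_congr_ae (ae_of_all _ fun y => ?_)
  simp only [resKer, if_true]
  split_ifs
  · have h : exp (I * k * ((x - y : ℝ) : ℂ)) * exp (-(I * t * y)) =
        exp (-(I * t * x)) * exp (I * (k + t) * ((x - y : ℝ) : ℂ)) := by
      rw [← exp_add, ← exp_add]
      congr 1
      push_cast
      ring
    linear_combination (I * g y) * h
  · ring

section Weighted

variable {s : ℝ} {q : L2} {lam₁ lam₂ : ℝ} {f₁ f₂ : hardy}

/-- The commutator identity for `-i∂ₓ` and the modulation `e^{-itx}`, tested between two bound
states. -/
theorem IsBound.integral_exp_mul_boundFn (h₁ : IsBound q lam₁ f₁) (h₂ : IsBound q lam₂ f₂)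
    (hs : 1 / 2 < s) (hqs : MemWeighted s q) (t : ℝ) :
    (t + lam₂ - lam₁ : ℂ) *
        ∫ x : ℝ, exp (-(I * t * x)) * boundFn q lam₁ f₁ x * conj (boundFn q lam₂ f₂ x) =
      (∫ x : ℝ, exp (-(I * t * x)) * density q f₁ x * conj (boundFn q lam₂ f₂ x)) -
        ∫ x : ℝ, exp (-(I * t * x)) * boundFn q lam₁ f₁ x * conj (density q f₂ x) := by
  set g₁ := density q f₁ with hg₁
  set φ₁ := boundFn q lam₁ f₁ with hφ₁
  set c : ℂ := t + lam₂ - lam₁ with hc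
  have hi1 : Integrable g₁ := integrable_density q f₁
  have hi2 : Integrable φ₁ := h₁.integrable_boundFn hs hqs
  have he1 := integrable_exp_mul hi1 t
  have he2 := (integrable_exp_mul hi2 t).const_mul c
  set G : ℝ → ℂ := fun y => exp (-(I * t * y)) * g₁ y - c * (exp (-(I * t * y)) * φ₁ y) with hG
  have hGi : Integrable G := he1.sub he2
  have hmem := ofReal_mem_halfPlane true lam₂
  -- `e^{-itx} φ₁` is the solution of the free equation at `lam₂` with the source `G`.
  have key : ∀ x : ℝ, resConv true lam₂ G x = exp (-(I * t * x)) * φ₁ x := by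
    intro x
    rw [hG, resConv_sub hmem he1 he2, resConv_const_mul, resConv_exp_mul, resConv_exp_mul]
    have hk : (lam₂ + t : ℂ) = ((lam₂ + t : ℝ) : ℂ) := by push_cast; ring
    have h := resolvent_identity (ofReal_mem_halfPlane true (lam₂ + t)) lam₁ hi1
      (h₁.integrable_moment hs hqs) x
    rw [← hk] at h
    have h' : resConv true (lam₂ + t) g₁ x - φ₁ x = (lam₂ + t - lam₁) * resConv true (lam₂ + t) φ₁ x := h
    rw [hc]
    linear_combination exp (-(I * t * x)) * h'
  have hadj := integral_resConv_mul_conj hmem hGi (integrable_density q f₂)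
  have hφ₂ : resConv (!true) (conj (lam₂ : ℂ)) (density q f₂) = boundFn q lam₂ f₂ := by
    rw [conj_ofReal]
    exact resConv_eq_of_angularFourier_eq_zero _ _ (integrable_density q f₂) h₂.fourier_eq_zero
  rw [hφ₂] at hadj
  simp only [key] at hadj
  have hb2 := h₂.memLp_boundFn hs hqs
  have hi : ∀ {v : ℝ → ℂ}, Integrable v →
      Integrable fun x => v x * conj (boundFn q lam₂ f₂ x) := fun {v} hv => by
    have h1 : MemLp (fun x => conj (boundFn q lam₂ f₂ x)) ∞ :=
      (memLp_top_resConv (ofReal_mem_halfPlane true lam₂) (integrable_density q f₂)).star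
    exact hv.mul_of_top_left h1
  rw [hadj]
  have e : ∀ x, G x * conj (boundFn q lam₂ f₂ x) =
      exp (-(I * t * x)) * g₁ x * conj (boundFn q lam₂ f₂ x) -
        c * (exp (-(I * t * x)) * φ₁ x * conj (boundFn q lam₂ f₂ x)) := fun x => by
    simp only [hG]; ring
  simp only [e]
  rw [integral_sub (hi he1) ((hi (integrable_exp_mul hi2 t)).const_mul c), integral_const_mul]
  ring

/-- The Fourier transform of `q̄ φ`. -/
def boundFourier (q : L2) (lam : ℝ) (f : hardy) : ℝ → ℂ :=
  𝓕 fun x => conj (q x) * boundFn q lam f x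

theorem boundFourier_zero (q : L2) (lam : ℝ) (f : hardy) :
    boundFourier q lam f 0 = conj (pairing q (boundFn q lam f)) := by
  rw [boundFourier, fourier_eq_angularFourier, angularFourier, pairing, ← integral_conj]
  refine integral_congr_ae (ae_of_all _ fun x => ?_)
  simp

theorem integrable_conj_mul_boundFn (q : L2) (hq1 : Integrable q) (lam : ℝ) (f : hardy) :
    Integrable fun x => conj (q x) * boundFn q lam f x :=
  (conjCLE.toContinuousLinearMap.integrable_comp hq1).mul_of_top_left
    (memLp_top_resConv (ofReal_mem_halfPlane true lam) (integrable_density q f))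

theorem continuous_boundFourier (q : L2) (hq1 : Integrable q) (lam : ℝ) (f : hardy) :
    Continuous (boundFourier q lam f) := by
  have h := continuous_angularFourier (integrable_conj_mul_boundFn q hq1 lam f)
  have e : boundFourier q lam f = fun ξ =>
      angularFourier (fun x => conj (q x) * boundFn q lam f x) (2 * Real.pi * ξ) :=
    funext fun ξ => fourier_eq_angularFourier _ _
  rw [e]
  exact h.comp (continuous_const.mul continuous_id)

/-- By Plancherel, the right side of the commutator identity involves only the frequencies that the
modulation moves across zero. -/
theorem IsBound.integral_sub_integral (h₁ : IsBound q lam₁ f₁) (h₂ : IsBound q lam₂ f₂)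
    (hs : 1 / 2 < s) (hqs : MemWeighted s q) {δ : ℝ} (hδ : 0 ≤ δ) :
    (∫ x : ℝ, exp (-(I * (2 * Real.pi * δ : ℝ) * x)) * density q f₁ x *
          conj (boundFn q lam₂ f₂ x)) -
        ∫ x : ℝ, exp (-(I * (2 * Real.pi * δ : ℝ) * x)) * boundFn q lam₁ f₁ x *
          conj (density q f₂ x) =
      ∫ ξ in Set.Ico (-δ) 0, boundFourier q lam₁ f₁ (ξ + δ) * conj (boundFourier q lam₂ f₂ ξ) := by
  set t : ℝ := 2 * Real.pi * δ with ht
  have ht0 : 0 ≤ t := by positivity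
  have htδ : t / (2 * Real.pi) = δ := by rw [ht]; field_simp
  have hq1 := hqs.integrable hs
  obtain ⟨u₁, hu₁, hf₁⟩ := h₁.exists_szego
  obtain ⟨u₂, hu₂, hf₂⟩ := h₂.exists_szego
  have hF : ∀ {u : L2} {lam : ℝ} {f : hardy},
      (u =ᵐ[volume] fun x => conj (q x) * boundFn q lam f x) →
      (𝓕 u : L2) =ᵐ[volume] boundFourier q lam f := by
    intro u lam f hu
    have h := fourier_L2_ae_eq ((integrable_conj_mul_boundFn q hq1 lam f).congr hu.symm)
    filter_upwards [h] with ξ hξ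
    rw [hξ, boundFourier, fourier_eq_angularFourier, fourier_eq_angularFourier,
      angularFourier_congr hu]
  have e1 : ∫ x : ℝ, exp (-(I * t * x)) * density q f₁ x * conj (boundFn q lam₂ f₂ x) =
      inner ℂ u₂ (modulate t (f₁ : L2)) := by
    rw [inner_L2_eq]
    refine integral_congr_ae ?_
    filter_upwards [hu₂, coeFn_modulate t (f₁ : L2)] with x h1 h2
    rw [h1, h2, density, map_mul, conj_conj]
    ring
  have e2 : ∫ x : ℝ, exp (-(I * t * x)) * boundFn q lam₁ f₁ x * conj (density q f₂ x) =
      inner ℂ (f₂ : L2) (modulate t (f₁ : L2)) := by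
    rw [← inner_szego_right (modulate t (f₁ : L2)) f₂.2, ← hf₁, szego_modulate_szego ht0,
      inner_szego_right _ f₂.2, inner_L2_eq]
    refine integral_congr_ae ?_
    filter_upwards [hu₁, coeFn_modulate t u₁] with x h1 h2
    rw [h2, h1, density, map_mul, hf₁]
    ring
  -- The difference is the pairing with `u₂ - C₊ u₂`, which has negative frequencies only.
  rw [e1, e2, ← inner_sub_left, ← (Lp.fourierTransformₗᵢ ℝ ℂ).inner_map_map]
  change inner ℂ (𝓕 (u₂ - f₂) : L2) (𝓕 (modulate t f₁) : L2) = _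
  rw [inner_L2_eq, ← integral_indicator measurableSet_Ico]
  refine integral_congr_ae ?_
  have hsub : (𝓕 (u₂ - f₂ : L2) : L2) = 𝓕 u₂ - 𝓕 (f₂ : L2) :=
    map_sub (Lp.fourierTransformₗᵢ ℝ ℂ) _ _
  filter_upwards [Lp.coeFn_sub (𝓕 u₂ : L2) (𝓕 (f₂ : L2)), fourier_modulate_szego t u₁,
    fourier_szego u₂, hF hu₂, ae_comp_add (hF hu₁) δ] with ξ a1 a2 a3 a4 a5
  rw [hf₁, htδ] at a2
  rw [hf₂] at a3
  rw [hsub, a1, Pi.sub_apply, a2, a3, a4]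
  by_cases h0 : 0 ≤ ξ
  · rw [Set.indicator_of_mem (show ξ ∈ Set.Ici (0 : ℝ) from h0), a4, sub_self, map_zero, mul_zero,
      Set.indicator_of_notMem]
    exact fun h => absurd h.2 (not_lt.2 h0)
  · rw [Set.indicator_of_notMem (show ξ ∉ Set.Ici (0 : ℝ) from h0), sub_zero]
    by_cases h1 : 0 ≤ ξ + δ
    · rw [Set.indicator_of_mem (show ξ + δ ∈ Set.Ici (0 : ℝ) from h1), Set.indicator_of_mem, a5]
      exact ⟨by linarith, not_le.1 h0⟩
    · rw [Set.indicator_of_notMem (show ξ + δ ∉ Set.Ici (0 : ℝ) from h1), zero_mul,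
        Set.indicator_of_notMem]
      exact fun h => h1 (by linarith [h.1])

/-- The commutator identity for the modulation by `t = 2πδ`, with the right side rescaled to a fixed
interval of integration. -/
theorem IsBound.mul_integral_boundFn (h₁ : IsBound q lam₁ f₁) (h₂ : IsBound q lam₂ f₂)
    (hs : 1 / 2 < s) (hqs : MemWeighted s q) {δ : ℝ} (hδ : 0 < δ) :
    (2 * Real.pi * δ + lam₂ - lam₁ : ℂ) *
        ∫ x : ℝ, exp (-(I * (2 * Real.pi * δ : ℝ) * x)) * boundFn q lam₁ f₁ x *
          conj (boundFn q lam₂ f₂ x) =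
      δ * ∫ r in (-1 : ℝ)..0,
        boundFourier q lam₁ f₁ (δ * r + δ) * conj (boundFourier q lam₂ f₂ (δ * r)) := by
  have h := h₁.integral_exp_mul_boundFn h₂ hs hqs (2 * Real.pi * δ)
  rw [h₁.integral_sub_integral h₂ hs hqs hδ.le, integral_Ico_eq_integral_Ioc,
    ← intervalIntegral.integral_of_le (by linarith)] at h
  have h2 := intervalIntegral.smul_integral_comp_mul_left (a := -1) (b := 0)
    (fun ξ => boundFourier q lam₁ f₁ (ξ + δ) * conj (boundFourier q lam₂ f₂ ξ)) δ
  rw [mul_zero, mul_neg_one, real_smul] at h2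
  rw [h2, ← h]
  push_cast
  ring

/-- Bound states with distinct energies are orthogonal, and for equal energies the scalar product is
determined by the pairings with `q`. -/
theorem IsBound.integral_boundFn_mul_conj (h₁ : IsBound q lam₁ f₁) (h₂ : IsBound q lam₂ f₂)
    (hs : 1 / 2 < s) (hqs : MemWeighted s q) :
    (lam₁ ≠ lam₂ → ∫ x, boundFn q lam₁ f₁ x * conj (boundFn q lam₂ f₂ x) = 0) ∧
    (lam₁ = lam₂ → 2 * Real.pi * ∫ x, boundFn q lam₁ f₁ x * conj (boundFn q lam₂ f₂ x) =
      conj (pairing q (boundFn q lam₁ f₁)) * pairing q (boundFn q lam₂ f₂)) := by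
  have hq1 := hqs.integrable hs
  set J : ℝ → ℂ := fun δ => ∫ x : ℝ, exp (-(I * (2 * Real.pi * δ : ℝ) * x)) * boundFn q lam₁ f₁ x *
          conj (boundFn q lam₂ f₂ x) with hJ
  set P : ℝ → ℂ := fun δ => ∫ r in (-1 : ℝ)..0,
        boundFourier q lam₁ f₁ (δ * r + δ) * conj (boundFourier q lam₂ f₂ (δ * r)) with hP
  have hint : Integrable fun x => boundFn q lam₁ f₁ x * conj (boundFn q lam₂ f₂ x) :=
    integrable_mul_L2 (h₁.memLp_boundFn hs hqs) (h₂.memLp_boundFn hs hqs).star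
  have hJc : Continuous J := by
    have h := (continuous_angularFourier hint).comp
      (by fun_prop : Continuous fun δ : ℝ => 2 * Real.pi * δ)
    refine h.congr fun δ => integral_congr_ae (ae_of_all _ fun x => ?_)
    simp only [mul_assoc]
  have hPc : Continuous P := by
    have h1 := continuous_boundFourier q hq1 lam₁ f₁
    have h2 := continuous_boundFourier q hq1 lam₂ f₂
    refine intervalIntegral.continuous_parametric_intervalIntegral_of_continuous' ?_ _ _
    fun_prop
  have hJ0 : J 0 = ∫ x, boundFn q lam₁ f₁ x * conj (boundFn q lam₂ f₂ x) := by
    simp [hJ]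
  have hP0 : P 0 = conj (pairing q (boundFn q lam₁ f₁)) * pairing q (boundFn q lam₂ f₂) := by
    simp [hP, boundFourier_zero]
  have hid : ∀ᶠ δ : ℝ in 𝓝[>] (0 : ℝ), (2 * Real.pi * δ + lam₂ - lam₁ : ℂ) * J δ = δ * P δ := by
    filter_upwards [self_mem_nhdsWithin] with δ hδ
    exact h₁.mul_integral_boundFn h₂ hs hqs hδ
  have hlJ : Tendsto J (𝓝[>] 0) (𝓝 (J 0)) := (hJc.tendsto 0).mono_left nhdsWithin_le_nhds
  have hlP : Tendsto P (𝓝[>] 0) (𝓝 (P 0)) := (hPc.tendsto 0).mono_left nhdsWithin_le_nhds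
  rw [← hJ0, ← hP0]
  constructor
  · intro hne
    have c1 : Tendsto (fun δ : ℝ => (2 * Real.pi * δ + lam₂ - lam₁ : ℂ)) (𝓝[>] 0)
        (𝓝 (2 * Real.pi * (0 : ℝ) + lam₂ - lam₁)) :=
      (Continuous.tendsto (by fun_prop) 0).mono_left nhdsWithin_le_nhds
    have c2 : Tendsto (fun δ : ℝ => (δ : ℂ)) (𝓝[>] 0) (𝓝 ((0 : ℝ) : ℂ)) :=
      (continuous_ofReal.tendsto 0).mono_left nhdsWithin_le_nhds
    have := tendsto_nhds_unique_of_eventuallyEq (c1.mul hlJ) (c2.mul hlP) hid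
    rw [ofReal_zero, mul_zero, zero_add, zero_mul] at this
    refine (mul_eq_zero.1 this).resolve_left ?_
    exact sub_ne_zero.2 (by exact_mod_cast hne.symm)
  · intro heq
    refine tendsto_nhds_unique_of_eventuallyEq (hlJ.const_mul (2 * Real.pi : ℂ)) hlP ?_
    filter_upwards [hid, self_mem_nhdsWithin] with δ h1 hδ
    rw [heq] at h1
    have hδ' : (δ : ℂ) ≠ 0 := by exact_mod_cast (ne_of_gt hδ)
    refine mul_left_cancel₀ hδ' ?_
    linear_combination h1

end Weighted

/-! ### Hardy's inequality -/

theorem lintegral_mul_sq_le {μ : Measure ℝ} {f g : ℝ → ℝ≥0∞} (hf : AEMeasurable f μ)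
    (hg : AEMeasurable g μ) :
    (∫⁻ x, f x * g x ∂μ) ^ 2 ≤ (∫⁻ x, f x ^ 2 ∂μ) * ∫⁻ x, g x ^ 2 ∂μ := by
  have h := ENNReal.lintegral_mul_le_Lp_mul_Lq μ Real.HolderConjugate.two_two hf hg
  simp only [Pi.mul_apply, ENNReal.rpow_two] at h
  refine (pow_le_pow_left' h 2).trans_eq ?_
  rw [mul_pow, ← ENNReal.rpow_natCast, ← ENNReal.rpow_natCast, ← ENNReal.rpow_mul,
    ← ENNReal.rpow_mul]
  norm_num

/-- The primitive of `a` that vanishes at zero. It is zero for negative `x`. -/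
def primitive (a : ℝ → ℝ≥0∞) (x : ℝ) : ℝ≥0∞ := ∫⁻ t in Set.Ioo 0 x, a t

theorem lintegral_Ioo_rpow {x : ℝ} (hx : 0 < x) :
    ∫⁻ t in Set.Ioo 0 x, ENNReal.ofReal (t ^ (-(1 / 2) : ℝ)) =
      ENNReal.ofReal (2 * x ^ (1 / 2 : ℝ)) := by
  have h1 : IntervalIntegrable (fun t : ℝ => t ^ (-(1 / 2) : ℝ)) volume 0 x :=
    intervalIntegral.intervalIntegrable_rpow' (by norm_num)
  rw [intervalIntegrable_iff_integrableOn_Ioo_of_le hx.le] at h1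
  rw [← ofReal_integral_eq_lintegral_ofReal h1]
  · rw [← integral_Ioc_eq_integral_Ioo, ← intervalIntegral.integral_of_le hx.le,
      integral_rpow (Or.inl (by norm_num))]
    congr 1
    norm_num
    ring
  · filter_upwards [ae_restrict_mem measurableSet_Ioo] with t ht
    exact Real.rpow_nonneg ht.1.le _

theorem lintegral_Ioi_rpow {t : ℝ} (ht : 0 < t) :
    ∫⁻ x in Set.Ioi t, ENNReal.ofReal (2 * x ^ (-(3 / 2) : ℝ)) =
      ENNReal.ofReal (4 * t ^ (-(1 / 2) : ℝ)) := by
  have h1 : IntegrableOn (fun x : ℝ => 2 * x ^ (-(3 / 2) : ℝ)) (Set.Ioi t) :=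
    (integrableOn_Ioi_rpow_of_lt (by norm_num) ht).const_mul 2
  rw [← ofReal_integral_eq_lintegral_ofReal h1]
  · rw [integral_const_mul, integral_Ioi_rpow_of_lt (by norm_num) ht]
    congr 1
    norm_num
    ring
  · filter_upwards [ae_restrict_mem measurableSet_Ioi] with x hx
    exact mul_nonneg zero_le_two (Real.rpow_nonneg (ht.trans hx).le _)

/-- The Cauchy–Schwarz inequality with the weight `t^{1/4}`. -/
theorem primitive_sq_le {a : ℝ → ℝ≥0∞} (ha : Measurable a) {x : ℝ} (hx : 0 < x) :
    primitive a x ^ 2 ≤ (∫⁻ t in Set.Ioo 0 x, a t ^ 2 * ENNReal.ofReal (t ^ (1 / 2 : ℝ))) *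
      ENNReal.ofReal (2 * x ^ (1 / 2 : ℝ)) := by
  have hm : ∀ r : ℝ, Measurable fun t : ℝ => ENNReal.ofReal (t ^ r) := fun r => by fun_prop
  have h := lintegral_mul_sq_le (μ := volume.restrict (Set.Ioo 0 x))
    (f := fun t => a t * ENNReal.ofReal (t ^ (1 / 4 : ℝ)))
    (g := fun t => ENNReal.ofReal (t ^ (-(1 / 4) : ℝ))) (ha.mul (hm _)).aemeasurable
    (hm _).aemeasurable
  have e1 : ∫⁻ t in Set.Ioo 0 x, a t * ENNReal.ofReal (t ^ (1 / 4 : ℝ)) *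
      ENNReal.ofReal (t ^ (-(1 / 4) : ℝ)) = primitive a x := by
    refine setLIntegral_congr_fun measurableSet_Ioo fun t ht => ?_
    rw [mul_assoc, ← ENNReal.ofReal_mul (Real.rpow_nonneg ht.1.le _), ← Real.rpow_add ht.1]
    norm_num
  have e2 : ∫⁻ t in Set.Ioo 0 x, (a t * ENNReal.ofReal (t ^ (1 / 4 : ℝ))) ^ 2 =
      ∫⁻ t in Set.Ioo 0 x, a t ^ 2 * ENNReal.ofReal (t ^ (1 / 2 : ℝ)) := by
    refine setLIntegral_congr_fun measurableSet_Ioo fun t ht => ?_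
    rw [mul_pow, ← ENNReal.ofReal_pow (Real.rpow_nonneg ht.1.le _), ← Real.rpow_natCast,
      ← Real.rpow_mul ht.1.le]
    norm_num
  have e3 : ∫⁻ t in Set.Ioo 0 x, ENNReal.ofReal (t ^ (-(1 / 4) : ℝ)) ^ 2 =
      ENNReal.ofReal (2 * x ^ (1 / 2 : ℝ)) := by
    rw [← lintegral_Ioo_rpow hx]
    refine setLIntegral_congr_fun measurableSet_Ioo fun t ht => ?_
    rw [← ENNReal.ofReal_pow (Real.rpow_nonneg ht.1.le _), ← Real.rpow_natCast,
      ← Real.rpow_mul ht.1.le]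
    norm_num
  rwa [e1, e2, e3] at h

theorem measurable_primitive {a : ℝ → ℝ≥0∞} (ha : Measurable a) : Measurable (primitive a) := by
  have h : Measurable fun z : ℝ × ℝ => (Set.Ioo 0 z.1).indicator a z.2 := by
    have hs : MeasurableSet {z : ℝ × ℝ | 0 < z.2 ∧ z.2 < z.1} :=
      (measurableSet_lt measurable_const measurable_snd).inter
        (measurableSet_lt measurable_snd measurable_fst)
    exact (ha.comp measurable_snd).indicator hs
  have e : primitive a = fun x => ∫⁻ t, (Set.Ioo 0 x).indicator a t :=
    funext fun x => (lintegral_indicator measurableSet_Ioo _).symm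
  rw [e]
  exact h.lintegral_prod_right'

/-- Hardy's inequality with its sharp constant. -/
theorem lintegral_primitive_sq_le {a : ℝ → ℝ≥0∞} (ha : Measurable a) :
    ∫⁻ x in Set.Ioi 0, primitive a x ^ 2 * ENNReal.ofReal (x ^ (-2 : ℝ)) ≤
      4 * ∫⁻ t in Set.Ioi 0, a t ^ 2 := by
  set F : ℝ → ℝ≥0∞ := fun t => a t ^ 2 * ENNReal.ofReal (t ^ (1 / 2 : ℝ)) with hF
  set k : ℝ → ℝ≥0∞ := fun x => ENNReal.ofReal (2 * x ^ (-(3 / 2) : ℝ)) with hk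
  have hFm : Measurable F := by fun_prop
  have hkm : Measurable k := by fun_prop
  have hs : MeasurableSet {z : ℝ × ℝ | z.2 < z.1} := measurableSet_lt measurable_snd measurable_fst
  calc ∫⁻ x in Set.Ioi 0, primitive a x ^ 2 * ENNReal.ofReal (x ^ (-2 : ℝ))
      ≤ ∫⁻ x in Set.Ioi 0, ∫⁻ t in Set.Ioi 0, {z : ℝ × ℝ | z.2 < z.1}.indicator
          (fun z => k z.1 * F z.2) (x, t) := by
        refine setLIntegral_mono' measurableSet_Ioi fun x hx => ?_
        have hx' : 0 < x := hx
        refine (mul_le_mul_left (primitive_sq_le ha hx') _).trans_eq ?_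
        rw [mul_assoc, ← ENNReal.ofReal_mul (by positivity), mul_assoc, ← Real.rpow_add hx',
          mul_comm, show (1 / 2 + -2 : ℝ) = -(3 / 2) by norm_num, ← lintegral_const_mul _ hFm,
          ← lintegral_indicator measurableSet_Ioo, ← lintegral_indicator measurableSet_Ioi]
        refine lintegral_congr fun t => ?_
        simp only [Set.indicator_apply, Set.mem_Ioo, Set.mem_Ioi, Set.mem_ofPred_eq]
        by_cases h1 : 0 < t <;> by_cases h2 : t < x <;> simp [h1, h2, hk, hF]
    _ = ∫⁻ t in Set.Ioi 0, ∫⁻ x in Set.Ioi 0, {z : ℝ × ℝ | z.2 < z.1}.indicator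
          (fun z => k z.1 * F z.2) (x, t) := by
        refine lintegral_lintegral_swap (Measurable.aemeasurable ?_)
        exact ((hkm.comp measurable_fst).mul (hFm.comp measurable_snd)).indicator hs
    _ = ∫⁻ t in Set.Ioi 0, 4 * a t ^ 2 := by
        refine setLIntegral_congr_fun measurableSet_Ioi fun t ht => ?_
        have ht' : 0 < t := ht
        have e : ∫⁻ x in Set.Ioi 0, {z : ℝ × ℝ | z.2 < z.1}.indicator (fun z => k z.1 * F z.2) (x, t)
            = ∫⁻ x in Set.Ioi t, k x * F t := by
          rw [← lintegral_indicator measurableSet_Ioi, ← lintegral_indicator measurableSet_Ioi]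
          refine lintegral_congr fun x => ?_
          simp only [Set.indicator_apply, Set.mem_Ioi, Set.mem_ofPred_eq]
          by_cases h2 : t < x
          · simp [h2, ht'.trans h2]
          · simp [h2]
        rw [e, lintegral_mul_const _ hkm, lintegral_Ioi_rpow ht', hF, mul_left_comm, mul_comm,
          ← ENNReal.ofReal_mul (by positivity), mul_assoc, ← Real.rpow_add ht']
        norm_num
    _ = 4 * ∫⁻ t in Set.Ioi 0, a t ^ 2 := lintegral_const_mul _ (ha.pow_const 2)

/-! ### Boundedness of `C₊ q̄ R₀(iM) g` -/

theorem lintegral_enorm_sq (f : L2) : ∫⁻ x, ‖f x‖ₑ ^ 2 = ENNReal.ofReal (‖f‖ ^ 2) := by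
  rw [norm_sq_L2, ofReal_integral_eq_lintegral_ofReal (integrable_norm_sq_L2 f)
    (ae_of_all _ fun _ => by positivity)]
  refine lintegral_congr fun x => ?_
  rw [ENNReal.ofReal_pow (norm_nonneg _), ofReal_norm]

/-- The square of the norm of `g ↦ C₊ q̄ R₀(iM) g`, from `L²` to functions with integrable Fourier
transform, is bounded by this quantity. -/
def smoothingConst (q : L2) (M : ℝ) : ℝ≥0∞ :=
  ∫⁻ x in Set.Ioi (0 : ℝ), primitive (fun t => ‖(𝓕 q : L2) t‖ₑ) x ^ 2 *
    ‖(((2 * Real.pi * x : ℝ) : ℂ) - I * M)⁻¹‖ₑ ^ 2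

theorem measurable_enorm_fourier (q : L2) : Measurable fun t => ‖(𝓕 q : L2) t‖ₑ :=
  (Lp.stronglyMeasurable (𝓕 q : L2)).measurable.enorm

theorem enorm_inv_sq_le {x : ℝ} (hx : 0 < x) (M : ℝ) :
    ‖(((2 * Real.pi * x : ℝ) : ℂ) - I * M)⁻¹‖ₑ ^ 2 ≤ ENNReal.ofReal (x ^ (-2 : ℝ)) := by
  have h1 : x ≤ ‖(((2 * Real.pi * x : ℝ) : ℂ) - I * M)‖ := by
    have h2 := Complex.abs_re_le_norm (((2 * Real.pi * x : ℝ) : ℂ) - I * M)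
    have h3 : (((2 * Real.pi * x : ℝ) : ℂ) - I * M).re = 2 * Real.pi * x := by simp
    rw [h3] at h2
    have h4 : x ≤ 2 * Real.pi * x := by nlinarith [Real.pi_gt_three]
    exact h4.trans ((le_abs_self _).trans h2)
  rw [← ofReal_norm, ← ENNReal.ofReal_pow (norm_nonneg _)]
  refine ENNReal.ofReal_le_ofReal ?_
  rw [norm_inv, Real.rpow_neg hx.le, Real.rpow_two, inv_pow]
  gcongr

theorem smoothingConst_bound_ne_top (q : L2) :
    ∫⁻ x in Set.Ioi (0 : ℝ), primitive (fun t => ‖(𝓕 q : L2) t‖ₑ) x ^ 2 *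
      ENNReal.ofReal (x ^ (-2 : ℝ)) ≠ ⊤ := by
  refine ((lintegral_primitive_sq_le (measurable_enorm_fourier q)).trans_lt ?_).ne
  refine ENNReal.mul_lt_top (by simp) ((setLIntegral_le_lintegral _ _).trans_lt ?_)
  rw [lintegral_enorm_sq]
  exact ENNReal.ofReal_lt_top

theorem smoothingConst_ne_top (q : L2) (M : ℝ) : smoothingConst q M ≠ ⊤ := by
  refine ((setLIntegral_mono' measurableSet_Ioi fun x hx => ?_).trans_lt
    (smoothingConst_bound_ne_top q).lt_top).ne
  exact mul_le_mul_right (enorm_inv_sq_le hx M) _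

/-- The bound tends to zero as `M → ∞`, by dominated convergence with the majorant from Hardy's
inequality. -/
theorem tendsto_smoothingConst (q : L2) :
    Tendsto (fun n : ℕ => smoothingConst q n) atTop (𝓝 0) := by
  have hlim : ∀ x ∈ Set.Ioi (0 : ℝ), Tendsto (fun n : ℕ =>
      primitive (fun t => ‖(𝓕 q : L2) t‖ₑ) x ^ 2 *
        ‖(((2 * Real.pi * x : ℝ) : ℂ) - I * (n : ℝ))⁻¹‖ₑ ^ 2) atTop (𝓝 0) := by
    intro x hx
    have hfin : primitive (fun t => ‖(𝓕 q : L2) t‖ₑ) x ^ 2 ≠ ⊤ := by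
      refine ((primitive_sq_le (measurable_enorm_fourier q) hx).trans_lt
        (ENNReal.mul_lt_top ?_ ENNReal.ofReal_lt_top)).ne
      have h1 : ∫⁻ t in Set.Ioo 0 x, ‖(𝓕 q : L2) t‖ₑ ^ 2 * ENNReal.ofReal (t ^ (1 / 2 : ℝ)) ≤
          ∫⁻ t in Set.Ioo 0 x, ‖(𝓕 q : L2) t‖ₑ ^ 2 * ENNReal.ofReal (x ^ (1 / 2 : ℝ)) := by
        refine setLIntegral_mono' measurableSet_Ioo fun t ht => ?_
        gcongr
        · exact ht.1.le
        · exact ht.2.le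
      refine h1.trans_lt ?_
      rw [lintegral_mul_const _ ((measurable_enorm_fourier q).pow_const 2)]
      refine ENNReal.mul_lt_top ((setLIntegral_le_lintegral _ _).trans_lt ?_) ENNReal.ofReal_lt_top
      rw [lintegral_enorm_sq]
      exact ENNReal.ofReal_lt_top
    have h2 : Tendsto (fun n : ℕ => (((2 * Real.pi * x : ℝ) : ℂ) - I * (n : ℝ))⁻¹) atTop
        (𝓝 0) := by
      refine squeeze_zero_norm' ?_ tendsto_inv_atTop_nhds_zero_nat
      filter_upwards [eventually_gt_atTop 0] with n hn
      have h3 := Complex.abs_im_le_norm (((2 * Real.pi * x : ℝ) : ℂ) - I * (n : ℝ))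
      have h4 : (((2 * Real.pi * x : ℝ) : ℂ) - I * (n : ℝ)).im = -n := by simp
      rw [h4, abs_neg, Nat.abs_cast] at h3
      have hn' : (0 : ℝ) < n := by exact_mod_cast hn
      rw [norm_inv]
      gcongr
    have h5 := (ENNReal.continuous_pow 2).continuousAt.tendsto.comp h2.enorm
    have h6 := ENNReal.Tendsto.const_mul h5 (Or.inr hfin)
    simpa using h6
  have h := tendsto_lintegral_filter_of_dominated_convergence
    (μ := volume.restrict (Set.Ioi (0 : ℝ))) (l := (atTop : Filter ℕ))
    (F := fun (n : ℕ) x => primitive (fun t => ‖(𝓕 q : L2) t‖ₑ) x ^ 2 *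
      ‖(((2 * Real.pi * x : ℝ) : ℂ) - I * (n : ℝ))⁻¹‖ₑ ^ 2) (f := fun _ => 0)
    (fun x => primitive (fun t => ‖(𝓕 q : L2) t‖ₑ) x ^ 2 * ENNReal.ofReal (x ^ (-2 : ℝ)))
    (Eventually.of_forall fun n =>
      ((measurable_primitive (measurable_enorm_fourier q)).pow_const 2).mul
        ((Measurable.enorm (by fun_prop)).pow_const 2))
    (Eventually.of_forall fun n => by
      filter_upwards [ae_restrict_mem measurableSet_Ioi] with x hx
      exact mul_le_mul_right (enorm_inv_sq_le hx _) _)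
    (smoothingConst_bound_ne_top q)
    (by
      filter_upwards [ae_restrict_mem measurableSet_Ioi] with x hx
      exact hlim x hx)
  rw [lintegral_zero] at h
  exact h

/-- The Fourier transform of `q̄ b` is a correlation of those of `q` and `b`. -/
theorem enorm_fourier_conj_mul_le {q b u : L2} (hu : u =ᵐ[volume] fun x => conj (q x) * b x) :
    ∀ᵐ ξ, ‖(𝓕 u : L2) ξ‖ₑ ≤ ∫⁻ η, ‖(𝓕 b : L2) η‖ₑ * ‖(𝓕 q : L2) (η - ξ)‖ₑ := by
  have hui : Integrable u :=
    (integrable_mul_L2 (Lp.memLp q).star (Lp.memLp b)).congr hu.symm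
  filter_upwards [fourier_L2_ae_eq hui] with ξ h1
  have h2 : 𝓕 (u : ℝ → ℂ) ξ = 𝓕 (fun x => b x * (star q : L2) x) ξ := by
    rw [fourier_eq_angularFourier, fourier_eq_angularFourier]
    refine angularFourier_congr ?_ _
    filter_upwards [hu, coeFn_star q] with x h3 h4
    rw [h3, h4, mul_comm]
  rw [h1, h2, fourier_mul_L2]
  refine (enorm_integral_le_lintegral_enorm _).trans_eq (lintegral_congr_ae ?_)
  have h5 := (Measure.measurePreserving_sub_left volume ξ).quasiMeasurePreserving.ae
    (fourier_star q)
  filter_upwards [h5] with η h6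
  rw [h6, enorm_mul, neg_sub, ← ofReal_norm (conj _), norm_conj, ofReal_norm]

/-- Fubini in the correlation of the Fourier transforms: the frequency `η` of `b` is paired with the
frequencies of `q` in `(0, η)` only, as both `q` and `C₊ u` have no negative ones. -/
theorem lintegral_fourier_szego_conj_mul_le {q : L2} (hq : q ∈ hardy) {b u : L2}
    (hu : u =ᵐ[volume] fun x => conj (q x) * b x) :
    ∫⁻ ξ, ‖(𝓕 (szego u : L2) : L2) ξ‖ₑ ≤
      ∫⁻ η in Set.Ioi 0, ‖(𝓕 b : L2) η‖ₑ * primitive (fun t => ‖(𝓕 q : L2) t‖ₑ) η := by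
  have ha := measurable_enorm_fourier q
  have hb := measurable_enorm_fourier b
  calc ∫⁻ ξ, ‖(𝓕 (szego u : L2) : L2) ξ‖ₑ
      ≤ ∫⁻ ξ in Set.Ici 0, ∫⁻ η, ‖(𝓕 b : L2) η‖ₑ * ‖(𝓕 q : L2) (η - ξ)‖ₑ := by
        rw [← lintegral_indicator measurableSet_Ici]
        refine lintegral_mono_ae ?_
        filter_upwards [fourier_szego u, enorm_fourier_conj_mul_le hu] with ξ h1 h2
        rw [h1]
        by_cases h : ξ ∈ Set.Ici (0 : ℝ)
        · rw [Set.indicator_of_mem h, Set.indicator_of_mem h]; exact h2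
        · rw [Set.indicator_of_notMem h, enorm_zero]; exact zero_le
    _ = ∫⁻ η, ∫⁻ ξ in Set.Ici 0, ‖(𝓕 b : L2) η‖ₑ * ‖(𝓕 q : L2) (η - ξ)‖ₑ := by
        refine lintegral_lintegral_swap (Measurable.aemeasurable ?_)
        exact (hb.comp measurable_snd).mul (ha.comp (measurable_snd.sub measurable_fst))
    _ = ∫⁻ η, (Set.Ioi 0).indicator
          (fun η => ‖(𝓕 b : L2) η‖ₑ * primitive (fun t => ‖(𝓕 q : L2) t‖ₑ) η) η := by
        refine lintegral_congr fun η => ?_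
        have hm : Measurable fun ξ => ‖(𝓕 q : L2) (η - ξ)‖ₑ :=
          ha.comp (measurable_const.sub measurable_id)
        rw [lintegral_const_mul _ hm]
        have h1 : ∫⁻ ξ in Set.Ici 0, ‖(𝓕 q : L2) (η - ξ)‖ₑ =
            ∫⁻ t, (Set.Ioo 0 η).indicator (fun t => ‖(𝓕 q : L2) t‖ₑ) t := by
          rw [← lintegral_indicator measurableSet_Ici, ← lintegral_sub_left_eq_self _ η]
          refine lintegral_congr_ae ?_
          filter_upwards [(mem_hardy_iff q).1 hq, compl_mem_ae_iff.2 (measure_singleton 0),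
            compl_mem_ae_iff.2 (measure_singleton η)] with t h1 h2 h3
          have h2' : t ≠ 0 := h2
          have h3' : t ≠ η := h3
          simp only [Set.indicator_apply, Set.mem_Ici, Set.mem_Ioo, sub_sub_cancel, sub_nonneg]
          rcases lt_or_gt_of_ne h2' with h4 | h4
          · simp [h1 h4]
          · by_cases h5 : t ≤ η
            · simp [h4, h5, lt_of_le_of_ne h5 h3']
            · rw [if_neg h5, if_neg fun h => h5 h.2.le]
        rw [h1, lintegral_indicator measurableSet_Ioo]
        by_cases h : η ∈ Set.Ioi (0 : ℝ)
        · rw [Set.indicator_of_mem h]; rfl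
        · rw [Set.indicator_of_notMem h, Set.Ioo_eq_empty (fun h' => h h')]
          simp
    _ = _ := lintegral_indicator measurableSet_Ioi _

theorem lintegral_fourier_szego_sq_le {q : L2} (hq : q ∈ hardy) {M : ℝ} (hM : 0 < M) {g u : L2}
    (hg : Integrable g) (hu : u =ᵐ[volume] fun x => conj (q x) * resConv true (I * M) g x) :
    (∫⁻ ξ, ‖(𝓕 (szego u : L2) : L2) ξ‖ₑ) ^ 2 ≤
      smoothingConst q M * ENNReal.ofReal (‖g‖ ^ 2) := by
  have hk : I * (M : ℂ) ∈ halfPlane true := by simp [halfPlane, hM.le]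
  have hk0 : (I * (M : ℂ)).im ≠ 0 := by simp [hM.ne']
  obtain ⟨hb1, hbF⟩ := integrable_resConv_of_im hk hk0 hg
  have hb2 := memLp_two_of_integrable_of_top hb1 (memLp_top_resConv hk hg)
  have hbe := hb2.coeFn_toLp
  set b : L2 := hb2.toLp _ with hb
  have hub : u =ᵐ[volume] fun x => conj (q x) * b x := by
    filter_upwards [hu, hbe] with x h1 h2
    rw [h1, h2]
  have hFb : ∀ᵐ η, ‖(𝓕 b : L2) η‖ₑ =
      ‖(𝓕 g : L2) η‖ₑ * ‖(((2 * Real.pi * η : ℝ) : ℂ) - I * M)⁻¹‖ₑ := by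
    filter_upwards [fourier_L2_ae_eq (hb1.congr hbe.symm), fourier_L2_ae_eq hg] with η h1 h2
    rw [h1, h2, fourier_eq_angularFourier, fourier_eq_angularFourier, angularFourier_congr hbe,
      hbF, enorm_mul]
  have h1 := lintegral_fourier_szego_conj_mul_le hq hub
  have h2 : ∫⁻ η in Set.Ioi 0, ‖(𝓕 b : L2) η‖ₑ * primitive (fun t => ‖(𝓕 q : L2) t‖ₑ) η =
      ∫⁻ η in Set.Ioi 0, (primitive (fun t => ‖(𝓕 q : L2) t‖ₑ) η *
        ‖(((2 * Real.pi * η : ℝ) : ℂ) - I * M)⁻¹‖ₑ) * ‖(𝓕 g : L2) η‖ₑ := by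
    refine lintegral_congr_ae ?_
    filter_upwards [ae_restrict_of_ae hFb] with η h3
    rw [h3]; ring
  rw [h2] at h1
  refine (pow_le_pow_left' h1 2).trans ((lintegral_mul_sq_le ?_ ?_).trans ?_)
  · exact ((measurable_primitive (measurable_enorm_fourier q)).mul
      (Measurable.enorm (by fun_prop))).aemeasurable
  · exact (measurable_enorm_fourier g).aemeasurable
  · simp only [mul_pow]
    refine mul_le_mul_right ((setLIntegral_le_lintegral _ _).trans_eq ?_) _
    rw [lintegral_enorm_sq]
    have : ‖(𝓕 g : L2)‖ = ‖g‖ := (Lp.fourierTransformₗᵢ ℝ ℂ).norm_map g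
    rw [this]

/-- The operator `g ↦ C₊ q̄ R₀(iM) g` is bounded from `L²` to `L^∞`. -/
theorem ae_norm_szego_le {q : L2} (hq : q ∈ hardy) {M : ℝ} (hM : 0 < M) {g u : L2}
    (hg : Integrable g) (hu : u =ᵐ[volume] fun x => conj (q x) * resConv true (I * M) g x) :
    ∀ᵐ x, ‖(szego u : L2) x‖ ≤ Real.sqrt (smoothingConst q M).toReal * ‖g‖ := by
  have h1 := lintegral_fourier_szego_sq_le hq hM hg hu
  have htop : smoothingConst q M * ENNReal.ofReal (‖g‖ ^ 2) ≠ ⊤ :=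
    ENNReal.mul_ne_top (smoothingConst_ne_top q M) ENNReal.ofReal_ne_top
  have hfin : ∫⁻ ξ, ‖(𝓕 (szego u : L2) : L2) ξ‖ₑ ≠ ⊤ := fun h => by
    rw [h] at h1
    exact htop (top_le_iff.1 (le_trans (by simp) h1))
  have hint : Integrable (𝓕 (szego u : L2) : L2) := ⟨(Lp.memLp _).1, hfin.lt_top⟩
  filter_upwards [ae_norm_le_of_integrable_fourier hint] with x hx
  refine hx.trans ?_
  rw [integral_norm_eq_lintegral_enorm (Lp.memLp _).1]
  have h2 := ENNReal.toReal_mono htop h1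
  rw [ENNReal.toReal_pow, ENNReal.toReal_mul, ENNReal.toReal_ofReal (by positivity)] at h2
  have h3 := Real.sqrt_le_sqrt h2
  rwa [Real.sqrt_sq ENNReal.toReal_nonneg, Real.sqrt_mul ENNReal.toReal_nonneg,
    Real.sqrt_sq (norm_nonneg _)] at h3

/-! ### Boundedness of the kernel vectors -/

/-- The point `iM` of the cut plane, for `M > 0`. -/
def imagPoint (M : ℝ) (hM : 0 < M) : CutPlane := .off (I * M) (by simp [hM.ne'])

theorem side_imagPoint (M : ℝ) (hM : 0 < M) : (imagPoint M hM).side = true :=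
  (CutPlane.side_eq_true_iff _).2 (by
    change 0 ≤ (I * (M : ℂ)).im
    simp [hM.le])

theorem val_imagPoint (M : ℝ) (hM : 0 < M) : (imagPoint M hM).val = I * M := rfl

theorem tendsto_hsNormSq_imag (q : L2) :
    Tendsto (fun n : ℕ => hsNormSq q (resKer true (I * (n : ℝ)))) atTop (𝓝 0) := by
  refine tendsto_hsNormSq q (C := 1) (fun n => measurable_resKer _ _)
    (Eventually.of_forall fun n => norm_resKer_le (by simp [halfPlane])) fun x hx => ?_
  simp only [resKer, if_true]
  split_ifs with h
  · rw [tendsto_zero_iff_norm_tendsto_zero]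
    have h1 : Tendsto (fun n : ℕ => Real.exp (-((n : ℝ) * x))) atTop (𝓝 0) :=
      Real.tendsto_exp_atBot.comp (tendsto_neg_atTop_atBot.comp
        (tendsto_natCast_atTop_atTop.atTop_mul_const h))
    refine h1.congr fun n => ?_
    rw [norm_mul, norm_I, one_mul, norm_exp]
    congr 1
    simp
  · exact tendsto_const_nhds

/-- A fixed point of an affine contraction of `L²` that preserves a ball of `L^∞` lies in that
ball. -/
theorem ae_norm_le_of_fixedPoint {f f₁ : hardy} {T : hardy →L[ℂ] hardy} (hT : ‖T‖ ≤ 1 / 2)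
    (hf : f = f₁ + T f) {C : ℝ} (hC : 0 ≤ C)
    (hstep : ∀ h : hardy, (∀ᵐ x, ‖(h : L2) x‖ ≤ C) → ∀ᵐ x, ‖(f₁ + T h : L2) x‖ ≤ C) :
    ∀ᵐ x, ‖(f : L2) x‖ ≤ C := by
  set h : ℕ → hardy := fun n => (fun v => f₁ + T v)^[n] 0 with hh
  have hsucc : ∀ n, h (n + 1) = f₁ + T (h n) := fun n => by
    simp only [hh, Function.iterate_succ_apply']
  have hbd : ∀ n, ∀ᵐ x, ‖(h n : L2) x‖ ≤ C := by
    intro n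
    induction n with
    | zero =>
      filter_upwards [Lp.coeFn_zero ℂ 2 (volume : Measure ℝ)] with x hx
      have h0 : ((h 0 : hardy) : L2) = 0 := rfl
      rw [h0, hx]
      simpa using hC
    | succ n ih =>
      rw [hsucc]
      exact hstep _ ih
  have hdist : ∀ n, ‖h n - f‖ ≤ (1 / 2) ^ n * ‖f‖ := by
    intro n
    induction n with
    | zero =>
      have h0 : h 0 = 0 := rfl
      simp [h0]
    | succ n ih =>
      have e : h (n + 1) - f = T (h n - f) := by
        rw [hsucc, map_sub]
        nth_rw 1 [hf]
        abel
      rw [e, pow_succ']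
      calc ‖T (h n - f)‖ ≤ ‖T‖ * ‖h n - f‖ := T.le_opNorm _
        _ ≤ 1 / 2 * ((1 / 2) ^ n * ‖f‖) := by gcongr
        _ = _ := by ring
  have hlim : Tendsto (fun n => (h n : L2)) atTop (𝓝 (f : L2)) := by
    rw [tendsto_iff_norm_sub_tendsto_zero]
    have h1 : Tendsto (fun n : ℕ => (1 / 2 : ℝ) ^ n * ‖f‖) atTop (𝓝 0) := by
      simpa using (tendsto_pow_atTop_nhds_zero_of_lt_one (by norm_num : (0 : ℝ) ≤ 1 / 2)
        (by norm_num)).mul_const ‖f‖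
    exact squeeze_zero (fun _ => norm_nonneg _) hdist h1
  obtain ⟨ns, -, hns⟩ := (tendstoInMeasure_of_tendsto_Lp hlim).exists_seq_tendsto_ae
  filter_upwards [hns, ae_all_iff.2 hbd] with x h1 h2
  exact le_of_tendsto h1.norm (Eventually.of_forall fun n => h2 (ns n))

section Weighted

variable {s : ℝ} {q : L2} {lam : ℝ} {f : hardy}

/-- The bound state `φ = R₀(lam) q f` is also `R₀(k) (q f + (lam - k) φ)`. -/
theorem IsBound.boundFn_eq_resConv_add (h : IsBound q lam f) (hs : 1 / 2 < s)
    (hqs : MemWeighted s q) {k : ℂ} (hk : k ∈ halfPlane true) (x : ℝ) :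
    boundFn q lam f x =
      resConv true k (density q f) x + (lam - k) * resConv true k (boundFn q lam f) x := by
  have h1 := resolvent_identity hk lam (integrable_density q f) (h.integrable_moment hs hqs) x
  have h2 : resConv true k (density q f) x - boundFn q lam f x =
    (k - lam) * resConv true k (boundFn q lam f) x := h1
  linear_combination -h2

/-- The vector `f` solves an equation `f = f₁ + C₊ q̄ R₀(iM) q f` with bounded `f₁`, and for large
`M` the operator on the right is a contraction for both the `L²` and the `L^∞` norm. -/
theorem IsBound.exists_ae_norm_le (h : IsBound q lam f) (hq : q ∈ hardy) (hs : 1 / 2 < s)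
    (hqs : MemWeighted s q) : ∃ C, ∀ᵐ x, ‖(f : L2) x‖ ≤ C := by
  have hε : Tendsto (fun n : ℕ => Real.sqrt (smoothingConst q n).toReal * ‖q‖) atTop (𝓝 0) := by
    have h1 := ((ENNReal.tendsto_toReal ENNReal.zero_ne_top).comp
      (tendsto_smoothingConst q)).sqrt.mul_const ‖q‖
    simpa using h1
  have hκ := (tendsto_hsNormSq_imag q).sqrt
  rw [Real.sqrt_zero] at hκ
  -- `M = n` is chosen so large that both contraction constants are at most `1/2`.
  obtain ⟨n, ⟨hn1, hn2⟩, hn0⟩ := ((hε.eventually_le_const (by norm_num : (0 : ℝ) < 1 / 2)).and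
    (hκ.eventually_le_const (by norm_num : (0 : ℝ) < 1 / 2))).and (eventually_gt_atTop 0) |>.exists
  have hM : (0 : ℝ) < n := by exact_mod_cast hn0
  set p := imagPoint n hM with hp
  have hk : I * ((n : ℝ) : ℂ) ∈ halfPlane true := by simp [halfPlane]
  have hT : ‖sandwich q p‖ ≤ 1 / 2 := by
    refine (norm_sandwich_le q p).trans ?_
    rw [hp, side_imagPoint, val_imagPoint]
    exact hn2
  obtain ⟨u, hu, hf⟩ := h.exists_szego
  set v : L2 := mulQbar q (freeResolvent p (mulQ q (f : L2))) with hv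
  have hvx := coeFn_mulQbar_freeResolvent_mulQ q p f
  rw [hp, side_imagPoint, val_imagPoint] at hvx
  set G : L2 := (lam - I * ((n : ℝ) : ℂ)) • (h.memLp_boundFn hs hqs).toLp _ with hG
  have hGx : G =ᵐ[volume] fun x => (lam - I * ((n : ℝ) : ℂ)) * boundFn q lam f x := by
    filter_upwards [Lp.coeFn_smul (lam - I * ((n : ℝ) : ℂ)) ((h.memLp_boundFn hs hqs).toLp _),
      (h.memLp_boundFn hs hqs).coeFn_toLp] with x h1 h2
    rw [hG, h1, Pi.smul_apply, h2, smul_eq_mul]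
  have hGi : Integrable G := ((h.integrable_boundFn hs hqs).const_mul _).congr hGx.symm
  -- Here `u = q̄ φ` and `v = q̄ R₀(iM) q f`, whose difference is `q̄ R₀(iM)` applied to the
  -- square integrable function `(lam - iM) φ`.
  have huv : (u - v : L2) =ᵐ[volume] fun x => conj (q x) * resConv true (I * ((n : ℝ) : ℂ)) G x := by
    filter_upwards [Lp.coeFn_sub u v, hu, hvx] with x h1 h2 h3
    rw [h1, Pi.sub_apply, h2, hv, hp, h3, resConv_congr _ _ hGx, resConv_const_mul,
      h.boundFn_eq_resConv_add hs hqs hk x]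
    ring
  have hf₁ := ae_norm_szego_le hq hM hGi huv
  set f₁ : hardy := szego (u - v) with hf₁_def
  set C₁ := Real.sqrt (smoothingConst q n).toReal * ‖G‖ with hC₁
  have hC₁0 : 0 ≤ C₁ := by positivity
  have hfix : f = f₁ + sandwich q p f := by
    rw [hf₁_def, map_sub, hf, sandwich_apply, ← hv, sub_add_cancel]
  refine ⟨2 * C₁, ae_norm_le_of_fixedPoint hT hfix (by positivity) fun w hw => ?_⟩
  have hdm : AEStronglyMeasurable (density q w) := (integrable_density q w).1
  have hdle : ∀ᵐ x, ‖density q w x‖ ≤ 2 * C₁ * ‖q x‖ := by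
    filter_upwards [hw] with x hx
    rw [density, norm_mul, mul_comm]
    gcongr
  have hd2 : MemLp (density q w) 2 := MemLp.of_le_mul (Lp.memLp q) hdm hdle
  have hdx := hd2.coeFn_toLp
  have hdn : ‖hd2.toLp _‖ ≤ 2 * C₁ * ‖q‖ := by
    refine Lp.norm_le_mul_norm_of_ae_le_mul ?_
    filter_upwards [hdx, hdle] with x h1 h2
    rw [h1]; exact h2
  have hwx := coeFn_mulQbar_freeResolvent_mulQ q p w
  rw [hp, side_imagPoint, val_imagPoint, ← hp, resConv_congr _ _ hdx.symm] at hwx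
  have hTw := ae_norm_szego_le hq hM ((integrable_density q w).congr hdx.symm) hwx
  filter_upwards [hf₁, hTw, Lp.coeFn_add (f₁ : L2) (sandwich q p w : L2)] with x h1 h2 h3
  rw [h3, Pi.add_apply]
  refine (norm_add_le _ _).trans ?_
  have h4 : ‖(sandwich q p w : L2) x‖ ≤ C₁ := by
    refine h2.trans ?_
    calc Real.sqrt (smoothingConst q n).toReal * ‖hd2.toLp _‖
        ≤ Real.sqrt (smoothingConst q n).toReal * (2 * C₁ * ‖q‖) := by gcongr
      _ = 2 * C₁ * (Real.sqrt (smoothingConst q n).toReal * ‖q‖) := by ring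
      _ ≤ 2 * C₁ * (1 / 2) := by gcongr
      _ = C₁ := by ring
  linarith

end Weighted

/-! ### Eigenfunctions and kernel vectors -/

section Weighted

variable {s : ℝ} {q : L2} {lam lam₁ lam₂ : ℝ} {f f₁ f₂ φ φ₁ φ₂ : hardy}

/-- `φ ∈ L²₊` is the bound state `R₀(lam) q f` for the kernel vector `f = C₊ q̄ φ`. -/
def IsBoundState (q : L2) (lam : ℝ) (f φ : hardy) : Prop :=
  IsBound q lam f ∧ (φ : L2) =ᵐ[volume] boundFn q lam f

theorem IsBound.exists_isBoundState (h : IsBound q lam f) (hq : q ∈ hardy) (hs : 1 / 2 < s)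
    (hqs : MemWeighted s q) : ∃ φ, IsBoundState q lam f φ :=
  ⟨⟨_, h.toLp_mem_hardy hq hs hqs⟩, h, (h.memLp_boundFn hs hqs).coeFn_toLp⟩

/-- The function `f` is determined by `φ`. -/
theorem IsBoundState.szego_eq (h : IsBoundState q lam f φ) {u : L2}
    (hu : u =ᵐ[volume] fun x => conj (q x) * (φ : L2) x) : szego u = f := by
  obtain ⟨v, hv, hf⟩ := h.1.exists_szego
  rw [← hf]
  congr 1
  refine Lp.ext ?_
  filter_upwards [hu, hv, h.2] with x h1 h2 h3
  rw [h1, h2, h3]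

theorem IsBoundState.ne_zero (h : IsBoundState q lam f φ) (hf : f ≠ 0) : φ ≠ 0 := by
  rintro rfl
  refine hf ?_
  have h1 := h.szego_eq (u := 0) (by
    filter_upwards [Lp.coeFn_zero ℂ 2 (volume : Measure ℝ)] with x hx
    have : ((0 : hardy) : L2) = 0 := rfl
    rw [this, hx]; simp)
  rw [← h1, map_zero]

/-- The boundedness of `f` is needed for `q f ∈ L²`, hence for `φ ∈ H¹`. -/
theorem IsBoundState.isEigenfunction (h : IsBoundState q lam f φ) (hf : f ≠ 0) (hq : q ∈ hardy)
    (hs : 1 / 2 < s) (hqs : MemWeighted s q) : IsEigenfunction q lam φ := by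
  refine ⟨h.ne_zero hf, ?_⟩
  obtain ⟨C, hC⟩ := h.1.exists_ae_norm_le hq hs hqs
  have hd2 : MemLp (density q f) 2 := by
    refine MemLp.of_le_mul (c := C) (Lp.memLp q) (integrable_density q f).1 ?_
    filter_upwards [hC] with x hx
    rw [density, norm_mul, mul_comm]
    gcongr
  obtain ⟨u, hu, hfu⟩ := h.1.exists_szego
  have hm : MemLp (fun x => I * (lam * (φ : L2) x + density q f x)) 2 :=
    (((Lp.memLp (φ : L2)).const_mul (lam : ℂ)).add hd2).const_mul I
  refine ⟨hm.toLp _, u, fun χ h1 h2 => ?_, ?_, ?_⟩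
  · have h3 := integral_resConv_mul_deriv lam (integrable_density q f) h1 h2
    rw [integral_congr_ae (g := fun x => boundFn q lam f x * deriv χ x)
      (by filter_upwards [h.2] with x hx; rw [hx])]
    rw [show ∫ x, boundFn q lam f x * deriv χ x = _ from h3]
    congr 1
    refine integral_congr_ae ?_
    filter_upwards [hm.coeFn_toLp, h.2] with x h4 h5
    rw [h4, h5, boundFn]
  · filter_upwards [hu, h.2] with x h4 h5
    rw [h4, h5]
  · filter_upwards [hm.coeFn_toLp, Lp.coeFn_smul (lam : ℂ) (φ : L2)] with x h4 h5
    have h6 : (((lam : ℂ) • φ : hardy) : L2) = (lam : ℂ) • (φ : L2) := rfl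
    rw [h6, h5, h4, hfu, Pi.smul_apply, smul_eq_mul, density]
    linear_combination ((lam : ℂ) * (φ : L2) x + q x * (f : L2) x) * I_mul_I

/-- Eigenfunctions are bound states: square integrable weak solutions of `-iφ' - q f = lam φ` are
given by the free resolvent. -/
theorem IsEigenfunction.exists_isBoundState (h : IsEigenfunction q lam φ) :
    ∃ f, IsBoundState q lam f φ ∧ f ≠ 0 := by
  obtain ⟨h0, dφ, u, hw, hu, he⟩ := h
  have hd : ∀ᵐ x, dφ x = I * (lam * (φ : L2) x + density q (szego u) x) := by
    filter_upwards [he, Lp.coeFn_smul (lam : ℂ) (φ : L2)] with x h1 h2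
    have h3 : (((lam : ℂ) • φ : hardy) : L2) = (lam : ℂ) • (φ : L2) := rfl
    rw [h3, h2, Pi.smul_apply, smul_eq_mul] at h1
    rw [h1, density]
    linear_combination dφ x * I_mul_I
  obtain ⟨h1, h2⟩ := ae_eq_resConv_of_weak_solution lam (Lp.memLp (φ : L2))
    (integrable_density q (szego u)) (fun χ hχ hχ' => by
      rw [hw χ hχ hχ']
      congr 1
      refine integral_congr_ae ?_
      filter_upwards [hd] with x hx
      rw [hx])
  refine ⟨szego u, ⟨⟨h2, u, ?_, rfl⟩, h1⟩, fun hf => h0 ?_⟩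
  · filter_upwards [hu, h1] with x h3 h4
    rw [h3, h4, boundFn]
  · refine Subtype.ext (Lp.ext ?_)
    have hz : density q (szego u) =ᵐ[volume] fun _ => 0 := by
      filter_upwards [Lp.coeFn_zero ℂ 2 (volume : Measure ℝ)] with x hx
      have : ((0 : hardy) : L2) = 0 := rfl
      rw [density, hf, this, hx]; simp
    filter_upwards [h1, Lp.coeFn_zero ℂ 2 (volume : Measure ℝ)] with x h3 h4
    have h5 : ((0 : hardy) : L2) = 0 := rfl
    rw [h5, h4, h3, resConv_congr _ _ hz]
    simp [resConv]

theorem pairing_eq_inner (q φ : L2) : pairing q φ = inner ℂ φ q := (inner_L2_eq φ q).symm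

theorem IsBoundState.inner_eq_zero (h₁ : IsBoundState q lam₁ f₁ φ₁)
    (h₂ : IsBoundState q lam₂ f₂ φ₂) (hs : 1 / 2 < s) (hqs : MemWeighted s q)
    (hne : lam₁ ≠ lam₂) : inner ℂ (φ₂ : L2) φ₁ = 0 := by
  rw [inner_L2_eq, ← (h₁.1.integral_boundFn_mul_conj h₂.1 hs hqs).1 hne]
  refine integral_congr_ae ?_
  filter_upwards [h₁.2, h₂.2] with x h1 h2
  rw [h1, h2]

theorem IsBoundState.two_pi_mul_inner (h₁ : IsBoundState q lam f₁ φ₁)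
    (h₂ : IsBoundState q lam f₂ φ₂) (hs : 1 / 2 < s) (hqs : MemWeighted s q) :
    2 * Real.pi * inner ℂ (φ₂ : L2) φ₁ = inner ℂ q φ₁ * inner ℂ (φ₂ : L2) q := by
  have h := (h₁.1.integral_boundFn_mul_conj h₂.1 hs hqs).2 rfl
  have e : ∀ {f φ : hardy}, IsBoundState q lam f φ →
      pairing q (boundFn q lam f) = inner ℂ (φ : L2) q := by
    intro f φ h
    rw [inner_L2_eq]
    refine integral_congr_ae ?_
    filter_upwards [h.2] with x h1
    rw [h1]
  rw [e h₁, e h₂, inner_conj_symm] at h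
  rw [← h, inner_L2_eq]
  congr 1
  refine integral_congr_ae ?_
  filter_upwards [h₁.2, h₂.2] with x h1 h2
  rw [h1, h2]

theorem IsBoundState.two_pi_mul_norm_sq (h : IsBoundState q lam f φ) (hs : 1 / 2 < s)
    (hqs : MemWeighted s q) : 2 * Real.pi * ‖φ‖ ^ 2 = ‖(inner ℂ (φ : L2) q : ℂ)‖ ^ 2 := by
  have h1 := h.two_pi_mul_inner h hs hqs
  rw [inner_self_eq_norm_sq_to_K, ← inner_conj_symm q, conj_mul'] at h1
  have h2 : ((2 * Real.pi * ‖(φ : L2)‖ ^ 2 : ℝ) : ℂ) = ((‖(inner ℂ (φ : L2) q : ℂ)‖ ^ 2 : ℝ) : ℂ) := by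
    push_cast
    exact h1
  exact ofReal_injective h2

theorem IsBoundState.inner_ne_zero (h : IsBoundState q lam f φ) (hφ : φ ≠ 0) (hs : 1 / 2 < s)
    (hqs : MemWeighted s q) : inner ℂ (φ : L2) q ≠ 0 := by
  intro h0
  have h1 := h.two_pi_mul_norm_sq hs hqs
  rw [h0, norm_zero] at h1
  have h2 : 0 < ‖φ‖ := norm_pos_iff.2 hφ
  have h3 : 0 < 2 * Real.pi * ‖φ‖ ^ 2 := by positivity
  linarith [h1, h3]

/-- Eigenvalues are simple. -/
theorem IsBoundState.eq_smul (h₁ : IsBoundState q lam f₁ φ₁) (h₂ : IsBoundState q lam f₂ φ₂)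
    (hφ : φ₂ ≠ 0) (hs : 1 / 2 < s) (hqs : MemWeighted s q) :
    φ₁ = ((inner ℂ q φ₁ : ℂ) / inner ℂ q φ₂) • φ₂ := by
  set c : ℂ := inner ℂ q φ₁ / inner ℂ q φ₂ with hc
  have h0 : (inner ℂ q φ₂ : ℂ) ≠ 0 := by
    rw [← inner_conj_symm]
    exact (map_ne_zero _).2 (h₂.inner_ne_zero hφ hs hqs)
  have hcq : c * inner ℂ q φ₂ = inner ℂ q φ₁ := div_mul_cancel₀ _ h0
  have e11 := h₁.two_pi_mul_inner h₁ hs hqs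
  have e12 := h₁.two_pi_mul_inner h₂ hs hqs
  have e21 := h₂.two_pi_mul_inner h₁ hs hqs
  have e22 := h₂.two_pi_mul_inner h₂ hs hqs
  -- All scalar products are given by the pairings with `q`, hence `‖φ₁ - c φ₂‖² = 0`.
  have hz : inner ℂ ((φ₁ : L2) - c • (φ₂ : L2)) ((φ₁ : L2) - c • (φ₂ : L2)) = 0 := by
    have hpi : (2 * Real.pi : ℂ) ≠ 0 := by
      simp [Real.pi_ne_zero]
    refine mul_left_cancel₀ hpi ?_
    simp only [inner_sub_left, inner_sub_right, inner_smul_left, inner_smul_right]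
    linear_combination e11 - conj c * e12 - c * e21 + conj c * c * e22 -
      (inner ℂ (φ₁ : L2) q - conj c * inner ℂ (φ₂ : L2) q) * hcq
  have h3 := inner_self_eq_zero.1 hz
  exact Subtype.ext (sub_eq_zero.1 h3)

theorem IsBoundState.vector_eq_smul (h₁ : IsBoundState q lam f₁ φ₁)
    (h₂ : IsBoundState q lam f₂ φ₂) {c : ℂ} (h : φ₁ = c • φ₂) : f₁ = c • f₂ := by
  obtain ⟨u, hu, hf⟩ := h₂.1.exists_szego
  rw [← hf, ← map_smul]
  refine (h₁.szego_eq ?_).symm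
  have h3 : (φ₁ : L2) = c • (φ₂ : L2) := by rw [h]; rfl
  filter_upwards [Lp.coeFn_smul c u, Lp.coeFn_smul c (φ₂ : L2), hu, h₂.2] with x h4 h5 h6 h7
  rw [h4, h3, h5, Pi.smul_apply, Pi.smul_apply, h6, h7, smul_eq_mul, smul_eq_mul]
  ring

end Weighted

/-! ### The point spectrum -/

section Weighted

variable {s : ℝ} {q : L2} {lam : ℝ} {φ : hardy}

theorem IsEigenfunction.smul (h : IsEigenfunction q lam φ) {c : ℂ} (hc : c ≠ 0) :
    IsEigenfunction q lam (c • φ) := by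
  obtain ⟨h0, dφ, u, hw, hu, he⟩ := h
  have e : ∀ (c : ℂ) (φ : hardy), ((c • φ : hardy) : L2) = c • (φ : L2) := fun _ _ => rfl
  refine ⟨smul_ne_zero hc h0, c • dφ, c • u, fun χ h1 h2 => ?_, ?_, ?_⟩
  · have h3 := hw χ h1 h2
    have e1 : ∫ x, ((c • φ : hardy) : L2) x * deriv χ x = c * ∫ x, (φ : L2) x * deriv χ x := by
      rw [← integral_const_mul]
      refine integral_congr_ae ?_
      filter_upwards [Lp.coeFn_smul c (φ : L2)] with x hx
      rw [e, hx, Pi.smul_apply, smul_eq_mul, mul_assoc]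
    have e2 : ∫ x, (c • dφ : L2) x * χ x = c * ∫ x, dφ x * χ x := by
      rw [← integral_const_mul]
      refine integral_congr_ae ?_
      filter_upwards [Lp.coeFn_smul c dφ] with x hx
      rw [hx, Pi.smul_apply, smul_eq_mul, mul_assoc]
    rw [e1, e2, h3, mul_neg]
  · filter_upwards [Lp.coeFn_smul c (φ : L2), Lp.coeFn_smul c u, hu] with x h1 h2 h3
    rw [e, h1, h2, Pi.smul_apply, Pi.smul_apply, h3, smul_eq_mul, smul_eq_mul]
    ring
  · have e3 : (((lam : ℂ) • (c • φ) : hardy) : L2) = c • (((lam : ℂ) • φ : hardy) : L2) := by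
      rw [smul_comm]; rfl
    have e4 : ((szego (c • u) : hardy) : L2) = c • (szego u : L2) := by rw [map_smul]; rfl
    filter_upwards [he, Lp.coeFn_smul c (((lam : ℂ) • φ : hardy) : L2), Lp.coeFn_smul c dφ,
      Lp.coeFn_smul c (szego u : L2)] with x h1 h2 h3 h4
    rw [e3, h2, e4, h4, h3, Pi.smul_apply, Pi.smul_apply, Pi.smul_apply, h1]
    simp only [smul_eq_mul]
    ring

/-- By Bessel's inequality for the normalised eigenfunctions, whose scalar products with `q` all have
modulus `√(2π)`. -/
theorem finite_pointSpectrum (hs : 1 / 2 < s) (hqs : MemWeighted s q) :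
    (pointSpectrum q).Finite := by
  have hex : ∀ lam : pointSpectrum q, ∃ f φ, IsBoundState q lam f φ ∧ φ ≠ 0 := by
    rintro ⟨lam, φ, hφ⟩
    obtain ⟨f, hf, -⟩ := hφ.exists_isBoundState
    exact ⟨f, φ, hf, hφ.1⟩
  choose f φ hb h0 using hex
  have h0' : ∀ i, ‖(φ i : L2)‖ ≠ 0 := fun i => norm_ne_zero_iff.2 fun h => h0 i (Subtype.ext h)
  set e : pointSpectrum q → L2 := fun i => ((‖(φ i : L2)‖⁻¹ : ℝ) : ℂ) • (φ i : L2) with he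
  have hon : Orthonormal ℂ e := by
    refine ⟨fun i => ?_, fun i j hij => ?_⟩
    · rw [he, norm_smul, norm_real, norm_inv, norm_norm, inv_mul_cancel₀ (h0' i)]
    · simp only [he]
      rw [inner_smul_left, inner_smul_right,
        (hb j).inner_eq_zero (hb i) hs hqs fun h => hij (Subtype.ext h.symm)]
      simp
  have hsum := hon.inner_products_summable (x := q)
  have hconst : ∀ i, ‖(inner ℂ (e i) q : ℂ)‖ ^ 2 = 2 * Real.pi := by
    intro i
    have h1 := (hb i).two_pi_mul_norm_sq hs hqs
    simp only [he]
    rw [inner_smul_left, norm_mul, mul_pow, ← h1, norm_conj, norm_real, norm_inv, norm_norm]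
    have h2 : ‖φ i‖ ≠ 0 := h0' i
    have h3 : ‖(φ i : L2)‖ = ‖φ i‖ := rfl
    rw [h3]
    field_simp
  simp only [hconst] at hsum
  have hfin : Finite (pointSpectrum q) := .of_summable_const Real.two_pi_pos hsum
  exact Set.toFinite _

theorem existsUnique_eigenfunction (hs : 1 / 2 < s) (hqs : MemWeighted s q)
    (hlam : lam ∈ pointSpectrum q) :
    ∃! φ : hardy, IsEigenfunction q lam φ ∧ pairing q (φ : L2) = 2 * Real.pi * I := by
  obtain ⟨φ, hφ⟩ := hlam
  obtain ⟨f, hf, -⟩ := hφ.exists_isBoundState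
  have hne := hf.inner_ne_zero hφ.1 hs hqs
  have hpi : (2 * Real.pi * I : ℂ) ≠ 0 := by simp [Real.pi_ne_zero]
  -- The normalisation is conjugated since the pairing is antilinear in the second argument.
  set c : ℂ := conj (2 * Real.pi * I / inner ℂ (φ : L2) q) with hc
  have hc0 : c ≠ 0 := (map_ne_zero _).2 (div_ne_zero hpi hne)
  refine ⟨c • φ, ⟨hφ.smul hc0, ?_⟩, ?_⟩
  · rw [pairing_eq_inner]
    change inner ℂ (c • (φ : L2)) q = _
    rw [inner_smul_left, hc, conj_conj, div_mul_cancel₀ _ hne]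
  · rintro ψ ⟨hψ, hψ2⟩
    obtain ⟨g, hg, -⟩ := hψ.exists_isBoundState
    have h1 := hg.eq_smul hf hφ.1 hs hqs
    rw [h1]
    congr 1
    rw [pairing_eq_inner] at hψ2
    rw [hc, ← hψ2, map_div₀, inner_conj_symm, inner_conj_symm]

/-- Away from the eigenvalues the operator `1 - C₊ q̄ R₀(k) q C₊` is invertible. -/
theorem isUnit_one_sub_sandwich (hq : q ∈ hardy) (hs : 1 / 2 < s) (hqs : MemWeighted s q)
    {p : CutPlane} (hp : p ∉ CutPlane.diamond (pointSpectrum q)) : IsUnit (1 - sandwich q p) := by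
  refine isUnit_one_sub_of_injective (isCompactOperator_sandwich q p) fun v hv => ?_
  by_cases him : p.val.im = 0
  · by_contra hv0
    have h1 := isBound_of_sandwich_eq him hv
    obtain ⟨φ, hφ⟩ := h1.exists_isBoundState hq hs hqs
    exact hp ⟨p.side, p.val.re, ⟨φ, hφ.isEigenfunction hv0 hq hs hqs⟩,
      p.eq_bdry_of_im_eq_zero him⟩
  · exact eq_zero_of_sandwich_eq him hv

end Weighted

/-! ### Simple poles of inverses -/

section Pole

variable {H : Type*} [NormedAddCommGroup H] [InnerProductSpace ℂ H]

/-- The orthogonal projection onto the line spanned by `f`. -/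
def lineProj (f : H) : H →L[ℂ] H := (((‖f‖ ^ 2 : ℝ) : ℂ)⁻¹ • innerSL ℂ f).smulRight f

theorem lineProj_apply (f v : H) :
    lineProj f v = (((‖f‖ ^ 2 : ℝ) : ℂ)⁻¹ * inner ℂ f v) • f := rfl

theorem lineProj_self {f : H} (hf : f ≠ 0) : lineProj f f = f := by
  have h : ((‖f‖ ^ 2 : ℝ) : ℂ) ≠ 0 := by
    exact_mod_cast pow_ne_zero 2 (norm_ne_zero_iff.2 hf)
  rw [lineProj_apply, inner_self_eq_norm_sq_to_K]
  have h2 : ((‖f‖ : ℂ) ^ 2) = ((‖f‖ ^ 2 : ℝ) : ℂ) := by push_cast; rfl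
  erw [h2]
  rw [inv_mul_cancel₀ h, one_smul]

theorem tendsto_inverse_apply [CompleteSpace H] {ι : Type*} {l : Filter ι} {A : ι → H →L[ℂ] H}
    {A₀ : H →L[ℂ] H} (hA₀ : IsUnit A₀) (hA : Tendsto A l (𝓝 A₀)) {v : ι → H} {v₀ : H}
    (hv : Tendsto v l (𝓝 v₀)) :
    Tendsto (fun i => Ring.inverse (A i) (v i)) l (𝓝 (Ring.inverse A₀ v₀)) := by
  have h : Tendsto (fun i => Ring.inverse (A i)) l (𝓝 (Ring.inverse A₀)) := by
    obtain ⟨x, hx⟩ := hA₀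
    rw [← hx]
    rw [← hx] at hA
    exact (NormedRing.inverse_continuousAt x).tendsto.comp hA
  exact (isBoundedBilinearMap_apply.continuous.tendsto (Ring.inverse A₀, v₀)).comp
    (h.prodMk_nhds hv)

/-- Let `K i` tend to an operator whose eigenspace for the eigenvalue one is spanned by `f`, the
eigenvalue being moved at the rate given by `z i → 0`. Then the solution of `u - K i u = w i` has
a simple pole in `z i` with residue proportional to `f`, and the remainder converges. The remainder
tends to zero if the data of the problem do. -/
theorem exists_regular_part_of_pole [CompleteSpace H] {ι : Type*} {l : Filter ι}
    {K : ι → H →L[ℂ] H} {K₀ : H →L[ℂ] H} {f : H} (hf : f ≠ 0)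
    {z β η : ι → ℂ} {α D β₀ η₀ : ℂ} {b c w : ι → H} {b₀ c₀ w₀ : H}
    (hK : Tendsto K l (𝓝 K₀)) (hB : IsUnit (1 - K₀ + lineProj f))
    (hz : Tendsto z l (𝓝 0)) (hβ : Tendsto β l (𝓝 β₀)) (hη : Tendsto η l (𝓝 η₀))
    (hb : Tendsto b l (𝓝 b₀)) (hc : Tendsto c l (𝓝 c₀)) (hw : Tendsto w l (𝓝 w₀))
    (hD : D ≠ 0) (hKf : ∀ i, K i f = f + z i • c i)
    (hfK : ∀ i u, inner ℂ f (K i u) = inner ℂ f u + z i * inner ℂ (b i) u)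
    (hbf : ∀ i, inner ℂ (b i) f = D + z i * η i)
    (hfw : ∀ i, inner ℂ f (w i) = α + z i * β i) :
    ∃ (r : ι → H) (r₀ : H), Tendsto r l (𝓝 r₀) ∧
      (∀ᶠ i in l, z i ≠ 0 → ∀ u, u - K i u = w i → u = -(α / D / z i) • f + r i) ∧
      (α = 0 → β₀ = 0 → w₀ = 0 → r₀ = 0) := by
  set B : ι → H →L[ℂ] H := fun i => 1 - K i + lineProj f with hBdef
  have hBlim : Tendsto B l (𝓝 (1 - K₀ + lineProj f)) :=
    (tendsto_const_nhds.sub hK).add tendsto_const_nhds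
  set T : ι → H →L[ℂ] H := fun i => Ring.inverse (B i) with hT
  set T₀ : H →L[ℂ] H := Ring.inverse (1 - K₀ + lineProj f) with hT₀
  have hunit : ∀ᶠ i in l, IsUnit (B i) :=
    hBlim.eventually (Units.isOpen.mem_nhds hB)
  have happ : ∀ {v : ι → H} {v₀ : H}, Tendsto v l (𝓝 v₀) →
      Tendsto (fun i => T i (v i)) l (𝓝 (T₀ v₀)) := fun {v v₀} hv => tendsto_inverse_apply hB hBlim hv
  -- The coefficient of `u` along `f` will be `e i / z i = -(α + z i κ i) / (z i E i)`, where `E i → D`.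
  -- Its regular part is `t i`.
  set γ : ι → ℂ := fun i => η i + inner ℂ (b i) (T i (c i)) with hγ
  have hγlim : Tendsto γ l (𝓝 (η₀ + inner ℂ b₀ (T₀ c₀))) := hη.add (hb.inner (happ hc))
  set E : ι → ℂ := fun i => D + z i * γ i with hE
  have hElim : Tendsto E l (𝓝 D) := by
    simpa using (hz.mul hγlim).const_add D
  set κ : ι → ℂ := fun i => β i + inner ℂ (b i) (T i (w i)) with hκ
  have hκlim : Tendsto κ l (𝓝 (β₀ + inner ℂ b₀ (T₀ w₀))) := hβ.add (hb.inner (happ hw))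
  set e : ι → ℂ := fun i => -(α + z i * κ i) / E i with he
  have helim : Tendsto e l (𝓝 (-(α + 0 * (β₀ + inner ℂ b₀ (T₀ w₀))) / D)) :=
    ((hz.mul hκlim).const_add α).neg.div hElim hD
  set t : ι → ℂ := fun i => α * γ i / (D * E i) - κ i / E i with ht
  have htlim : Tendsto t l (𝓝 (α * (η₀ + inner ℂ b₀ (T₀ c₀)) / (D * D) -
      (β₀ + inner ℂ b₀ (T₀ w₀)) / D)) :=
    ((hγlim.const_mul α).div (hElim.const_mul D) (mul_ne_zero hD hD)).sub (hκlim.div hElim hD)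
  refine ⟨fun i => T i (w i) + e i • T i (c i) + t i • f, _,
    ((happ hw).add (helim.smul (happ hc))).add (htlim.smul_const f), ?_, ?_⟩
  · filter_upwards [hunit, hElim.eventually_ne hD] with i hi hEi hzi u hu
    have hTB : ∀ v, T i (B i v) = v := fun v => by
      have h := Ring.inverse_mul_cancel _ hi
      have h2 := congrArg (fun A : H →L[ℂ] H => A v) h
      exact h2
    -- The coefficient `a` of `u` along `f` carries the pole; pairing the equation with `f` determines it.
    set a : ℂ := ((‖f‖ ^ 2 : ℝ) : ℂ)⁻¹ * inner ℂ f u with ha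
    have hBu : B i u = w i + a • f := by
      rw [← hu]; rfl
    have hBf : B i f = f - z i • c i := by
      have : B i f = f - K i f + lineProj f f := rfl
      rw [this, lineProj_self hf, hKf]; abel
    have hTf : T i f = f + z i • T i (c i) := by
      have h := hTB f
      rw [hBf, map_sub, map_smul] at h
      rw [← sub_eq_iff_eq_add, h]
    have hu2 : u = T i (w i) + a • (f + z i • T i (c i)) := by
      rw [← hTf, ← map_smul, ← map_add, ← hBu, hTB]
    have h1 : inner ℂ (b i) u = inner ℂ (b i) (T i (w i)) + a * E i := by
      rw [hu2]
      simp only [inner_add_right, inner_smul_right, hbf, hE, hγ]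
      ring
    have h2 : α + z i * β i = -(z i * (inner ℂ (b i) (T i (w i)) + a * E i)) := by
      rw [← hfw, ← h1, ← hu, inner_sub_right, hfK]; ring
    have hae : a * z i = e i := by
      simp only [he, hκ]
      rw [eq_div_iff hEi]
      linear_combination h2
    have hat : a = -(α / D / z i) + t i := by
      have h3 : a = e i / z i := by rw [← hae, mul_div_cancel_right₀ _ hzi]
      rw [h3]
      simp only [he, ht]
      have h4 : E i = D + z i * γ i := rfl
      field_simp
      rw [h4]
      ring
    nth_rw 1 [hu2]
    rw [smul_add, smul_smul, hae]
    nth_rw 1 [hat]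
    rw [add_smul]
    abel
  · rintro rfl h2 h3
    simp [h2, h3]

end Pole

/-! ### The pole of the sandwiched resolvent at an eigenvalue -/

theorem isCompactOperator_lineProj (f : hardy) : IsCompactOperator (lineProj f) := by
  have h1 : IsCompactOperator (((‖f‖ ^ 2 : ℝ) : ℂ)⁻¹ • innerSL ℂ f) :=
    isCompactOperator_of_locallyCompactSpace_dom _
  exact h1.clm_comp ((1 : ℂ →L[ℂ] ℂ).smulRight f)

theorem inner_szego_mulQbar (q : L2) (U : LInf) (v : hardy) :
    inner ℂ (szego (mulQbar q U)) v = ∫ x, density q v x * conj (U x) := by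
  rw [Submodule.coe_inner, inner_szego_left _ v.2, inner_L2_eq]
  refine integral_congr_ae ?_
  filter_upwards [coeFn_mulQbar q U] with x hx
  rw [hx, density, map_mul, conj_conj]
  ring

theorem integral_resConv_mul_conj_conjPt (p : CutPlane) {g h : ℝ → ℂ} (hg : Integrable g)
    (hh : Integrable h) (hn : NegFreq h) :
    ∫ x, resConv p.side p.val g x * conj (h x) =
      ∫ x, g x * conj (resConv p.conjPt.side p.conjPt.val h x) := by
  have h1 : p.conjPt.side = (!p.side) ∨ (p.conjPt.val.im = 0 ∧ p.conjPt.val.re ≤ 0) := by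
    rcases p.side_conjPt with h | h
    · exact Or.inl h
    · rw [CutPlane.val_conjPt]
      exact Or.inr (by simpa using h)
  rw [integral_resConv_mul_conj p.val_mem_halfPlane hg hh, resConv_eq_of_negFreq hh hn h1,
    CutPlane.val_conjPt]

section Weighted

variable {s : ℝ} {q : L2} {lam : ℝ} {f φ : hardy}

theorem IsBoundState.integrable (h : IsBoundState q lam f φ) (hs : 1 / 2 < s)
    (hqs : MemWeighted s q) : Integrable (φ : L2) :=
  (h.1.integrable_boundFn hs hqs).congr h.2.symm

/-- A bound state as an element of `L¹`. -/
def IsBoundState.toL1 (h : IsBoundState q lam f φ) (hs : 1 / 2 < s) (hqs : MemWeighted s q) : L1 :=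
  (memLp_one_iff_integrable.2 (h.integrable hs hqs)).toLp _

theorem IsBoundState.coeFn_toL1 (h : IsBoundState q lam f φ) (hs : 1 / 2 < s)
    (hqs : MemWeighted s q) : h.toL1 hs hqs =ᵐ[volume] boundFn q lam f :=
  (MemLp.coeFn_toLp _).trans h.2

theorem IsBoundState.negFreq_toL1 (h : IsBoundState q lam f φ) (hq : q ∈ hardy) (hs : 1 / 2 < s)
    (hqs : MemWeighted s q) : NegFreq (h.toL1 hs hqs) :=
  (h.1.negFreq_boundFn hq hs hqs).congr (h.coeFn_toL1 hs hqs).symm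

theorem IsBound.resConv_density (h : IsBound q lam f) (hs : 1 / 2 < s) (hqs : MemWeighted s q)
    (p : CutPlane) (x : ℝ) : resConv p.side p.val (density q f) x =
      boundFn q lam f x + (p.val - lam) * resConv p.side p.val (boundFn q lam f) x := by
  have h1 := resolvent_identity p.val_mem_halfPlane lam (integrable_density q f)
    (h.integrable_moment hs hqs) x
  have h2 : resConv p.side lam (density q f) = boundFn q lam f :=
    resConv_eq_of_angularFourier_eq_zero _ _ (integrable_density q f) h.fourier_eq_zero
  rw [h2] at h1
  linear_combination h1

theorem IsBoundState.coeFn_freeResolvent_toL1 (h : IsBoundState q lam f φ) (hs : 1 / 2 < s)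
    (hqs : MemWeighted s q) (p : CutPlane) :
    freeResolvent p (h.toL1 hs hqs) =ᵐ[volume] resConv p.side p.val (boundFn q lam f) := by
  rw [← resConv_congr _ _ (h.coeFn_toL1 hs hqs)]
  exact coeFn_freeResolvent p _

/-- `R₀(k) q f = φ + (k - lam) R₀(k) φ`. -/
theorem IsBoundState.freeResolvent_mulQ (h : IsBoundState q lam f φ) (hs : 1 / 2 < s)
    (hqs : MemWeighted s q) (p : CutPlane) :
    freeResolvent p (mulQ q (f : L2)) =ᵐ[volume] fun x =>
      (φ : L2) x + (p.val - lam) * freeResolvent p (h.toL1 hs hqs) x := by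
  filter_upwards [coeFn_freeResolvent p (mulQ q (f : L2)), h.coeFn_freeResolvent_toL1 hs hqs p,
    h.2] with x h1 h2 h3
  rw [h1, h2, h3, resConv_congr _ _ (coeFn_mulQ q f)]
  exact h.1.resConv_density hs hqs p x

theorem IsBoundState.sandwich_apply (h : IsBoundState q lam f φ) (hs : 1 / 2 < s)
    (hqs : MemWeighted s q) (p : CutPlane) :
    sandwich q p f =
      f + (p.val - lam : ℂ) • szego (mulQbar q (freeResolvent p (h.toL1 hs hqs))) := by
  obtain ⟨u, hu, hfu⟩ := h.1.exists_szego
  rw [CalogeroMoser.sandwich_apply, ← map_smul]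
  nth_rw 2 [← hfu]
  rw [← map_add]
  congr 1
  refine Lp.ext ?_
  filter_upwards [coeFn_mulQbar q (freeResolvent p (mulQ q (f : L2))),
    h.freeResolvent_mulQ hs hqs p, hu, h.2, coeFn_mulQbar q (freeResolvent p (h.toL1 hs hqs)),
    Lp.coeFn_add u ((p.val - lam : ℂ) • mulQbar q (freeResolvent p (h.toL1 hs hqs))),
    Lp.coeFn_smul (p.val - lam : ℂ) (mulQbar q (freeResolvent p (h.toL1 hs hqs)))]
    with x h1 h2 h3 h4 h5 h6 h7
  rw [h1, h2, h6, Pi.add_apply, h7, Pi.smul_apply, h5, h3, h4, smul_eq_mul]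
  ring

theorem integrable_mul_conj_of_top {g : ℝ → ℂ} (hg : Integrable g) {U : ℝ → ℂ} (hU : MemLp U ∞) :
    Integrable fun x => g x * conj (U x) :=
  hg.mul_of_top_left hU.star

/-- Pairing `R₀(k) g` with the density of a bound state. -/
theorem IsBoundState.integral_resConv_mul_conj_density (h : IsBoundState q lam f φ)
    (hq : q ∈ hardy) (hs : 1 / 2 < s) (hqs : MemWeighted s q) (p : CutPlane) {g : ℝ → ℂ}
    (hg : Integrable g) : ∫ x, resConv p.side p.val g x * conj (density q f x) =
      (∫ x, g x * conj (boundFn q lam f x)) +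
        (p.val - lam) * ∫ x, g x * conj (freeResolvent p.conjPt (h.toL1 hs hqs) x) := by
  have hi1 : Integrable fun x => g x * conj (boundFn q lam f x) :=
    integrable_mul_conj_of_top hg (memLp_top_resConv (ofReal_mem_halfPlane true lam)
      (integrable_density q f))
  have hi2 : Integrable fun x => g x * conj (freeResolvent p.conjPt (h.toL1 hs hqs) x) :=
    integrable_mul_conj_of_top hg (Lp.memLp _)
  rw [integral_resConv_mul_conj_conjPt p hg (integrable_density q f) (negFreq_density hq f),
    ← integral_const_mul, ← integral_add hi1 (hi2.const_mul _)]
  refine integral_congr_ae ?_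
  filter_upwards [h.coeFn_freeResolvent_toL1 hs hqs p.conjPt] with x h1
  rw [h1, h.1.resConv_density hs hqs, CutPlane.val_conjPt, map_add, map_mul, map_sub, conj_conj,
    conj_ofReal]
  ring

/-- The adjoint counterpart of `IsBoundState.sandwich_apply`. -/
theorem IsBoundState.inner_sandwich (h : IsBoundState q lam f φ) (hq : q ∈ hardy) (hs : 1 / 2 < s)
    (hqs : MemWeighted s q) (p : CutPlane) (v : hardy) :
    inner ℂ f (sandwich q p v) = inner ℂ f v + (p.val - lam) *
      inner ℂ (szego (mulQbar q (freeResolvent p.conjPt (h.toL1 hs hqs)))) v := by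
  obtain ⟨u, hu, hfu⟩ := h.1.exists_szego
  have h1 : inner ℂ f (sandwich q p v) =
      ∫ x, resConv p.side p.val (density q v) x * conj (density q f x) := by
    rw [Submodule.coe_inner, CalogeroMoser.sandwich_apply, inner_szego_right _ f.2, inner_L2_eq]
    refine integral_congr_ae ?_
    filter_upwards [coeFn_mulQbar_freeResolvent_mulQ q p v] with x hx
    have h3 : conj (density q f x) = conj (q x) * conj ((f : L2) x) := map_mul _ _ _
    rw [hx, h3]
    ring
  have h2 : inner ℂ f v = ∫ x, density q v x * conj (boundFn q lam f x) := by
    rw [← hfu, Submodule.coe_inner, inner_szego_left _ v.2, inner_L2_eq, hfu]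
    refine integral_congr_ae ?_
    filter_upwards [hu] with x hx
    rw [hx, density, map_mul, conj_conj]
    ring
  rw [h1, h2, inner_szego_mulQbar,
    h.integral_resConv_mul_conj_density hq hs hqs p (integrable_density q v)]

/-- The rate at which the eigenvalue one of `C₊ q̄ R₀(k) q C₊` moves with `k`, multiplied by `‖f‖²`. It does
not vanish at `lam`, where it equals `‖φ‖²`. -/
theorem IsBoundState.inner_conj_resolvent (h : IsBoundState q lam f φ) (hq : q ∈ hardy)
    (hs : 1 / 2 < s) (hqs : MemWeighted s q) (p : CutPlane) :
    inner ℂ (szego (mulQbar q (freeResolvent p.conjPt (h.toL1 hs hqs)))) f =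
      ((‖φ‖ ^ 2 : ℝ) : ℂ) +
        (p.val - lam) * pairing (freeResolvent p (h.toL1 hs hqs)) (h.toL1 hs hqs) := by
  have hφ := h.1.integrable_boundFn hs hqs
  have e1 : ∫ x, density q f x * conj (freeResolvent p.conjPt (h.toL1 hs hqs) x) =
      ∫ x, resConv p.side p.val (density q f) x * conj (boundFn q lam f x) := by
    rw [integral_resConv_mul_conj_conjPt p (integrable_density q f) hφ
      (h.1.negFreq_boundFn hq hs hqs)]
    refine integral_congr_ae ?_
    filter_upwards [h.coeFn_freeResolvent_toL1 hs hqs p.conjPt] with x h1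
    rw [h1]
  have e2 : ((‖φ‖ ^ 2 : ℝ) : ℂ) = ∫ x, boundFn q lam f x * conj (boundFn q lam f x) := by
    have h3 : ((‖φ‖ ^ 2 : ℝ) : ℂ) = inner ℂ (φ : L2) φ := by
      rw [inner_self_eq_norm_sq_to_K]; push_cast; rfl
    rw [h3, inner_L2_eq]
    refine integral_congr_ae ?_
    filter_upwards [h.2] with x h1
    rw [h1]
  have hi1 : Integrable fun x => boundFn q lam f x * conj (boundFn q lam f x) :=
    integrable_mul_conj_of_top hφ (memLp_top_resConv (ofReal_mem_halfPlane true lam)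
      (integrable_density q f))
  have hi2 := integrable_pairing (freeResolvent p (h.toL1 hs hqs)) (h.toL1 hs hqs)
  rw [inner_szego_mulQbar, e1, e2, pairing, ← integral_const_mul,
    ← integral_add hi1 (hi2.const_mul _)]
  refine integral_congr_ae ?_
  filter_upwards [h.coeFn_freeResolvent_toL1 hs hqs p, h.coeFn_toL1 hs hqs] with x h1 h2
  rw [h.1.resConv_density hs hqs, h1, h2]
  ring

/-- A vector in the kernel is orthogonal to `f`, by pairing with `f`, hence a kernel vector of
`1 - C₊ q̄ R₀(lam) q C₊`, hence a multiple of `f` since the eigenvalue is simple; being orthogonal to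
`f` it vanishes. -/
theorem IsBoundState.isUnit_one_sub_add_lineProj (h : IsBoundState q lam f φ) (hf : f ≠ 0)
    (hq : q ∈ hardy) (hs : 1 / 2 < s) (hqs : MemWeighted s q) {p : CutPlane} (hp : p.val = lam) :
    IsUnit (1 - sandwich q p + lineProj f) := by
  have hn : ((‖f‖ ^ 2 : ℝ) : ℂ) ≠ 0 := by
    exact_mod_cast pow_ne_zero 2 (norm_ne_zero_iff.2 hf)
  have hff : inner ℂ f f = ((‖f‖ ^ 2 : ℝ) : ℂ) := by
    refine (inner_self_eq_norm_sq_to_K (𝕜 := ℂ) f).trans ?_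
    push_cast
    rfl
  rw [show 1 - sandwich q p + lineProj f = 1 - (sandwich q p - lineProj f) by abel]
  refine isUnit_one_sub_of_injective
    ((isCompactOperator_sandwich q p).sub (isCompactOperator_lineProj f)) fun v hv => ?_
  have h1 : sandwich q p v - lineProj f v = v := hv
  -- Pairing with `f` removes `1 - C₊ q̄ R₀(lam) q C₊`.
  have h2 : inner ℂ f v = 0 := by
    have h3 := congrArg (inner ℂ f) h1
    rw [inner_sub_right, h.inner_sandwich hq hs hqs, hp, sub_self, zero_mul, add_zero,
      lineProj_apply, inner_smul_right, hff, mul_right_comm, inv_mul_cancel₀ hn, one_mul,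
      sub_self] at h3
    exact h3.symm
  rw [lineProj_apply, h2, mul_zero, zero_smul, sub_zero] at h1
  have him : p.val.im = 0 := by rw [hp, ofReal_im]
  have h3 := isBound_of_sandwich_eq him h1
  rw [hp, ofReal_re] at h3
  obtain ⟨ψ, hψ⟩ := h3.exists_isBoundState hq hs hqs
  have h4 := hψ.vector_eq_smul h (hψ.eq_smul h (h.ne_zero hf) hs hqs)
  rw [h4] at h2
  replace h2 := (inner_smul_right (𝕜 := ℂ) f f _).symm.trans h2
  rw [hff] at h2
  rw [h4, (mul_eq_zero.1 h2).resolve_right hn, zero_smul]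

/-- Solutions of `u - C₊ q̄ R₀(k) q C₊ u = w` near an eigenvalue. -/
theorem IsBoundState.exists_regular_part (h : IsBoundState q lam f φ) (hf : f ≠ 0)
    (hq : q ∈ hardy) (hs : 1 / 2 < s) (hqs : MemWeighted s q) {ι : Type*} {l : Filter ι}
    {P : ι → CutPlane} {p₀ : CutPlane} (hP : Tendsto P l (𝓝 p₀)) (hp₀ : p₀.val = lam)
    {w : ι → hardy} {w₀ : hardy} {β : ι → ℂ} {α β₀ : ℂ} (hw : Tendsto w l (𝓝 w₀))
    (hβ : Tendsto β l (𝓝 β₀)) (hfw : ∀ i, inner ℂ f (w i) = α + ((P i).val - lam) * β i) :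
    ∃ (r : ι → hardy) (r₀ : hardy), Tendsto r l (𝓝 r₀) ∧
      (∀ᶠ i in l, (P i).val - lam ≠ 0 → ∀ u, u - sandwich q (P i) u = w i →
        u = -(α / ((‖φ‖ ^ 2 : ℝ) : ℂ) / ((P i).val - lam)) • f + r i) ∧
      (α = 0 → β₀ = 0 → w₀ = 0 → r₀ = 0) := by
  have hn := h.negFreq_toL1 hq hs hqs
  have hcP : Tendsto (fun i => (P i).conjPt) l (𝓝 p₀.conjPt) :=
    (CutPlane.continuous_conjPt.tendsto p₀).comp hP
  have hc : ∀ {Q : ι → CutPlane} {p : CutPlane}, Tendsto Q l (𝓝 p) →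
      Tendsto (fun i => szego (mulQbar q (freeResolvent (Q i) (h.toL1 hs hqs)))) l
        (𝓝 (szego (mulQbar q (freeResolvent p (h.toL1 hs hqs))))) := fun {Q p} hQ =>
    (szego.continuous.tendsto _).comp ((tendsto_mulQbar_freeResolvent q hn p).comp hQ)
  have hz : Tendsto (fun i => (P i).val - (lam : ℂ)) l (𝓝 0) := by
    have h1 := ((CutPlane.continuous_val.tendsto p₀).comp hP).sub_const (lam : ℂ)
    rwa [hp₀, sub_self] at h1
  have hD : ((‖φ‖ ^ 2 : ℝ) : ℂ) ≠ 0 := by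
    exact_mod_cast pow_ne_zero 2 (norm_ne_zero_iff.2 (h.ne_zero hf))
  exact exists_regular_part_of_pole hf (((continuous_sandwich hq).tendsto p₀).comp hP)
    (h.isUnit_one_sub_add_lineProj hf hq hs hqs hp₀) hz hβ
    (tendsto_pairing_freeResolvent hP hn tendsto_const_nhds (h.toL1 hs hqs)) (hc hcP) (hc hP) hw hD
    (fun i => h.sandwich_apply hs hqs (P i)) (fun i u => h.inner_sandwich hq hs hqs (P i) u)
    (fun i => h.inner_conj_resolvent hq hs hqs (P i)) hfw

end Weighted

/-! ### Continuous extension across finitely many points -/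

theorem eventually_notMem_of_finite {X : Type*} [TopologicalSpace X] [T1Space X] {S : Set X}
    (hS : S.Finite) (x : X) : ∀ᶠ y in 𝓝[≠] x, y ∉ S := by
  have h1 : (S \ {x})ᶜ ∈ 𝓝 x :=
    (hS.subset Set.sdiff_subset).isClosed.isOpen_compl.mem_nhds fun h => h.2 rfl
  filter_upwards [nhdsWithin_le_nhds h1, self_mem_nhdsWithin] with y h2 h3 h4
  exact h2 ⟨h4, h3⟩

theorem continuous_of_tendsto_punctured {X Y : Type*} [TopologicalSpace X] [T1Space X]
    [TopologicalSpace Y] {S : Set X} (hS : S.Finite) {F L : X → Y} (hL : ∀ x ∉ S, L x = F x)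
    (h : ∀ x, Tendsto F (𝓝[≠] x) (𝓝 (L x))) : Continuous L := by
  refine continuous_iff_continuousAt.2 fun x => continuousAt_iff_punctured_nhds.2 ?_
  refine (h x).congr' ?_
  filter_upwards [eventually_notMem_of_finite hS x] with y hy
  exact (hL y hy).symm

theorem CutPlane.finite_diamond {E : Set ℝ} (hE : E.Finite) : (diamond E).Finite := by
  refine ((hE.image (bdry true)).union (hE.image (bdry false))).subset ?_
  rintro p ⟨up, lam, hlam, rfl⟩
  cases up
  · exact Or.inr ⟨lam, hlam, rfl⟩
  · exact Or.inl ⟨lam, hlam, rfl⟩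

theorem CutPlane.mem_diamond_of_val_eq {E : Set ℝ} {p : CutPlane} {lam : ℝ} (hlam : lam ∈ E)
    (h : p.val = lam) : p ∈ diamond E := by
  have h1 : p.val.im = 0 := by rw [h, ofReal_im]
  have h2 : p.val.re = lam := by rw [h, ofReal_re]
  exact ⟨p.side, lam, hlam, by rw [← h2]; exact p.eq_bdry_of_im_eq_zero h1⟩

theorem CutPlane.bdry_notMem_diamond {E : Set ℝ} {up : Bool} {lam : ℝ} (h : lam ∉ E) :
    bdry up lam ∉ diamond E := by
  rintro ⟨up', lam', hlam', he⟩
  have h1 := congrArg val he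
  rw [val_bdry, val_bdry] at h1
  have h2 : lam = lam' := by exact_mod_cast h1
  exact h (h2 ▸ hlam')

/-! ### The pairing of `L^∞` and `L¹` -/

/-- The pairing with an integrable function, as a linear functional. -/
def pairingLinear (f : L1) : LInf →ₗ[ℂ] ℂ where
  toFun u := pairing u f
  map_add' u v := pairing_add u v f
  map_smul' c u := pairing_smul c u f

theorem pairingLinear_apply (f : L1) (u : LInf) : pairingLinear f u = pairing u f := rfl

theorem LInf_eq_of_pairing_eq {u v : LInf} (h : ∀ f : L1, pairing u f = pairing v f) : u = v := by
  have hloc : ∀ w : LInf, LocallyIntegrable w := fun w =>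
    (Lp.memLp w).locallyIntegrable le_top
  refine Lp.ext (ae_eq_of_forall_test (hloc u) (hloc v) fun ψ h1 h2 => ?_)
  have hm := (test_memLp h1 h2 1).star
  have e : ∀ w : LInf, ∫ x, w x * ψ x = pairing w (hm.toLp _ : L1) := fun w => by
    refine integral_congr_ae ?_
    filter_upwards [hm.coeFn_toLp] with x hx
    rw [hx]
    simp
  rw [e, e, h]

/-! ### The singularities of the inhomogeneous Jost function -/

section Weighted

variable {s : ℝ} {q : L2} {lam : ℝ} {f φ : hardy}

theorem inner_szego_mulQbar_right (q : L2) (U : LInf) (f : hardy) :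
    inner ℂ f (szego (mulQbar q U)) = ∫ x, U x * conj (density q f x) := by
  rw [Submodule.coe_inner, inner_szego_right _ f.2, inner_L2_eq]
  refine integral_congr_ae ?_
  filter_upwards [coeFn_mulQbar q U] with x hx
  rw [hx, density, map_mul]
  ring

/-- A bound state as an element of `L^∞`. -/
def IsBoundState.toLInf (h : IsBoundState q lam f φ) : LInf :=
  ((memLp_congr_ae h.2).2 (memLp_top_resConv (ofReal_mem_halfPlane true lam)
    (integrable_density q f))).toLp _

theorem IsBoundState.coeFn_toLInf (h : IsBoundState q lam f φ) :
    h.toLInf =ᵐ[volume] (φ : L2) := MemLp.coeFn_toLp _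

theorem IsBoundState.freeResolvent_mulQ_eq (h : IsBoundState q lam f φ) (hs : 1 / 2 < s)
    (hqs : MemWeighted s q) (p : CutPlane) :
    freeResolvent p (mulQ q (f : L2)) =
      h.toLInf + (p.val - lam : ℂ) • freeResolvent p (h.toL1 hs hqs) := by
  refine Lp.ext ?_
  filter_upwards [h.freeResolvent_mulQ hs hqs p, h.coeFn_toLInf,
    Lp.coeFn_add h.toLInf ((p.val - lam : ℂ) • freeResolvent p (h.toL1 hs hqs)),
    Lp.coeFn_smul (p.val - lam : ℂ) (freeResolvent p (h.toL1 hs hqs))] with x h1 h2 h3 h4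
  rw [h1, h3, Pi.add_apply, h4, Pi.smul_apply, h2, smul_eq_mul]

/-- The vector `(1 - C₊ q̄ R₀(k) q C₊)⁻¹ C₊ q̄ R₀(k) q`. -/
def jostVector (q : L2) (hq1 : MemLp q 1 volume) (p : CutPlane) : hardy :=
  Ring.inverse (1 - sandwich q p) (szego (mulQbar q (freeResolvent p (hq1.toLp q))))

theorem jostInhom_eq (q : L2) (hq1 : MemLp q 1 volume) (p : CutPlane) :
    jostInhom q hq1 p =
      freeResolvent p (hq1.toLp q) + freeResolvent p (mulQ q (jostVector q hq1 p : L2)) := rfl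

theorem sub_sandwich_inverse {q : L2} {p : CutPlane} (h : IsUnit (1 - sandwich q p)) (w : hardy) :
    Ring.inverse (1 - sandwich q p) w - sandwich q p (Ring.inverse (1 - sandwich q p) w) = w :=
  congrArg (fun A : hardy →L[ℂ] hardy => A w) (Ring.mul_inverse_cancel _ h)

theorem negFreq_toLp_one {q : L2} (hq : q ∈ hardy) (hq1 : MemLp q 1 volume) :
    NegFreq (hq1.toLp q : L1) :=
  (negFreq_of_mem_hardy (memLp_one_iff_integrable.1 hq1) hq).congr hq1.coeFn_toLp.symm

theorem tendsto_szego_mulQbar_freeResolvent {q : L2} {G : L1} (hG : NegFreq G) (p₀ : CutPlane) :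
    Tendsto (fun p => szego (mulQbar q (freeResolvent p G))) (𝓝 p₀)
      (𝓝 (szego (mulQbar q (freeResolvent p₀ G)))) :=
  (szego.continuous.tendsto _).comp (tendsto_mulQbar_freeResolvent q hG p₀)

theorem tendsto_inverse_one_sub_sandwich (hq : q ∈ hardy) {p₀ : CutPlane}
    (h : IsUnit (1 - sandwich q p₀)) {ι : Type*} {l : Filter ι} {P : ι → CutPlane}
    (hP : Tendsto P l (𝓝 p₀)) {w : ι → hardy} {w₀ : hardy} (hw : Tendsto w l (𝓝 w₀)) :
    Tendsto (fun i => Ring.inverse (1 - sandwich q (P i)) (w i)) l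
      (𝓝 (Ring.inverse (1 - sandwich q p₀) w₀)) := by
  have h1 : Tendsto (fun i => 1 - sandwich q (P i)) l (𝓝 (1 - sandwich q p₀)) :=
    tendsto_const_nhds.sub (((continuous_sandwich hq).tendsto p₀).comp hP)
  exact tendsto_inverse_apply h h1 hw

theorem tendsto_pairing_freeResolvent_mulQ (hq : q ∈ hardy) {ι : Type*} {l : Filter ι}
    {P : ι → CutPlane} {p₀ : CutPlane} (hP : Tendsto P l (𝓝 p₀)) {r : ι → hardy} {r₀ : hardy}
    (hr : Tendsto r l (𝓝 r₀)) (g : L1) :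
    Tendsto (fun i => pairing (freeResolvent (P i) (mulQ q (r i : L2))) g) l
      (𝓝 (pairing (freeResolvent p₀ (mulQ q (r₀ : L2))) g)) := by
  refine tendsto_pairing_freeResolvent hP (negFreq_mulQ hq r₀) ?_ g
  exact ((mulQ q).continuous.tendsto _).comp ((continuous_subtype_val.tendsto r₀).comp hr)

theorem tendsto_pairing_jostInhom (hq : q ∈ hardy) (hq1 : MemLp q 1 volume) {p₀ : CutPlane}
    (h : IsUnit (1 - sandwich q p₀)) (g : L1) :
    Tendsto (fun p => pairing (jostInhom q hq1 p) g) (𝓝 p₀)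
      (𝓝 (pairing (jostInhom q hq1 p₀) g)) := by
  have hn := negFreq_toLp_one hq hq1
  have h1 : Tendsto (fun p => jostVector q hq1 p) (𝓝 p₀) (𝓝 (jostVector q hq1 p₀)) :=
    tendsto_inverse_one_sub_sandwich hq h tendsto_id (tendsto_szego_mulQbar_freeResolvent hn p₀)
  simp only [jostInhom_eq, pairing_add]
  exact (tendsto_pairing_freeResolvent tendsto_id hn tendsto_const_nhds g).add
    (tendsto_pairing_freeResolvent_mulQ hq tendsto_id h1 g)

/-- Near an eigenvalue the inhomogeneous Jost function is the sum of `-iφ/(k - lam)` and a function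
with a weak-star limit. -/
theorem IsBoundState.exists_limit_jostInhom_add (h : IsBoundState q lam f φ) (hf : f ≠ 0)
    (hq : q ∈ hardy) (hs : 1 / 2 < s) (hqs : MemWeighted s q)
    (hn : pairing q (φ : L2) = 2 * Real.pi * I) {p₀ : CutPlane} (hp₀ : p₀.val = lam)
    (hunit : ∀ᶠ p in 𝓝[≠] p₀, IsUnit (1 - sandwich q p) ∧ p.val - lam ≠ 0) :
    ∃ L : LInf, ∀ g : L1, Tendsto (fun p => pairing
      (jostInhom q (hqs.memLp_one hs) p + (I * (p.val - lam : ℂ)⁻¹) • h.toLInf : LInf) g)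
        (𝓝[≠] p₀) (𝓝 (pairing L g)) := by
  have hq1 := hqs.memLp_one hs
  set G : L1 := hq1.toLp q with hG
  have hGn : NegFreq G := negFreq_toLp_one hq hq1
  have hGx : G =ᵐ[volume] q := hq1.coeFn_toLp
  set φ₁ : L1 := h.toL1 hs hqs with hφ₁
  have hφn : NegFreq φ₁ := h.negFreq_toL1 hq hs hqs
  have hid : Tendsto (fun p : CutPlane => p) (𝓝[≠] p₀) (𝓝 p₀) := nhdsWithin_le_nhds
  have hβ : Tendsto (fun p : CutPlane => conj (pairing (freeResolvent p.conjPt φ₁) G)) (𝓝[≠] p₀)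
      (𝓝 (conj (pairing (freeResolvent p₀.conjPt φ₁) G))) :=
    (continuous_conj.tendsto _).comp (tendsto_pairing_freeResolvent
      ((CutPlane.continuous_conjPt.tendsto p₀).comp hid) hφn tendsto_const_nhds G)
  have hfw : ∀ p : CutPlane, inner ℂ f (szego (mulQbar q (freeResolvent p G))) =
      2 * Real.pi * I + (p.val - lam) * conj (pairing (freeResolvent p.conjPt φ₁) G) := by
    intro p
    have h1 := h.integral_resConv_mul_conj_density hq hs hqs p (L1.integrable_coeFn G)
    have h2 : ∫ x, G x * conj (boundFn q lam f x) = 2 * Real.pi * I := by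
      rw [← hn]
      refine integral_congr_ae ?_
      filter_upwards [hGx, h.2] with x h3 h4
      rw [h3, h4]
    have h3 : conj (pairing (freeResolvent p.conjPt φ₁) G) =
        ∫ x, G x * conj (freeResolvent p.conjPt φ₁ x) := by
      rw [pairing, ← integral_conj]
      refine integral_congr_ae (ae_of_all _ fun x => ?_)
      simp only [map_mul, conj_conj]
      ring
    rw [inner_szego_mulQbar_right, h3, ← h2, ← h1]
    refine integral_congr_ae ?_
    filter_upwards [coeFn_freeResolvent p G] with x hx
    rw [hx]
  obtain ⟨r, r₀, hr, hev, -⟩ := h.exists_regular_part hf hq hs hqs hid hp₀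
    ((tendsto_szego_mulQbar_freeResolvent hGn p₀).comp hid) hβ hfw
  -- The normalisation of `φ` makes the residue equal to `-i`.
  have hres : (2 * Real.pi * I) / ((‖φ‖ ^ 2 : ℝ) : ℂ) = I := by
    have h1 := h.two_pi_mul_norm_sq hs hqs
    rw [← pairing_eq_inner, hn] at h1
    have h2 : ‖(2 * Real.pi * I : ℂ)‖ = 2 * Real.pi := by
      simp [abs_of_pos Real.pi_pos]
    rw [h2, sq (2 * Real.pi)] at h1
    have h3 : ‖φ‖ ^ 2 = 2 * Real.pi := mul_left_cancel₀ Real.two_pi_pos.ne' h1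
    rw [h3]
    have h4 : ((2 * Real.pi : ℝ) : ℂ) ≠ 0 := by exact_mod_cast Real.two_pi_pos.ne'
    push_cast at h4 ⊢
    field_simp
  refine ⟨freeResolvent p₀ G + (-I) • freeResolvent p₀ φ₁ + freeResolvent p₀ (mulQ q (r₀ : L2)),
    fun g => ?_⟩
  have hlim := ((tendsto_pairing_freeResolvent hid hGn tendsto_const_nhds g).add
    ((tendsto_pairing_freeResolvent hid hφn tendsto_const_nhds g).const_mul (-I))).add
    (tendsto_pairing_freeResolvent_mulQ hq hid hr g)
  rw [pairing_add, pairing_add, pairing_smul]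
  refine hlim.congr' ?_
  filter_upwards [hunit, hev] with p hp hp2
  have hz := hp.2
  have hu := hp2 hz (jostVector q hq1 p) (sub_sandwich_inverse hp.1 _)
  rw [hres] at hu
  have hu' : (jostVector q hq1 p : L2) = -(I / (p.val - lam)) • (f : L2) + (r p : L2) := by
    rw [hu]; rfl
  rw [← pairing_smul, ← pairing_add, ← pairing_add, jostInhom_eq, hu', map_add, map_add, map_smul,
    map_smul, h.freeResolvent_mulQ_eq hs hqs p]
  refine congrArg (fun u : LInf => pairing u g) ?_
  rw [smul_add, smul_smul, neg_mul, div_mul_cancel₀ _ hz, div_eq_mul_inv]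
  module

end Weighted

/-! ### The regular part of the inhomogeneous Jost function -/

/-- The two edge points over `lam > 0` have disjoint neighbourhoods. -/
theorem CutPlane.eventually_val_ne (p₀ : CutPlane) : ∀ᶠ p in 𝓝[≠] p₀, p.val ≠ p₀.val := by
  filter_upwards [nhdsWithin_le_nhds (eventually_side p₀), self_mem_nhdsWithin] with p h1 h2 h3
  refine h2 ?_
  rw [Set.mem_singleton_iff]
  cases p with
  | off k hk =>
    cases p₀ with
    | off k₀ hk₀ =>
      have : k = k₀ := h3
      subst this
      rfl
    | edge up₀ lam₀ h₀ => exact absurd h3 (off_val_ne k hk h₀)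
  | edge up lam h =>
    cases p₀ with
    | off k₀ hk₀ => exact absurd h3.symm (off_val_ne k₀ hk₀ h)
    | edge up₀ lam₀ h₀ =>
      have h4 : lam = lam₀ := ofReal_injective h3
      subst h4
      have h5 : up = up₀ := by
        rcases h1.2 with h5 | h5
        · exact h5
        · exact absurd h (not_lt.2 h5.2)
      rw [h5]

theorem coeFn_sum_LInf {ι : Type*} (J : Finset ι) (c : ι → ℂ) (B : ι → LInf) :
    (∑ j ∈ J, c j • B j : LInf) =ᵐ[volume] fun x => ∑ j ∈ J, c j * B j x := by
  classical
  induction J using Finset.induction_on with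
  | empty =>
    filter_upwards [Lp.coeFn_zero ℂ ∞ (volume : Measure ℝ)] with x hx
    rw [Finset.sum_empty, hx]
    simp
  | insert a J ha ih =>
    filter_upwards [ih, Lp.coeFn_add (c a • B a) (∑ j ∈ J, c j • B j), Lp.coeFn_smul (c a) (B a)]
      with x h1 h2 h3
    rw [Finset.sum_insert ha, h2, Pi.add_apply, h1, h3, Finset.sum_insert ha]
    rfl

theorem tendsto_pairing_sum_poles {ι : Type*} (J : Finset ι) (lam : ι → ℝ) (B : ι → LInf)
    {p₀ : CutPlane} (hJ : ∀ j ∈ J, p₀.val ≠ lam j) (g : L1) :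
    Tendsto (fun p : CutPlane =>
        pairing (∑ j ∈ J, (I * (p.val - lam j : ℂ)⁻¹) • B j : LInf) g) (𝓝 p₀)
      (𝓝 (pairing (∑ j ∈ J, (I * (p₀.val - lam j : ℂ)⁻¹) • B j : LInf) g)) := by
  simp only [← pairingLinear_apply, map_sum, map_smul, smul_eq_mul]
  refine tendsto_finsetSum _ fun j hj => ?_
  exact (((((CutPlane.continuous_val.tendsto p₀).sub_const _).inv₀
    (sub_ne_zero.2 (hJ j hj))).const_mul I).mul_const _)

/-- The subtraction of its poles turns the inhomogeneous Jost function into a weak-star continuous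
function on the whole cut plane. -/
theorem existsUnique_regular_part_jostInhom {s : ℝ} (hs : 1 / 2 < s) {q : L2} (hq : q ∈ hardy)
    (hqs : MemWeighted s q) {N : ℕ} {lam : Fin N → ℝ} {φ : Fin N → hardy}
    (hinj : Function.Injective lam) (hrange : Set.range lam = pointSpectrum q)
    (hφ : ∀ j, IsEigenfunction q (lam j) (φ j))
    (hn : ∀ j, pairing q (φ j : L2) = 2 * Real.pi * I) :
    ∃! h : CutPlane → LInf,
      (∀ f : L1, Continuous fun k => pairing (h k) f) ∧
      ∀ k : CutPlane, k ∉ CutPlane.diamond (pointSpectrum q) →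
        ∀ᵐ x ∂(volume : Measure ℝ), jostInhom q (hqs.memLp_one hs) k x =
          -I * ∑ j, (φ j : L2) x / (k.val - (lam j : ℂ)) + h k x := by
  classical
  choose f hb hf0 using fun j => (hφ j).exists_isBoundState
  set S := CutPlane.diamond (pointSpectrum q) with hS
  have hSfin : S.Finite := CutPlane.finite_diamond (finite_pointSpectrum hs hqs)
  have hnotS : ∀ {p : CutPlane}, p ∉ S → ∀ j, p.val ≠ lam j := fun {p} hp j h =>
    hp (CutPlane.mem_diamond_of_val_eq (hrange ▸ Set.mem_range_self j) h)
  set F : CutPlane → LInf := fun p => jostInhom q (hqs.memLp_one hs) p +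
    ∑ j, (I * (p.val - lam j : ℂ)⁻¹) • (hb j).toLInf with hF
  have hFx : ∀ p : CutPlane, ∀ᵐ x, jostInhom q (hqs.memLp_one hs) p x =
      -I * ∑ j, (φ j : L2) x / (p.val - (lam j : ℂ)) + F p x := by
    intro p
    filter_upwards [Lp.coeFn_add (jostInhom q (hqs.memLp_one hs) p)
      (∑ j, (I * (p.val - lam j : ℂ)⁻¹) • (hb j).toLInf),
      coeFn_sum_LInf Finset.univ (fun j => I * (p.val - lam j : ℂ)⁻¹) (fun j => (hb j).toLInf),
      ae_all_iff.2 fun j => (hb j).coeFn_toLInf] with x h1 h2 h3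
    rw [hF, h1, Pi.add_apply, h2]
    have h4 : ∑ j, I * (p.val - lam j : ℂ)⁻¹ * (hb j).toLInf x =
        I * ∑ j, (φ j : L2) x / (p.val - (lam j : ℂ)) := by
      rw [Finset.mul_sum]
      refine Finset.sum_congr rfl fun j _ => ?_
      rw [h3 j, div_eq_mul_inv]
      ring
    rw [h4]
    ring
  have hlim : ∀ p₀ : CutPlane, ∃ L : LInf, (∀ g : L1, Tendsto (fun p => pairing (F p) g) (𝓝[≠] p₀)
      (𝓝 (pairing L g))) ∧ (p₀ ∉ S → L = F p₀) := by
    intro p₀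
    by_cases hp₀ : p₀ ∈ S
    · obtain ⟨up, mu, hmu, hpe⟩ := hp₀
      obtain ⟨j₀, rfl⟩ : mu ∈ Set.range lam := hrange ▸ hmu
      have hval : p₀.val = lam j₀ := by rw [hpe, CutPlane.val_bdry]
      obtain ⟨L, hL⟩ := (hb j₀).exists_limit_jostInhom_add (hf0 j₀) hq hs hqs (hn j₀) hval (by
        filter_upwards [eventually_notMem_of_finite hSfin p₀, CutPlane.eventually_val_ne p₀]
          with p h1 h2
        rw [hval] at h2
        exact ⟨isUnit_one_sub_sandwich hq hs hqs h1, sub_ne_zero.2 h2⟩)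
      have hJ : ∀ j ∈ Finset.univ.erase j₀, p₀.val ≠ lam j := fun j hj h => by
        rw [hval] at h
        exact Finset.ne_of_mem_erase hj (hinj (by exact_mod_cast h)).symm
      refine ⟨L + ∑ j ∈ Finset.univ.erase j₀, (I * (p₀.val - lam j : ℂ)⁻¹) • (hb j).toLInf,
        fun g => ?_, fun h => absurd ⟨up, _, hmu, hpe⟩ h⟩
      rw [pairing_add]
      refine ((hL g).add ((tendsto_pairing_sum_poles _ lam (fun j => (hb j).toLInf) hJ g).mono_left
        nhdsWithin_le_nhds)).congr fun p => ?_
      rw [← pairing_add, hF, add_assoc, Finset.add_sum_erase _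
        (fun j => (I * (p.val - lam j : ℂ)⁻¹) • (hb j).toLInf) (Finset.mem_univ j₀)]
    · refine ⟨F p₀, fun g => ?_, fun _ => rfl⟩
      have h1 := (tendsto_pairing_jostInhom hq (hqs.memLp_one hs)
        (isUnit_one_sub_sandwich hq hs hqs hp₀) g).add
        (tendsto_pairing_sum_poles Finset.univ lam (fun j => (hb j).toLInf)
          (fun j _ => hnotS hp₀ j) g)
      simp only [← pairing_add] at h1
      exact h1.mono_left nhdsWithin_le_nhds
  choose L hL hLS using hlim
  have hLc : ∀ g : L1, Continuous fun k => pairing (L k) g := fun g =>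
    continuous_of_tendsto_punctured hSfin (F := fun p => pairing (F p) g)
      (fun p hp => by rw [hLS p hp]) fun p => hL p g
  refine ⟨L, ⟨hLc, fun k hk => ?_⟩, ?_⟩
  · rw [hLS k hk]
    exact hFx k
  · rintro h ⟨hc, hh⟩
    have heq : ∀ p ∉ S, h p = L p := fun p hp => by
      rw [hLS p hp]
      refine Lp.ext ?_
      filter_upwards [hh p hp, hFx p] with x h1 h2
      exact add_left_cancel (h1.symm.trans h2)
    have hdense : Dense Sᶜ := by
      have h1 := (dense_univ (X := CutPlane)).sdiff_finite hSfin
      rwa [← Set.compl_eq_univ_sdiff] at h1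
    funext p
    refine LInf_eq_of_pairing_eq fun g => ?_
    have h2 := (hc g).ext_on hdense (hLc g) fun p hp => by simp only [heq p hp]
    exact congrFun h2 p

/-! ### The homogeneous Jost function -/

theorem coeFn_planeWave (lam : ℝ) :
    planeWave lam =ᵐ[volume] fun x : ℝ => exp (I * lam * x) := MemLp.coeFn_toLp _

theorem conj_exp_I_mul (lam x : ℝ) : conj (exp (I * lam * x)) = exp (-(I * lam * x)) := by
  rw [← exp_conj]
  congr 1
  simp

theorem tendsto_szego_mulQbar_planeWave (q : L2) (lam₀ : ℝ) :
    Tendsto (fun lam => szego (mulQbar q (planeWave lam))) (𝓝 lam₀)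
      (𝓝 (szego (mulQbar q (planeWave lam₀)))) := by
  refine (szego.continuous.tendsto _).comp ?_
  refine tendsto_L2_of_dominated q
    (u := fun lam (x : ℝ) => exp (I * lam * x) - exp (I * lam₀ * x)) 2 ?_ ?_ ?_ ?_
  · refine Eventually.of_forall fun lam => ?_
    filter_upwards [coeFn_mulQbar q (planeWave lam), coeFn_mulQbar q (planeWave lam₀),
      coeFn_planeWave lam, coeFn_planeWave lam₀] with x h1 h2 h3 h4
    rw [h1, h2, h3, h4, ← mul_sub, norm_mul, norm_conj]
  · exact Eventually.of_forall fun lam => Continuous.aestronglyMeasurable (by fun_prop)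
  · refine Eventually.of_forall fun lam => ae_of_all _ fun x => (norm_sub_le _ _).trans ?_
    rw [norm_exp, norm_exp]
    norm_num
  · refine ae_of_all _ fun x => ?_
    have h : Continuous fun lam : ℝ => exp (I * lam * x) - exp (I * lam₀ * x) := by fun_prop
    simpa using h.tendsto lam₀

/-- The source of the homogeneous Jost function vanishes at zero energy. -/
theorem szego_mulQbar_planeWave_zero {q : L2} (hq : q ∈ hardy) :
    szego (mulQbar q (planeWave 0)) = 0 := by
  rw [← szego_star hq]
  congr 1
  refine Lp.ext ?_
  filter_upwards [coeFn_mulQbar q (planeWave 0), coeFn_planeWave 0, coeFn_star q] with x h1 h2 h3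
  rw [h1, h2, h3]
  simp

/-- The vector `(1 - C₊ q̄ R₀(lam ± 0i) q C₊)⁻¹ C₊ q̄ e(lam)`. -/
def jostHomVector (q : L2) (up : Bool) (lam : ℝ) : hardy :=
  Ring.inverse (1 - sandwich q (CutPlane.bdry up lam)) (szego (mulQbar q (planeWave lam)))

theorem jostHom_eq {q : L2} {up : Bool} {lam : ℝ}
    (h : IsUnit (1 - sandwich q (CutPlane.bdry up lam))) :
    jostHom q up lam = planeWave lam +
      freeResolvent (CutPlane.bdry up lam) (mulQ q (jostHomVector q up lam : L2)) := by
  set p := CutPlane.bdry up lam with hp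
  set v : hardy := szego (mulQbar q (planeWave lam)) with hv
  set T : hardy →L[ℂ] hardy := Ring.inverse (1 - sandwich q p) with hT
  have h1 : T (v - sandwich q p v) = v :=
    congrArg (fun A : hardy →L[ℂ] hardy => A v) (Ring.inverse_mul_cancel _ h)
  have h2 : v + T (sandwich q p v) = T v := by
    rw [map_sub] at h1
    nth_rw 1 [← h1]
    abel
  have h3 : jostHom q up lam = planeWave lam + (freeResolvent p (mulQ q (v : L2)) +
      freeResolvent p (mulQ q (T (sandwich q p v) : L2))) := rfl
  have h4 : jostHomVector q up lam = v + T (sandwich q p v) := h2.symm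
  rw [h3, h4, ← map_add, ← map_add]
  rfl

theorem norm_LInf_le {u : LInf} {C : ℝ} (hC : 0 ≤ C) (h : ∀ᵐ x, ‖u x‖ ≤ C) : ‖u‖ ≤ C := by
  rw [Lp.norm_def, eLpNorm_exponent_top]
  exact ENNReal.toReal_le_of_le_ofReal hC (eLpNormEssSup_le_of_ae_bound h)

/-- The product of the conjugate of `e(lam)` and `R₀(lam ± 0i) G`. -/
def modConv (up : Bool) (lam : ℝ) (G : L1) : LInf :=
  (ContinuousLinearMap.mul ℂ ℂ).holder ∞ (star (planeWave lam))
    (freeResolvent (CutPlane.bdry up lam) G)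

theorem coeFn_mod (lam : ℝ) (u : LInf) :
    ((ContinuousLinearMap.mul ℂ ℂ).holder ∞ (star (planeWave lam)) u : LInf) =ᵐ[volume]
      fun x : ℝ => exp (-(I * lam * x)) * u x := by
  have h1 : (star (planeWave lam) : LInf) =ᵐ[volume] fun x => conj (planeWave lam x) :=
    Lp.coeFn_star (planeWave lam)
  filter_upwards [(ContinuousLinearMap.mul ℂ ℂ).coeFn_holder (r := ∞) (star (planeWave lam)) u, h1,
    coeFn_planeWave lam] with x h2 h3 h4
  rw [h2, h3, h4, conj_exp_I_mul]
  rfl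

theorem jostMod_eq {q : L2} {up : Bool} {lam : ℝ}
    (h : IsUnit (1 - sandwich q (CutPlane.bdry up lam))) :
    jostMod q up lam = planeWave 0 + modConv up lam (mulQ q (jostHomVector q up lam : L2)) := by
  refine Lp.ext ?_
  filter_upwards [coeFn_mod lam (jostHom q up lam),
    coeFn_mod lam (freeResolvent (CutPlane.bdry up lam) (mulQ q (jostHomVector q up lam : L2))),
    Lp.coeFn_add (planeWave 0) (modConv up lam (mulQ q (jostHomVector q up lam : L2))),
    coeFn_planeWave lam, coeFn_planeWave 0,
    Lp.coeFn_add (planeWave lam)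
      (freeResolvent (CutPlane.bdry up lam) (mulQ q (jostHomVector q up lam : L2)))]
    with x h1 h2 h3 h4 h5 h6
  rw [jostMod, h1, h3, Pi.add_apply, modConv, h2, jostHom_eq h, h6, Pi.add_apply, h4, h5, mul_add,
    ← exp_add]
  simp

theorem norm_modConv_le (up : Bool) (lam : ℝ) (G : L1) : ‖modConv up lam G‖ ≤ ‖G‖ := by
  have h0 : ‖modConv up lam G‖ ≤ ‖freeResolvent (CutPlane.bdry up lam) G‖ := by
    refine norm_LInf_le (norm_nonneg _) ?_
    filter_upwards [coeFn_mod lam (freeResolvent (CutPlane.bdry up lam) G),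
      ae_le_eLpNormEssSup (f := freeResolvent (CutPlane.bdry up lam) G) (μ := volume)] with x h1 h2
    rw [modConv, h1, norm_mul, norm_exp_neg_I_mul, one_mul, Lp.norm_def, eLpNorm_exponent_top,
      ← toReal_enorm]
    refine ENNReal.toReal_mono ?_ h2
    have := Lp.eLpNorm_ne_top (freeResolvent (CutPlane.bdry up lam) G)
    rwa [eLpNorm_exponent_top] at this
  refine h0.trans (((freeResolvent _).le_opNorm _).trans ?_)
  exact mul_le_of_le_one_left (norm_nonneg _) (norm_freeResolvent_le _)

theorem modConv_sub (up : Bool) (lam : ℝ) (G G' : L1) :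
    modConv up lam (G - G') = modConv up lam G - modConv up lam G' := by
  refine Lp.ext ?_
  filter_upwards [coeFn_mod lam (freeResolvent (CutPlane.bdry up lam) (G - G')),
    coeFn_mod lam (freeResolvent (CutPlane.bdry up lam) G),
    coeFn_mod lam (freeResolvent (CutPlane.bdry up lam) G'),
    Lp.coeFn_sub (modConv up lam G) (modConv up lam G'),
    Lp.coeFn_sub (freeResolvent (CutPlane.bdry up lam) G) (freeResolvent (CutPlane.bdry up lam) G')]
    with x h1 h2 h3 h4 h5
  rw [h4, Pi.sub_apply, modConv, modConv, modConv, h1, h2, h3, map_sub, h5, Pi.sub_apply, mul_sub]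

/-- Modulation turns the boundary value of the free resolvent at `lam` into the one at zero, whose kernel
is constant on each side. -/
theorem exp_mul_resConv (up : Bool) (lam : ℝ) (g : ℝ → ℂ) (x : ℝ) :
    exp (-(I * lam * x)) * resConv up lam g x =
      resConv up 0 (fun y : ℝ => exp (-(I * lam * y)) * g y) x := by
  rw [resConv, resConv, ← integral_const_mul]
  refine integral_congr_ae (ae_of_all _ fun y => ?_)
  have h : exp (I * lam * ((x - y : ℝ) : ℂ)) * exp (-(I * lam * x)) = exp (-(I * lam * y)) := by
    rw [← exp_add]
    congr 1
    push_cast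
    ring
  cases up
  · simp only [resKer, Bool.false_eq_true, if_false]
    split_ifs
    · simp only [mul_zero, zero_mul, exp_zero]
      linear_combination (-I * g y) * h
    · ring
  · simp only [resKer, if_true]
    split_ifs
    · simp only [mul_zero, zero_mul, exp_zero]
      linear_combination (I * g y) * h
    · ring

theorem coeFn_modConv (up : Bool) {lam : ℝ} (hlam : 0 < lam) (G : L1) :
    modConv up lam G =ᵐ[volume] resConv up 0 (fun y : ℝ => exp (-(I * lam * y)) * G y) := by
  filter_upwards [coeFn_mod lam (freeResolvent (CutPlane.bdry up lam) G),
    coeFn_freeResolvent (CutPlane.bdry up lam) G] with x h1 h2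
  have h3 : (CutPlane.bdry up lam).side = up := by simp [CutPlane.bdry, hlam, CutPlane.side]
  rw [modConv, h1, h2, CutPlane.val_bdry, h3, exp_mul_resConv]

/-- After modulation, the boundary values of the free resolvent depend continuously in norm on
`lam > 0`. -/
theorem tendsto_modConv (up : Bool) {lam₀ : ℝ} (h₀ : 0 < lam₀) {l : Filter ℝ}
    [l.IsCountablyGenerated] (hl : Tendsto id l (𝓝 lam₀)) {G : ℝ → L1} {G₀ : L1}
    (hG : Tendsto G l (𝓝 G₀)) :
    Tendsto (fun lam => modConv up lam (G lam)) l (𝓝 (modConv up lam₀ G₀)) := by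
  rw [tendsto_iff_norm_sub_tendsto_zero]
  have hGi := L1.integrable_coeFn G₀
  have h1 : Tendsto (fun lam : ℝ => ∫ y : ℝ,
      ‖exp (-(I * lam * y)) * G₀ y - exp (-(I * lam₀ * y)) * G₀ y‖) l (𝓝 0) := by
    rw [← integral_zero ℝ ℝ (μ := volume)]
    refine tendsto_integral_filter_of_dominated_convergence (bound := fun y => 2 * ‖G₀ y‖) ?_ ?_
      (hGi.norm.const_mul 2) (ae_of_all _ fun y => ?_)
    · exact Eventually.of_forall fun lam =>
        ((integrable_exp_mul hGi lam).sub (integrable_exp_mul hGi lam₀)).1.norm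
    · refine Eventually.of_forall fun lam => ae_of_all _ fun y => ?_
      rw [norm_norm]
      refine (norm_sub_le _ _).trans ?_
      rw [norm_mul, norm_mul, norm_exp_neg_I_mul, norm_exp_neg_I_mul]
      linarith
    · have h : Continuous fun lam : ℝ =>
          ‖exp (-(I * lam * y)) * G₀ y - exp (-(I * lam₀ * y)) * G₀ y‖ := by fun_prop
      have h2 := (h.tendsto lam₀).comp hl
      simpa using h2
  have h2 := (tendsto_iff_norm_sub_tendsto_zero.1 hG).add h1
  rw [add_zero] at h2
  refine squeeze_zero' (Eventually.of_forall fun _ => norm_nonneg _) ?_ h2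
  filter_upwards [hl.eventually (lt_mem_nhds h₀)] with lam hlam
  have h3 : modConv up lam (G lam) - modConv up lam₀ G₀ =
      modConv up lam (G lam - G₀) + (modConv up lam G₀ - modConv up lam₀ G₀) := by
    rw [modConv_sub]; abel
  rw [h3]
  refine (norm_add_le _ _).trans (add_le_add (norm_modConv_le _ _ _) ?_)
  refine norm_LInf_le (integral_nonneg fun _ => norm_nonneg _) ?_
  filter_upwards [Lp.coeFn_sub (modConv up lam G₀) (modConv up lam₀ G₀),
    coeFn_modConv up (show 0 < lam from hlam) G₀, coeFn_modConv up h₀ G₀] with x h4 h5 h6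
  have hm : (0 : ℂ) ∈ halfPlane up := by
    have := ofReal_mem_halfPlane up 0
    simpa using this
  rw [h4, Pi.sub_apply, h5, h6, ← resConv_sub hm (integrable_exp_mul hGi lam)
    (integrable_exp_mul hGi lam₀)]
  exact norm_resConv_le hm ((integrable_exp_mul hGi lam).sub (integrable_exp_mul hGi lam₀)) x

section Weighted

variable {s : ℝ} {q : L2}

/-- The vectors `(1 - C₊ q̄ R₀(lam ± 0i) q C₊)⁻¹ C₊ q̄ e(lam)` converge as `lam` tends to an
eigenvalue as well: the singularity is removable since the source `C₊ q̄ e(lam)` is orthogonal to the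
kernel vector at the eigenvalue. -/
theorem exists_tendsto_jostHomVector (hq : q ∈ hardy) (hs : 1 / 2 < s) (hqs : MemWeighted s q)
    (up : Bool) {lam₀ : ℝ} {l : Filter ℝ} (hl : Tendsto id l (𝓝 lam₀))
    (hb : Tendsto (CutPlane.bdry up) l (𝓝 (CutPlane.bdry up lam₀)))
    (hne : ∀ᶠ lam in l, lam ≠ lam₀ ∧ lam ∉ pointSpectrum q) :
    ∃ u₀ : hardy, Tendsto (jostHomVector q up) l (𝓝 u₀) ∧
      (lam₀ ∉ pointSpectrum q → u₀ = jostHomVector q up lam₀) ∧ (lam₀ = 0 → u₀ = 0) := by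
  have hv := (tendsto_szego_mulQbar_planeWave q lam₀).comp hl
  by_cases h₀ : lam₀ ∈ pointSpectrum q
  · obtain ⟨φ, hφ⟩ := h₀
    obtain ⟨f, hf, hf0⟩ := hφ.exists_isBoundState
    have hφi := hf.1.integrable_boundFn hs hqs
    have hβ : Tendsto (fun lam : ℝ => conj (angularFourier (boundFn q lam₀ f) lam)) l
        (𝓝 (conj (angularFourier (boundFn q lam₀ f) lam₀))) :=
      ((continuous_conj.comp (continuous_angularFourier hφi)).tendsto lam₀).comp hl
    have hfw : ∀ lam : ℝ, inner ℂ f (szego (mulQbar q (planeWave lam))) =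
        0 + ((CutPlane.bdry up lam).val - lam₀) *
          conj (angularFourier (boundFn q lam₀ f) lam) := by
      intro lam
      have h1 : conj (angularFourier (density q f) lam) =
          ∫ x, planeWave lam x * conj (density q f x) := by
        rw [angularFourier, ← integral_conj]
        refine integral_congr_ae ?_
        filter_upwards [coeFn_planeWave lam] with x hx
        rw [hx, map_mul, ← conj_exp_I_mul, conj_conj]
      -- `⟨C₊ q̄ e(lam), f⟩` is the conjugate of the Fourier transform of `q f` at `lam`, which vanishes at
      -- `lam₀`.
      have h2 := sub_mul_angularFourier_resConv lam₀ (integrable_density q f)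
        (hf.1.integrable_moment hs hqs) hf.1.fourier_eq_zero lam
      rw [inner_szego_mulQbar_right, ← h1, ← h2, CutPlane.val_bdry, map_mul, map_sub, conj_ofReal,
        conj_ofReal, zero_add]
      rfl
    obtain ⟨r, r₀, hr, hev, hz⟩ := hf.exists_regular_part hf0 hq hs hqs hb
      (CutPlane.val_bdry up lam₀) hv hβ hfw
    refine ⟨r₀, hr.congr' ?_, fun h => absurd ⟨φ, hφ⟩ h, fun h => hz rfl ?_ ?_⟩
    · filter_upwards [hne, hev] with lam h1 h2
      have h3 : (CutPlane.bdry up lam).val - (lam₀ : ℂ) ≠ 0 := by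
        rw [CutPlane.val_bdry]
        exact sub_ne_zero.2 (by exact_mod_cast h1.1)
      have h4 := h2 h3 (jostHomVector q up lam) (sub_sandwich_inverse
        (isUnit_one_sub_sandwich hq hs hqs (CutPlane.bdry_notMem_diamond h1.2)) _)
      rw [h4]
      simp
    -- At `lam₀ = 0` the Fourier transform of the bound state vanishes, so that the numbers `β` tend to zero.
    · rw [hf.1.negFreq_boundFn hq hs hqs lam₀ h.le, map_zero]
    · rw [h]
      exact szego_mulQbar_planeWave_zero hq
  · refine ⟨jostHomVector q up lam₀, tendsto_inverse_one_sub_sandwich hq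
      (isUnit_one_sub_sandwich hq hs hqs (CutPlane.bdry_notMem_diamond h₀)) hb hv, fun _ => rfl,
      fun h => ?_⟩
    rw [jostHomVector, h, szego_mulQbar_planeWave_zero hq, map_zero]

/-- The modulated Jost function extends continuously across the embedded eigenvalues. -/
theorem existsUnique_extension_jostMod (hq : q ∈ hardy) (hs : 1 / 2 < s) (hqs : MemWeighted s q)
    (up : Bool) : ∃! M : Set.Ioi (0 : ℝ) → LInf, Continuous M ∧
      ∀ lam : Set.Ioi (0 : ℝ), (lam : ℝ) ∉ pointSpectrum q → M lam = jostMod q up lam := by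
  have hfin := finite_pointSpectrum hs hqs
  set S : Set (Set.Ioi (0 : ℝ)) := Subtype.val ⁻¹' pointSpectrum q with hS
  have hSfin : S.Finite := hfin.preimage Subtype.val_injective.injOn
  have hlim : ∀ x : Set.Ioi (0 : ℝ), ∃ M : LInf,
      Tendsto (fun y : Set.Ioi (0 : ℝ) => jostMod q up y) (𝓝[≠] x) (𝓝 M) ∧
      (x ∉ S → M = jostMod q up x) := by
    rintro ⟨lam₀, h₀⟩
    have hl : Tendsto id (𝓝[≠] lam₀) (𝓝 lam₀) := nhdsWithin_le_nhds
    have hne : ∀ᶠ lam in 𝓝[≠] lam₀, lam ≠ lam₀ ∧ lam ∉ pointSpectrum q :=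
      eventually_mem_nhdsWithin.and (eventually_notMem_of_finite hfin lam₀)
    obtain ⟨u₀, hu, hu', -⟩ := exists_tendsto_jostHomVector hq hs hqs up hl
      ((CutPlane.continuousAt_bdry up h₀).tendsto.comp hl) hne
    have hG : Tendsto (fun lam => mulQ q (jostHomVector q up lam : L2)) (𝓝[≠] lam₀)
        (𝓝 (mulQ q (u₀ : L2))) :=
      ((mulQ q).continuous.tendsto _).comp ((continuous_subtype_val.tendsto u₀).comp hu)
    have h1 : Tendsto (fun lam => jostMod q up lam) (𝓝[≠] lam₀)
        (𝓝 (planeWave 0 + modConv up lam₀ (mulQ q (u₀ : L2)))) := by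
      refine ((tendsto_modConv up h₀ hl hG).const_add (planeWave 0)).congr' ?_
      filter_upwards [hne] with lam h2
      exact (jostMod_eq
        (isUnit_one_sub_sandwich hq hs hqs (CutPlane.bdry_notMem_diamond h2.2))).symm
    refine ⟨_, h1.comp (tendsto_nhdsWithin_iff.2
      ⟨(continuous_subtype_val.tendsto _).mono_left nhdsWithin_le_nhds, ?_⟩), fun h => ?_⟩
    · filter_upwards [self_mem_nhdsWithin] with y hy
      exact fun h => hy (Subtype.ext h)
    · rw [jostMod_eq (isUnit_one_sub_sandwich hq hs hqs (CutPlane.bdry_notMem_diamond h)), hu' h]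
  choose M hM hMS using hlim
  refine ⟨M, ⟨continuous_of_tendsto_punctured hSfin hMS hM, hMS⟩, ?_⟩
  rintro M' ⟨hc, hM'⟩
  have hne : ∀ x : Set.Ioi (0 : ℝ), (𝓝[≠] x).NeBot := fun x => by
    have h : (𝓝[>] x).NeBot := inferInstance
    exact h.mono (nhdsWithin_mono _ fun y hy => ne_of_gt hy)
  have hdense : Dense Sᶜ := by
    have h1 := (dense_univ (X := Set.Ioi (0 : ℝ))).sdiff_finite hSfin
    rwa [← Set.compl_eq_univ_sdiff] at h1
  exact hc.ext_on hdense (continuous_of_tendsto_punctured hSfin hMS hM) fun x hx => by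
    rw [hM' x hx, hMS x hx]

/-- Zero may itself be an eigenvalue; the regular part of the solution still vanishes there. -/
theorem tendsto_norm_jostMod_sub (hq : q ∈ hardy) (hs : 1 / 2 < s) (hqs : MemWeighted s q)
    (up : Bool) :
    Tendsto (fun lam : ℝ => ‖jostMod q up lam - planeWave 0‖) (𝓝[>] 0) (𝓝 0) := by
  have hle : 𝓝[>] (0 : ℝ) ≤ 𝓝[≠] 0 := nhdsWithin_mono _ fun y hy => ne_of_gt hy
  have hne : ∀ᶠ lam in 𝓝[>] (0 : ℝ), lam ≠ 0 ∧ lam ∉ pointSpectrum q :=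
    hle (eventually_mem_nhdsWithin.and
      (eventually_notMem_of_finite (finite_pointSpectrum hs hqs) (0 : ℝ)))
  obtain ⟨u₀, hu, -, hu0⟩ := exists_tendsto_jostHomVector hq hs hqs up
    (show Tendsto id (𝓝[>] (0 : ℝ)) (𝓝 0) from nhdsWithin_le_nhds)
    (CutPlane.tendsto_bdry_zero up) hne
  rw [hu0 rfl] at hu
  have hG : Tendsto (fun lam => ‖mulQ q (jostHomVector q up lam : L2)‖) (𝓝[>] 0) (𝓝 0) := by
    have h1 : Tendsto (fun lam => mulQ q (jostHomVector q up lam : L2)) (𝓝[>] 0)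
        (𝓝 (mulQ q ((0 : hardy) : L2))) :=
      ((mulQ q).continuous.tendsto _).comp ((continuous_subtype_val.tendsto 0).comp hu)
    have h2 : mulQ q ((0 : hardy) : L2) = 0 := map_zero _
    rw [h2] at h1
    simpa using h1.norm
  refine squeeze_zero' (Eventually.of_forall fun _ => norm_nonneg _) ?_ hG
  filter_upwards [hne] with lam h
  rw [jostMod_eq (isUnit_one_sub_sandwich hq hs hqs (CutPlane.bdry_notMem_diamond h.2)),
    add_sub_cancel_left]
  exact norm_modConv_le _ _ _

end Weighted

end

end CalogeroMoser

open CalogeroMoser in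
theorem mainTheorem7 (s : ℝ) (hs : 1 / 2 < s) (q : L2) (hq : q ∈ hardy)
    (hqs : MemWeighted s q) :
    -- finitely many eigenvalues, all simple, with eigenfunctions that can be normalised
    (pointSpectrum q).Finite ∧
    (∀ lam ∈ pointSpectrum q,
      ∃! φ : hardy, IsEigenfunction q lam φ ∧
        pairing q (φ : L2) = 2 * Real.pi * Complex.I) ∧
    -- the Jost functions are well defined away from the eigenvalues
    (∀ k : CutPlane, k ∉ CutPlane.diamond (pointSpectrum q) → IsUnit (1 - sandwich q k)) ∧
    -- (a)
    (∀ (N : ℕ) (lam : Fin N → ℝ) (φ : Fin N → hardy),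
      Function.Injective lam → Set.range lam = pointSpectrum q →
      (∀ j, IsEigenfunction q (lam j) (φ j)) →
      (∀ j, pairing q (φ j : L2) = 2 * Real.pi * Complex.I) →
      ∃! h : CutPlane → LInf,
        (∀ f : L1, Continuous fun k => pairing (h k) f) ∧
        ∀ k : CutPlane, k ∉ CutPlane.diamond (pointSpectrum q) →
          ∀ᵐ x ∂(MeasureTheory.volume : MeasureTheory.Measure ℝ),
            jostInhom q (hqs.memLp_one hs) k x =
              -Complex.I * ∑ j, (φ j : L2) x / (k.val - (lam j : ℂ)) + h k x) ∧
    -- (b)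
    (∀ up : Bool,
      (∃! M : Set.Ioi (0 : ℝ) → LInf,
        Continuous M ∧
        ∀ lam : Set.Ioi (0 : ℝ), (lam : ℝ) ∉ pointSpectrum q → M lam = jostMod q up lam) ∧
      Filter.Tendsto (fun lam : ℝ => ‖jostMod q up lam - planeWave 0‖)
        (nhdsWithin 0 (Set.Ioi 0)) (nhds 0)) :=
  ⟨finite_pointSpectrum hs hqs, fun _ => existsUnique_eigenfunction hs hqs,
    fun _ => isUnit_one_sub_sandwich hq hs hqs,
    fun _ _ _ hinj hrange hφ hn => existsUnique_regular_part_jostInhom hs hq hqs hinj hrange hφ hn,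
    fun up => ⟨existsUnique_extension_jostMod hq hs hqs up, tendsto_norm_jostMod_sub hq hs hqs up⟩⟩
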